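/- Let $p$ be a prime number. Let $E$ be a field of characteristic $p$, complete for a real-valued valuation $v$, and assume that $E$ is perfect or that $v$ is discrete. Let $\Gamma$ be a Cohen ring of $E$ (a complete discrete valuation ring of characteristic $0$ with maximal ideal $p\Gamma$ and residue field $E$) with a Frobenius lift $\varphi$, i.e. a ring endomorphism of $\Gamma$ that induces $x\mapsto x^p$ on $E$. Let $\Gamma\hookrightarrow W(E^{\mathrm{pf}})$ be the induced embedding compatible with the Frobenius maps, where $E^{\mathrm{pf}}$ is the perfect closure of $E$ with the unique extension of $v$. For $x=\sum_{k\ge 0}p^k[x_k]\in W(E^{\mathrm{pf}})$ and a real number $s>0$ put $$v^{\le n}(x)=\min_{k\le n}v(x_k),\qquad w_s(x)=\inf_n\{s\,v^{\le n}(x)+n\}.$$ For real $r>0$ let $\Gamma_r=\{x\in\Gamma:\ r\,v^{\le n}(x)+n\to\infty\text{ as }n\to\infty\}$, a subring of $\Gamma$, and let $\Gamma_{\mathrm{an},r}$ be the completion of $\Gamma_r[p^{-1}]$ for the Fréchet topology defined by the valuations $w_s$, $0<s\le r$. Say that $\Gamma$ has enough $r$-units if every nonzero element of $E$ lifts to a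 unit of $\Gamma_r$. Suppose that $\Gamma$ has enough $r_0$-units and let $0<r<r_0$. Write $R=\Gamma_{\mathrm{an},r}$. Then $R$ is an adequate integral domain, that is: $R$ is an integral domain; every finitely generated ideal of $R$ is principal; and for all $a,b\in R$ with $a\ne 0$ there is a decomposition $a=a_1a_2$ in $R$ such that $(a_1,b)=R$ and $(a_3,b)\ne R$ for every non-unit $a_3\in R$ dividing $a_2$. Moreover the elementary divisor theorem holds over $R$: if $N\subset M$ are finite free $R$-modules of ranks $n$ and $m$, then there are a basis $e_1,\dots,e_m$ of $M$, a basis $f_1,\dots,f_n$ of $N$ and non-zero elements $\lambda_1\mid\dots\mid\lambda_n$ of $R$ such that $f_i=\lambda_ie_i$ for $1\le i\le n$. -/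

import Mathlib

open scoped NNReal
open Filter Topology

namespace Overconvergent
noncomputable section

/-- A Cohen ring `Γ` of the field `E` of characteristic `p` (a complete discrete valuation ring of
characteristic zero with maximal ideal `pΓ`, together with an identification of its residue field
with `E`), together with a Frobenius lift, i.e. a ring endomorphism `frob` of `Γ` inducing
`x ↦ x ^ p` on `E`. -/
structure FrobeniusCohenRing (p : ℕ) (E : Type*) [Field E] (Γ : Type*) [CommRing Γ] where
  isDomain : IsDomain Γ
  isDiscreteValuationRing : IsDiscreteValuationRing Γ
  charZero : CharZero Γ
  isAdicComplete : IsAdicComplete (Ideal.span {(p : Γ)}) Γ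
  residue : Γ →+* E
  residue_surjective : Function.Surjective residue
  ker_residue : RingHom.ker residue = Ideal.span {(p : Γ)}
  frob : Γ →+* Γ
  residue_frob : ∀ x, residue (frob x) = residue x ^ p

section Dwork

variable {p : ℕ} [hp : Fact p.Prime] {A : Type*} [CommRing A]

theorem ghost_eq_sum (y : WittVector p A) (n : ℕ) :
    WittVector.ghostComponent n y =
      ∑ i ∈ Finset.range (n + 1), (p : A) ^ i * y.coeff i ^ p ^ (n - i) := by
  rw [WittVector.ghostComponent_apply, wittPolynomial_eq_sum_C_mul_X_pow]
  simp

theorem ghost_injective (hA : ∀ a : A, (p : A) * a = 0 → a = 0) :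
    Function.Injective (WittVector.ghostMap : WittVector p A → ℕ → A) := by
  have hpow : ∀ (n : ℕ) (a : A), (p : A) ^ n * a = 0 → a = 0 := by
    intro n
    induction n with
    | zero => intro a h; simpa using h
    | succ n ih =>
      intro a h
      rw [pow_succ', mul_assoc] at h
      exact ih a (hA _ h)
  intro x y hxy
  ext n
  induction n using Nat.strong_induction_on with
  | _ n ih =>
    have h : WittVector.ghostComponent n x = WittVector.ghostComponent n y := congrFun hxy n
    rw [ghost_eq_sum, ghost_eq_sum, Finset.sum_range_succ, Finset.sum_range_succ,
      Finset.sum_congr rfl (fun i hi => by rw [ih i (Finset.mem_range.mp hi)])] at h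
    have h2 := add_left_cancel h
    simp only [Nat.sub_self, pow_zero, pow_one] at h2
    exact sub_eq_zero.mp (hpow n _ (by rw [mul_sub, h2, sub_self]))

theorem exists_ghost (f : A →+* A) (hf : ∀ a, (p : A) ∣ f a - a ^ p) (x : A) :
    ∃ y : WittVector p A, ∀ n, WittVector.ghostComponent n y = f^[n] x := by
  have key : ∀ (n : ℕ) (c : ℕ → A),
      (∑ i ∈ Finset.range (n + 1), (p : A) ^ i * c i ^ p ^ (n - i) = f^[n] x) →
      ∃ d : A, ∑ i ∈ Finset.range (n + 1), (p : A) ^ i * c i ^ p ^ (n + 1 - i)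
        + (p : A) ^ (n + 1) * d = f^[n + 1] x := by
    intro n c hc
    have hdvd : (p : A) ^ (n + 1) ∣ f^[n + 1] x
        - ∑ i ∈ Finset.range (n + 1), (p : A) ^ i * c i ^ p ^ (n + 1 - i) := by
      rw [Function.iterate_succ_apply', ← hc, map_sum, ← Finset.sum_sub_distrib]
      refine Finset.dvd_sum fun i hi => ?_
      have hi' : i ≤ n := Nat.lt_succ_iff.mp (Finset.mem_range.mp hi)
      rw [map_mul, map_pow, map_pow, map_natCast, ← mul_sub]
      have h1 : (p : A) ^ (n - i + 1) ∣ f (c i) ^ p ^ (n - i) - (c i ^ p) ^ p ^ (n - i) :=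
        dvd_sub_pow_of_dvd_sub (hf (c i)) (n - i)
      have h2 : (c i ^ p) ^ p ^ (n - i) = c i ^ p ^ (n + 1 - i) := by
        rw [← pow_mul, ← pow_succ', Nat.succ_sub hi']
      rw [h2] at h1
      have h3 : (p : A) ^ (n + 1) = (p : A) ^ i * (p : A) ^ (n - i + 1) := by
        rw [← pow_add]; congr 1; omega
      rw [h3]
      exact mul_dvd_mul_left _ h1
    obtain ⟨d, hd⟩ := hdvd
    exact ⟨d, by rw [← hd]; ring⟩
  have step : ∀ (n : ℕ) (c : ℕ → A), ∃ d : A,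
      (∑ i ∈ Finset.range (n + 1), (p : A) ^ i * c i ^ p ^ (n - i) = f^[n] x) →
      ∑ i ∈ Finset.range (n + 1), (p : A) ^ i * c i ^ p ^ (n + 1 - i)
        + (p : A) ^ (n + 1) * d = f^[n + 1] x := by
    intro n c
    by_cases h : ∑ i ∈ Finset.range (n + 1), (p : A) ^ i * c i ^ p ^ (n - i) = f^[n] x
    · obtain ⟨d, hd⟩ := key n c h
      exact ⟨d, fun _ => hd⟩
    · exact ⟨0, fun h' => absurd h' h⟩
  choose d hd using step
  let s : ℕ → ℕ → A := fun n => Nat.rec (fun _ => x)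
    (fun n c => Function.update c (n + 1) (d n c)) n
  have hs : ∀ n, s (n + 1) = Function.update (s n) (n + 1) (d n (s n)) := fun _ => rfl
  have hstab : ∀ n i, i ≤ n → s n i = s i i := by
    intro n
    induction n with
    | zero => intro i hi; rw [Nat.le_zero.mp hi]
    | succ n ih =>
      intro i hi
      rcases Nat.lt_or_ge n i with h | h
      · rw [le_antisymm hi h]
      · rw [hs, Function.update_of_ne (by omega), ih i h]
  have hsum : ∀ n, ∑ i ∈ Finset.range (n + 1), (p : A) ^ i * s n i ^ p ^ (n - i) = f^[n] x := by
    intro n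
    induction n with
    | zero => simp [s]
    | succ n ih =>
      rw [Finset.sum_range_succ, ← hd n (s n) ih]
      congr 1
      · refine Finset.sum_congr rfl fun i hi => ?_
        rw [hs, Function.update_of_ne (by have := Finset.mem_range.mp hi; omega)]
      · rw [hs]; simp
  refine ⟨WittVector.mk p fun i => s i i, fun n => ?_⟩
  rw [ghost_eq_sum, ← hsum n]
  refine Finset.sum_congr rfl fun i hi => ?_
  rw [WittVector.coeff_mk, hstab n i (Nat.lt_succ_iff.mp (Finset.mem_range.mp hi))]

/-- For a `p`-torsion-free ring `A` with a Frobenius lift `f`, the ring homomorphism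
`A → W(A)` whose ghost components are the iterates of `f`. -/
def cartierMap (hA : ∀ a : A, (p : A) * a = 0 → a = 0) (f : A →+* A)
    (hf : ∀ a, (p : A) ∣ f a - a ^ p) : A →+* WittVector p A :=
  have spec : ∀ x, WittVector.ghostMap (Classical.choose (exists_ghost (p := p) f hf x)) =
      fun n => (f ^ n) x := fun x => by
    funext n
    rw [WittVector.ghostMap_apply, Classical.choose_spec (exists_ghost (p := p) f hf x) n,
      RingHom.coe_pow]
  { toFun := fun x => Classical.choose (exists_ghost (p := p) f hf x)
    map_one' := ghost_injective hA (by rw [spec, map_one]; funext n; simp)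
    map_mul' := fun x y => ghost_injective hA (by rw [spec, map_mul, spec, spec]; funext n; simp)
    map_zero' := ghost_injective hA (by rw [spec, map_zero]; funext n; simp)
    map_add' := fun x y =>
      ghost_injective hA (by rw [spec, map_add, spec, spec]; funext n; simp) }

theorem ghostComponent_cartierMap (hA : ∀ a : A, (p : A) * a = 0 → a = 0) (f : A →+* A)
    (hf : ∀ a, (p : A) ∣ f a - a ^ p) (x : A) (n : ℕ) :
    WittVector.ghostComponent n (cartierMap hA f hf x) = f^[n] x :=
  Classical.choose_spec (exists_ghost (p := p) f hf x) n

end Dwork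

section PerfectClosureNorm

variable (p : ℕ) [hp : Fact p.Prime] {E : Type*} [NormedField E] [CharP E p]

/-- The unique extension of the norm of `E` to its perfect closure: the `p ^ n`-th root of `y` has
norm `‖y‖ ^ (1 / p ^ n)`. The additive valuation `v` is related to the norm by `‖y‖ = p ^ (-v y)`. -/
def pfNorm (x : PerfectClosure E p) : ℝ≥0 :=
  PerfectClosure.liftOn x (fun y => ‖y.2‖₊ ^ ((p : ℝ) ^ y.1)⁻¹) (by
    rintro _ _ ⟨n, y⟩
    have hp0 : (p : ℝ) ≠ 0 := Nat.cast_ne_zero.mpr hp.out.ne_zero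
    simp only [frobenius_def, nnnorm_pow]
    rw [← NNReal.rpow_natCast, ← NNReal.rpow_mul]
    congr 1
    rw [pow_succ]
    field_simp)

theorem pfNorm_mk (n : ℕ) (y : E) :
    pfNorm p (PerfectClosure.mk E p (n, y)) = ‖y‖₊ ^ ((p : ℝ) ^ n)⁻¹ := rfl

theorem pfNorm_mk_add (n m : ℕ) (y : E) :
    ‖(frobenius E p)^[m] y‖₊ ^ ((p : ℝ) ^ (n + m))⁻¹ = ‖y‖₊ ^ ((p : ℝ) ^ n)⁻¹ := by
  have hp0 : (p : ℝ) ≠ 0 := Nat.cast_ne_zero.mpr hp.out.ne_zero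
  rw [iterate_frobenius, nnnorm_pow, ← NNReal.rpow_natCast, ← NNReal.rpow_mul]
  congr 1
  rw [pow_add]
  push_cast
  field_simp

theorem pfNorm_zero : pfNorm p (0 : PerfectClosure E p) = 0 := by
  rw [PerfectClosure.zero_def, pfNorm_mk]; simp

theorem pfNorm_one : pfNorm p (1 : PerfectClosure E p) = 1 := by
  rw [PerfectClosure.one_def, pfNorm_mk]; simp

theorem pfNorm_of (x : E) : pfNorm p (PerfectClosure.of E p x) = ‖x‖₊ := by
  rw [PerfectClosure.of_apply, pfNorm_mk]; simp

theorem pfNorm_mul (x y : PerfectClosure E p) : pfNorm p (x * y) = pfNorm p x * pfNorm p y := by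
  obtain ⟨⟨n, x⟩, rfl⟩ := PerfectClosure.mk_surjective E p x
  obtain ⟨⟨m, y⟩, rfl⟩ := PerfectClosure.mk_surjective E p y
  rw [PerfectClosure.mk_mul_mk, pfNorm_mk, pfNorm_mk, pfNorm_mk]
  simp only [nnnorm_mul, NNReal.mul_rpow]
  rw [pfNorm_mk_add, add_comm n m, pfNorm_mk_add]

theorem pfNorm_neg (x : PerfectClosure E p) : pfNorm p (-x) = pfNorm p x := by
  obtain ⟨⟨n, x⟩, rfl⟩ := PerfectClosure.mk_surjective E p x
  rw [PerfectClosure.neg_mk, pfNorm_mk, pfNorm_mk, nnnorm_neg]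

theorem pfNorm_add_le [IsUltrametricDist E] (x y : PerfectClosure E p) :
    pfNorm p (x + y) ≤ max (pfNorm p x) (pfNorm p y) := by
  obtain ⟨⟨n, x⟩, rfl⟩ := PerfectClosure.mk_surjective E p x
  obtain ⟨⟨m, y⟩, rfl⟩ := PerfectClosure.mk_surjective E p y
  rw [PerfectClosure.mk_add_mk, pfNorm_mk, pfNorm_mk, pfNorm_mk, ← pfNorm_mk_add p n m x,
    ← pfNorm_mk_add p m n y, add_comm m n]
  have h : (0 : ℝ) ≤ ((p : ℝ) ^ (n + m))⁻¹ := by positivity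
  rw [← (NNReal.monotone_rpow_of_nonneg h).map_max]
  exact NNReal.rpow_le_rpow (IsUltrametricDist.nnnorm_add_le_max _ _) h

theorem pfNorm_pow (x : PerfectClosure E p) (n : ℕ) : pfNorm p (x ^ n) = pfNorm p x ^ n := by
  induction n with
  | zero => simp [pfNorm_one]
  | succ n ih => rw [pow_succ, pfNorm_mul, ih, pow_succ]

theorem pfNorm_eq_zero {x : PerfectClosure E p} : pfNorm p x = 0 ↔ x = 0 := by
  refine ⟨fun h => ?_, fun h => h ▸ pfNorm_zero p⟩
  by_contra hx
  have := pfNorm_mul p x x⁻¹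
  rw [mul_inv_cancel₀ hx, h, zero_mul, pfNorm_one] at this
  exact one_ne_zero this

end PerfectClosureNorm

/-- The valuation ring of the perfect closure. -/
def pfIntegers (p : ℕ) [Fact p.Prime] (E : Type*) [NormedField E] [CharP E p]
    [IsUltrametricDist E] : Subring (PerfectClosure E p) where
  carrier := {x | pfNorm p x ≤ 1}
  mul_mem' {x y} hx hy := by
    have := mul_le_mul' (show pfNorm p x ≤ 1 from hx) (show pfNorm p y ≤ 1 from hy)
    rw [mul_one, ← pfNorm_mul] at this
    exact this
  one_mem' := (pfNorm_one p).le
  add_mem' {x y} hx hy := (pfNorm_add_le p x y).trans (max_le hx hy)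
  zero_mem' := by simp [pfNorm_zero]
  neg_mem' {x} hx := by simpa [pfNorm_neg] using hx

section WittNorm

variable (p : ℕ) [hp : Fact p.Prime] {E : Type*} [NormedField E] [CharP E p]

/-- The coordinate `x_k` of `x = ∑ p ^ k [x_k]`, i.e. the `p ^ k`-th root of the `k`-th Witt
coefficient of `x`. -/
def teichCoord (x : WittVector p (PerfectClosure E p)) (k : ℕ) : PerfectClosure E p :=
  ((frobeniusEquiv (PerfectClosure E p) p).symm ^ k) (x.coeff k)

/-- The norm `p ^ (-v^{≤ n}(x))` attached to the partial valuation
`v^{≤ n}(∑ p ^ k [x_k]) = min_{k ≤ n} v(x_k)`. -/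
def partialNorm (n : ℕ) (x : WittVector p (PerfectClosure E p)) : ℝ≥0 :=
  (Finset.range (n + 1)).sup fun k => pfNorm p (teichCoord p x k)

/-- The number `p ^ (-(r v^{≤ n}(x) + n))`. -/
def gaussTerm (r : ℝ≥0) (x : WittVector p (PerfectClosure E p)) (n : ℕ) : ℝ≥0 :=
  ((p : ℝ≥0)⁻¹) ^ n * partialNorm p n x ^ (r : ℝ)

/-- The norm `p ^ (-w_r(x))` attached to `w_r(x) = inf_n (r v^{≤ n}(x) + n)`. It is meaningful on
`wittSubring p r`, where the supremum is that of a bounded sequence. -/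
def gaussNorm (r : ℝ≥0) (x : WittVector p (PerfectClosure E p)) : ℝ≥0 :=
  ⨆ n, gaussTerm p r x n

theorem teichCoord_pow (x : WittVector p (PerfectClosure E p)) (k : ℕ) :
    teichCoord p x k ^ p ^ k = x.coeff k := by
  unfold teichCoord
  generalize x.coeff k = c
  induction k generalizing c with
  | zero => simp
  | succ k ih =>
    rw [pow_succ p, pow_mul, pow_succ, RingAut.mul_apply, ih]
    exact frobeniusEquiv_symm_pow_p _ p c

theorem pfNorm_coeff (x : WittVector p (PerfectClosure E p)) (k : ℕ) :
    pfNorm p (x.coeff k) = pfNorm p (teichCoord p x k) ^ p ^ k := by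
  rw [← teichCoord_pow, pfNorm_pow]

theorem pfNorm_teichCoord_le_iff (x : WittVector p (PerfectClosure E p)) (k : ℕ)
    (c : PerfectClosure E p) :
    pfNorm p (teichCoord p x k) ≤ pfNorm p c ↔ pfNorm p (x.coeff k) ≤ pfNorm p (c ^ p ^ k) := by
  rw [pfNorm_coeff, pfNorm_pow]
  exact (pow_le_pow_iff_left₀ zero_le zero_le (pow_ne_zero _ hp.out.ne_zero)).symm

theorem le_partialNorm (x : WittVector p (PerfectClosure E p)) {k n : ℕ} (h : k ≤ n) :
    pfNorm p (teichCoord p x k) ≤ partialNorm p n x :=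
  Finset.le_sup (f := fun k => pfNorm p (teichCoord p x k)) (Finset.mem_range.mpr (by omega))

theorem partialNorm_le {x : WittVector p (PerfectClosure E p)} {n : ℕ} {c : ℝ≥0}
    (h : ∀ k ≤ n, pfNorm p (teichCoord p x k) ≤ c) : partialNorm p n x ≤ c :=
  Finset.sup_le fun k hk => h k (by have := Finset.mem_range.mp hk; omega)

theorem exists_partialNorm_eq (x : WittVector p (PerfectClosure E p)) (n : ℕ) :
    ∃ c : PerfectClosure E p, partialNorm p n x = pfNorm p c := by
  obtain ⟨k, -, hk⟩ := Finset.exists_mem_eq_sup (Finset.range (n + 1)) (by simp)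
    (fun k => pfNorm p (teichCoord p x k))
  exact ⟨_, hk⟩

theorem partialNorm_mono (x : WittVector p (PerfectClosure E p)) :
    Monotone fun n => partialNorm p n x := fun _ _ h =>
  partialNorm_le p fun _ hk => le_partialNorm p x (hk.trans h)

theorem partialNorm_congr {x y : WittVector p (PerfectClosure E p)} {n : ℕ}
    (h : ∀ k ≤ n, x.coeff k = y.coeff k) : partialNorm p n x = partialNorm p n y :=
  le_antisymm
    (partialNorm_le p fun k hk => by
      have := le_partialNorm p y hk
      rwa [teichCoord, ← h k hk] at this)
    (partialNorm_le p fun k hk => by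
      have := le_partialNorm p x hk
      rwa [teichCoord, h k hk] at this)

theorem coeff_init (n : ℕ) (x : WittVector p (PerfectClosure E p)) (k : ℕ) :
    (WittVector.init n x).coeff k = if k < n then x.coeff k else 0 := by
  simp only [WittVector.init, WittVector.select, WittVector.coeff_mk]
  split_ifs <;> rfl

theorem teichCoord_of_coeff {x : WittVector p (PerfectClosure E p)} {k : ℕ}
    {c : PerfectClosure E p} (h : x.coeff k = c ^ p ^ k) : teichCoord p x k = c := by
  have h1 := teichCoord_pow p x k
  rw [h, ← iterateFrobenius_def, ← iterateFrobenius_def] at h1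
  exact (iterateFrobenius_inj _ p k) h1

theorem coeff_eq_of_dvd_sub {x y : WittVector p (PerfectClosure E p)} {n : ℕ}
    (h : (p : WittVector p (PerfectClosure E p)) ^ (n + 1) ∣ x - y) :
    ∀ k ≤ n, x.coeff k = y.coeff k := by
  rw [← Ideal.mem_span_singleton, WittVector.mem_span_p_pow_iff_le_coeff_eq_zero,
    ← WittVector.le_coeff_eq_iff_le_sub_coeff_eq_zero] at h
  exact fun k hk => h k (Nat.lt_succ_of_le hk)

theorem dvd_sub_teichSum (x : WittVector p (PerfectClosure E p)) (n : ℕ) :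
    (p : WittVector p (PerfectClosure E p)) ^ (n + 1) ∣
      x - ∑ i ∈ Finset.Iic n, WittVector.teichmuller p (teichCoord p x i) * (p : WittVector p (PerfectClosure E p)) ^ i :=
  WittVector.dvd_sub_sum_teichmuller_iterateFrobeniusEquiv_coeff x n

theorem coeff_teichmuller_mul (c : PerfectClosure E p)
    (x : WittVector p (PerfectClosure E p)) (k : ℕ) :
    (WittVector.teichmuller p c * x).coeff k = c ^ p ^ k * x.coeff k := by
  let z : WittVector p (PerfectClosure E p) := WittVector.mk p fun k => c ^ p ^ k * x.coeff k
  have hz : ∀ i, teichCoord p z i = c * teichCoord p x i := fun i =>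
    teichCoord_of_coeff p (by rw [mul_pow, teichCoord_pow, WittVector.coeff_mk])
  have h1 := dvd_sub_teichSum p z k
  have h2 := (dvd_sub_teichSum p x k).mul_left (WittVector.teichmuller p c)
  have h3 := dvd_sub h2 h1
  have h4 : WittVector.teichmuller p c * (x - ∑ i ∈ Finset.Iic k,
        WittVector.teichmuller p (teichCoord p x i) * (p : WittVector p (PerfectClosure E p)) ^ i)
      - (z - ∑ i ∈ Finset.Iic k,
        WittVector.teichmuller p (teichCoord p z i) * (p : WittVector p (PerfectClosure E p)) ^ i)
      = WittVector.teichmuller p c * x - z := by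
    simp only [hz, map_mul, mul_sub, Finset.mul_sum, mul_assoc]
    ring
  rw [h4] at h3
  exact coeff_eq_of_dvd_sub p h3 k le_rfl

theorem partialNorm_zero (n : ℕ) : partialNorm p n (0 : WittVector p (PerfectClosure E p)) = 0 :=
  le_antisymm (partialNorm_le p fun k _ => by
    rw [teichCoord, WittVector.zero_coeff, map_zero, pfNorm_zero]) zero_le

theorem partialNorm_teichmuller_mul_pow (c : PerfectClosure E p) (m n : ℕ) :
    partialNorm p n (WittVector.teichmuller p c * (p : WittVector p (PerfectClosure E p)) ^ m) ≤
      if m ≤ n then pfNorm p c else 0 := by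
  refine partialNorm_le p fun k hk => ?_
  by_cases hkm : k = m
  · subst hkm
    rw [if_pos hk, teichCoord_of_coeff p (WittVector.teichmuller_mul_pow_coeff k c)]
  · rw [teichCoord, WittVector.teichmuller_mul_pow_coeff_of_ne c hkm, map_zero, pfNorm_zero]
    exact zero_le

theorem inv_p_lt_one : (p : ℝ≥0)⁻¹ < 1 :=
  inv_lt_one_of_one_lt₀ (by exact_mod_cast hp.out.one_lt)

theorem tendsto_inv_p_pow : Tendsto (fun n => (p : ℝ≥0)⁻¹ ^ n) atTop (𝓝 0) :=
  NNReal.tendsto_pow_atTop_nhds_zero_of_lt_one (inv_p_lt_one p)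

theorem gaussTerm_le_rpow {r s : ℝ≥0} (hs : 0 < s) (hsr : s ≤ r)
    (x : WittVector p (PerfectClosure E p)) (n : ℕ) :
    gaussTerm p s x n ≤ gaussTerm p r x n ^ ((s : ℝ) / r) := by
  have hr : (0 : ℝ) < r := NNReal.coe_pos.mpr (hs.trans_le hsr)
  have hq : (s : ℝ) / r ≤ 1 := (div_le_one hr).mpr (by exact_mod_cast hsr)
  have hq0 : 0 < (s : ℝ) / r := div_pos (NNReal.coe_pos.mpr hs) hr
  unfold gaussTerm
  rw [NNReal.mul_rpow, ← NNReal.rpow_mul, mul_div_cancel₀ _ hr.ne']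
  refine mul_le_mul_left ?_ _
  have h0 : 0 < (p : ℝ≥0)⁻¹ ^ n := pow_pos (inv_pos.mpr (by exact_mod_cast hp.out.pos)) n
  calc (p : ℝ≥0)⁻¹ ^ n = ((p : ℝ≥0)⁻¹ ^ n) ^ (1 : ℝ) := (NNReal.rpow_one _).symm
    _ ≤ _ := NNReal.rpow_le_rpow_of_exponent_ge h0 (pow_le_one₀ zero_le (inv_p_lt_one p).le) hq

theorem partialNorm_p_mul (x : WittVector p (PerfectClosure E p)) (n : ℕ) :
    partialNorm p (n + 1) ((p : WittVector p (PerfectClosure E p)) * x) = partialNorm p n x := by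
  have h : ∀ k, teichCoord p ((p : WittVector p (PerfectClosure E p)) * x) (k + 1) =
      teichCoord p x k := fun k => teichCoord_of_coeff p (by
    rw [mul_comm, WittVector.mul_charP_coeff_succ, ← teichCoord_pow p x k, ← pow_mul, ← pow_succ])
  have h0 : teichCoord p ((p : WittVector p (PerfectClosure E p)) * x) 0 = 0 :=
    teichCoord_of_coeff p (by rw [mul_comm, WittVector.mul_charP_coeff_zero]; simp)
  refine le_antisymm (partialNorm_le p fun k hk => ?_) (partialNorm_le p fun k hk => ?_)
  · cases k with
    | zero => rw [h0, pfNorm_zero]; exact zero_le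
    | succ k => rw [h]; exact le_partialNorm p x (by omega)
  · rw [← h]; exact le_partialNorm p _ (by omega)

theorem gaussNorm_zero {r : ℝ≥0} (hr : 0 < r) :
    gaussNorm p r (0 : WittVector p (PerfectClosure E p)) = 0 := by
  simp [gaussNorm, gaussTerm, partialNorm_zero, NNReal.zero_rpow, hr.ne']

variable [IsUltrametricDist E]

theorem coeff_add_integral {x y : WittVector p (PerfectClosure E p)} {n : ℕ}
    (hx : ∀ k ≤ n, pfNorm p (x.coeff k) ≤ 1) (hy : ∀ k ≤ n, pfNorm p (y.coeff k) ≤ 1) :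
    pfNorm p ((x + y).coeff n) ≤ 1 := by
  let O := pfIntegers p E
  have lift : ∀ z : WittVector p (PerfectClosure E p), (∀ k ≤ n, pfNorm p (z.coeff k) ≤ 1) →
      ∃ w : WittVector p O, WittVector.init (n + 1) z = WittVector.map O.subtype w := by
    intro z hz
    refine ⟨WittVector.mk p fun k => if h : k ≤ n then ⟨z.coeff k, hz k h⟩ else 0, ?_⟩
    ext k
    rw [WittVector.map_coeff, WittVector.coeff_mk, coeff_init]
    by_cases h : k ≤ n
    · rw [if_pos (by omega), dif_pos h]; rfl
    · rw [if_neg (by omega), dif_neg h]; simp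
  have hinit : ∀ z : WittVector p (PerfectClosure E p),
      (WittVector.init (n + 1) z).coeff n = z.coeff n := by
    intro z
    rw [coeff_init, if_pos (Nat.lt_succ_self n)]
  obtain ⟨a, ha⟩ := lift x hx
  obtain ⟨b, hb⟩ := lift y hy
  rw [← hinit, WittVector.init_add, hinit, ha, hb, ← map_add, WittVector.map_coeff]
  exact ((a + b).coeff n).2

theorem partialNorm_add_le (n : ℕ) (x y : WittVector p (PerfectClosure E p)) :
    partialNorm p n (x + y) ≤ max (partialNorm p n x) (partialNorm p n y) := by
  obtain ⟨c, hc⟩ : ∃ c : PerfectClosure E p,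
      max (partialNorm p n x) (partialNorm p n y) = pfNorm p c := by
    rcases max_choice (partialNorm p n x) (partialNorm p n y) with h | h <;> rw [h]
    · exact exists_partialNorm_eq p x n
    · exact exists_partialNorm_eq p y n
  have hx : ∀ k ≤ n, pfNorm p (x.coeff k) ≤ pfNorm p (c ^ p ^ k) := fun k hk =>
    (pfNorm_teichCoord_le_iff p x k c).mp
      (((le_partialNorm p x hk).trans (le_max_left _ _)).trans hc.le)
  have hy : ∀ k ≤ n, pfNorm p (y.coeff k) ≤ pfNorm p (c ^ p ^ k) := fun k hk =>
    (pfNorm_teichCoord_le_iff p y k c).mp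
      (((le_partialNorm p y hk).trans (le_max_right _ _)).trans hc.le)
  rw [hc]
  by_cases h0 : c = 0
  · subst h0
    have hz : ∀ z : WittVector p (PerfectClosure E p),
        (∀ k ≤ n, pfNorm p (z.coeff k) ≤ pfNorm p ((0 : PerfectClosure E p) ^ p ^ k)) →
        WittVector.init (n + 1) z = 0 := by
      intro z hz
      ext k
      rw [coeff_init, WittVector.zero_coeff]
      split_ifs with h
      · have := hz k (by omega)
        rw [zero_pow (pow_ne_zero _ hp.out.ne_zero), pfNorm_zero] at this
        exact (pfNorm_eq_zero p).mp (le_antisymm this zero_le)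
      · rfl
    have h1 : WittVector.init (n + 1) (x + y) = 0 := by
      rw [WittVector.init_add, hz x hx, hz y hy, add_zero]
      ext k
      rw [coeff_init]
      simp
    refine partialNorm_le p fun k hk => ?_
    rw [pfNorm_teichCoord_le_iff]
    have h2 := congrArg (fun z => WittVector.coeff z k) h1
    simp only [coeff_init, WittVector.zero_coeff] at h2
    rw [if_pos (by omega)] at h2
    rw [h2, pfNorm_zero]
    exact zero_le
  · have hc0 : ∀ k, pfNorm p (c ^ p ^ k) ≠ 0 := fun k h => pow_ne_zero _ h0 ((pfNorm_eq_zero p).mp h)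
    have scale : ∀ (z : WittVector p (PerfectClosure E p)) (k : ℕ),
        pfNorm p ((WittVector.teichmuller p c⁻¹ * z).coeff k) ≤ 1 ↔
          pfNorm p (z.coeff k) ≤ pfNorm p (c ^ p ^ k) := by
      intro z k
      rw [coeff_teichmuller_mul, pfNorm_mul]
      have h1 : pfNorm p (c⁻¹ ^ p ^ k) = (pfNorm p (c ^ p ^ k))⁻¹ := by
        rw [← mul_eq_one_iff_eq_inv₀ (hc0 k), ← pfNorm_mul, ← mul_pow, inv_mul_cancel₀ h0, one_pow,
          pfNorm_one]
      rw [h1, inv_mul_le_iff₀ (pos_iff_ne_zero.mpr (hc0 k)), mul_one]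
    refine partialNorm_le p fun k hk => ?_
    rw [pfNorm_teichCoord_le_iff, ← scale, mul_add]
    exact coeff_add_integral p (fun j hj => (scale x j).mpr (hx j (hj.trans hk)))
      (fun j hj => (scale y j).mpr (hy j (hj.trans hk)))

theorem partialNorm_sum_le {ι : Type*} (s : Finset ι) (n : ℕ)
    (f : ι → WittVector p (PerfectClosure E p)) {B : ℝ≥0} (h : ∀ i ∈ s, partialNorm p n (f i) ≤ B) :
    partialNorm p n (∑ i ∈ s, f i) ≤ B := by
  classical
  induction s using Finset.induction_on with
  | empty => rw [Finset.sum_empty, partialNorm_zero]; exact zero_le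
  | insert a s ha ih =>
    rw [Finset.sum_insert ha]
    exact (partialNorm_add_le p n _ _).trans (max_le (h a (Finset.mem_insert_self a s))
      (ih fun i hi => h i (Finset.mem_insert_of_mem hi)))

theorem partialNorm_mul_le_of (x y : WittVector p (PerfectClosure E p)) (n : ℕ) {B : ℝ≥0}
    (h : ∀ i j, i + j ≤ n → pfNorm p (teichCoord p x i) * pfNorm p (teichCoord p y j) ≤ B) :
    partialNorm p n (x * y) ≤ B := by
  have h1 := dvd_sub_teichSum p x n
  have h2 := dvd_sub_teichSum p y n
  set X := ∑ i ∈ Finset.Iic n, WittVector.teichmuller p (teichCoord p x i) *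
    (p : WittVector p (PerfectClosure E p)) ^ i with hX
  set Y := ∑ i ∈ Finset.Iic n, WittVector.teichmuller p (teichCoord p y i) *
    (p : WittVector p (PerfectClosure E p)) ^ i with hY
  have h3 : (p : WittVector p (PerfectClosure E p)) ^ (n + 1) ∣ x * y - X * Y := by
    have : x * y - X * Y = (x - X) * y + X * (y - Y) := by ring
    rw [this]
    exact dvd_add (h1.mul_right y) (h2.mul_left X)
  rw [partialNorm_congr p (coeff_eq_of_dvd_sub p h3), hX, hY, Finset.sum_mul_sum]
  refine partialNorm_sum_le p _ n _ fun i _ => partialNorm_sum_le p _ n _ fun j _ => ?_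
  have h5 : WittVector.teichmuller p (teichCoord p x i) *
      (p : WittVector p (PerfectClosure E p)) ^ i * (WittVector.teichmuller p (teichCoord p y j) *
      (p : WittVector p (PerfectClosure E p)) ^ j) =
      WittVector.teichmuller p (teichCoord p x i * teichCoord p y j) *
      (p : WittVector p (PerfectClosure E p)) ^ (i + j) := by
    rw [map_mul, pow_add]; ring
  rw [h5]
  refine (partialNorm_teichmuller_mul_pow p _ _ n).trans ?_
  split_ifs with hij
  · rw [pfNorm_mul]; exact h i j hij
  · exact zero_le

theorem partialNorm_neg_le (n : ℕ) (x : WittVector p (PerfectClosure E p)) :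
    partialNorm p n (-x) ≤ partialNorm p n x := by
  have h1 : ∀ i, pfNorm p (teichCoord p (-1 : WittVector p (PerfectClosure E p)) i) ≤ 1 := by
    intro i
    rw [← pfNorm_one p (E := E), pfNorm_teichCoord_le_iff, one_pow, pfNorm_one]
    have h : (-1 : WittVector p (PerfectClosure E p)) =
        WittVector.map (pfIntegers p E).subtype (-1) := by rw [map_neg, map_one]
    rw [h, WittVector.map_coeff]
    exact (WittVector.coeff (-1 : WittVector p (pfIntegers p E)) i).2
  rw [neg_eq_neg_one_mul]
  refine partialNorm_mul_le_of p _ _ n fun i j hij => ?_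
  exact (mul_le_of_le_one_left zero_le (h1 i)).trans (le_partialNorm p x (by omega))

theorem exists_partialNorm_mul_le (x y : WittVector p (PerfectClosure E p)) (n : ℕ) :
    ∃ i j k, i + j + k = n ∧
      partialNorm p n (x * y) ≤ partialNorm p i x * partialNorm p j y := by
  let s : Finset (ℕ × ℕ) := (Finset.range (n + 1) ×ˢ Finset.range (n + 1)).filter
    fun a => a.1 + a.2 ≤ n
  have hs : s.Nonempty := ⟨(0, 0), by simp [s]⟩
  obtain ⟨a, ha, hmax⟩ := s.exists_max_image
    (fun a => pfNorm p (teichCoord p x a.1) * pfNorm p (teichCoord p y a.2)) hs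
  have ha2 : a.1 + a.2 ≤ n := (Finset.mem_filter.mp ha).2
  refine ⟨a.1, a.2, n - (a.1 + a.2), by omega, ?_⟩
  refine (partialNorm_mul_le_of p x y n fun i j hij => hmax (i, j) ?_).trans
    (mul_le_mul' (le_partialNorm p x le_rfl) (le_partialNorm p y le_rfl))
  simp only [s, Finset.mem_filter, Finset.mem_product, Finset.mem_range]
  omega

theorem exists_gaussTerm_mul_le (r : ℝ≥0) (x y : WittVector p (PerfectClosure E p)) (n : ℕ) :
    ∃ i j k, i + j + k = n ∧
      gaussTerm p r (x * y) n ≤ ((p : ℝ≥0)⁻¹) ^ k * (gaussTerm p r x i * gaussTerm p r y j) := by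
  obtain ⟨i, j, k, hn, h⟩ := exists_partialNorm_mul_le p x y n
  refine ⟨i, j, k, hn, ?_⟩
  have h1 := NNReal.rpow_le_rpow h r.2
  rw [NNReal.mul_rpow] at h1
  unfold gaussTerm
  calc _ ≤ (p : ℝ≥0)⁻¹ ^ n * (partialNorm p i x ^ (r : ℝ) * partialNorm p j y ^ (r : ℝ)) :=
        mul_le_mul_right h1 _
    _ = _ := by rw [← hn, pow_add, pow_add]; ring

theorem gaussTerm_add_le (r : ℝ≥0) (x y : WittVector p (PerfectClosure E p)) (n : ℕ) :
    gaussTerm p r (x + y) n ≤ max (gaussTerm p r x n) (gaussTerm p r y n) := by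
  unfold gaussTerm
  rw [← mul_max_of_nonneg _ _ (zero_le : 0 ≤ (p : ℝ≥0)⁻¹ ^ n),
    ← (NNReal.monotone_rpow_of_nonneg r.coe_nonneg).map_max]
  exact mul_le_mul_right (NNReal.rpow_le_rpow (partialNorm_add_le p n x y) r.2) _

theorem gaussTerm_neg (r : ℝ≥0) (x : WittVector p (PerfectClosure E p)) (n : ℕ) :
    gaussTerm p r (-x) n = gaussTerm p r x n := by
  have h : partialNorm p n (-x) = partialNorm p n x :=
    le_antisymm (partialNorm_neg_le p n x) (by simpa using partialNorm_neg_le p n (-x))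
  rw [gaussTerm, gaussTerm, h]

/-- The ring `W(E^pf)_r` of Witt vectors `x` with `r v^{≤ n}(x) + n → ∞` as `n → ∞`. -/
def wittSubring (r : ℝ≥0) : Subring (WittVector p (PerfectClosure E p)) where
  carrier := {x | Tendsto (gaussTerm p r x) atTop (𝓝 0)}
  zero_mem' := by
    refine tendsto_of_tendsto_of_tendsto_of_le_of_le tendsto_const_nhds (tendsto_inv_p_pow p)
      (fun _ => zero_le) fun n => ?_
    simp only [gaussTerm, partialNorm_zero]
    exact mul_le_of_le_one_right zero_le (NNReal.rpow_le_one zero_le_one r.2)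
  one_mem' := by
    refine tendsto_of_tendsto_of_tendsto_of_le_of_le tendsto_const_nhds (tendsto_inv_p_pow p)
      (fun _ => zero_le) fun n => ?_
    refine mul_le_of_le_one_right zero_le (NNReal.rpow_le_one ?_ r.2)
    have h := partialNorm_teichmuller_mul_pow p (1 : PerfectClosure E p) 0 n
    rwa [map_one, pow_zero, mul_one, if_pos (Nat.zero_le n), pfNorm_one] at h
  add_mem' {x y} hx hy := by
    have h := Tendsto.max hx hy
    rw [max_self] at h
    exact tendsto_of_tendsto_of_tendsto_of_le_of_le tendsto_const_nhds h (fun _ => zero_le)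
      fun n => gaussTerm_add_le p r x y n
  neg_mem' {x} hx := by
    have : gaussTerm p r (-x) = gaussTerm p r x := funext fun n => gaussTerm_neg p r x n
    simpa only [Set.mem_ofPred_eq, this] using hx
  mul_mem' {x y} hx hy := by
    have hx' : Tendsto (gaussTerm p r x) atTop (𝓝 0) := hx
    have hy' : Tendsto (gaussTerm p r y) atTop (𝓝 0) := hy
    obtain ⟨A, hA⟩ := hx'.bddAbove_range
    obtain ⟨B, hB⟩ := hy'.bddAbove_range
    have hA' : ∀ n, gaussTerm p r x n ≤ A := fun n => hA ⟨n, rfl⟩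
    have hB' : ∀ n, gaussTerm p r y n ≤ B := fun n => hB ⟨n, rfl⟩
    have hC' : ∀ k, (p : ℝ≥0)⁻¹ ^ k ≤ 1 := fun k => pow_le_one₀ zero_le (inv_p_lt_one p).le
    have t1 : Tendsto (fun n => gaussTerm p r x n * B) atTop (𝓝 0) := by
      simpa using hx'.mul_const B
    have t2 : Tendsto (fun n => A * gaussTerm p r y n) atTop (𝓝 0) := by
      simpa using hy'.const_mul A
    have t3 : Tendsto (fun n => (p : ℝ≥0)⁻¹ ^ n * (A * B)) atTop (𝓝 0) := by
      simpa using (tendsto_inv_p_pow p).mul_const (A * B)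
    show Tendsto (gaussTerm p r (x * y)) atTop (𝓝 0)
    rw [tendsto_order] at t1 t2 t3 ⊢
    refine ⟨fun a ha => absurd ha (not_lt.mpr zero_le), fun ε hε => ?_⟩
    obtain ⟨N, hN⟩ := Filter.eventually_atTop.mp
      (((t1.2 ε hε).and (t2.2 ε hε)).and (t3.2 ε hε))
    refine Filter.eventually_atTop.mpr ⟨3 * N, fun n hn => ?_⟩
    obtain ⟨i, j, k, hijk, h⟩ := exists_gaussTerm_mul_le p r x y n
    refine h.trans_lt ?_
    rcases (by omega : N ≤ i ∨ N ≤ j ∨ N ≤ k) with hi | hj | hk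
    · refine lt_of_le_of_lt ?_ (hN i hi).1.1
      exact (mul_le_of_le_one_left zero_le (hC' k)).trans (mul_le_mul_right (hB' j) _)
    · refine lt_of_le_of_lt ?_ (hN j hj).1.2
      exact (mul_le_of_le_one_left zero_le (hC' k)).trans (mul_le_mul_left (hA' i) _)
    · exact lt_of_le_of_lt (mul_le_mul_right (mul_le_mul' (hA' i) (hB' j)) _) (hN k hk).2

theorem wittSubring_anti {r s : ℝ≥0} (hs : 0 < s) (hsr : s ≤ r) :
    wittSubring p (E := E) r ≤ wittSubring p s := by
  intro x hx
  have hx' : Tendsto (gaussTerm p r x) atTop (𝓝 0) := hx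
  have hq0 : 0 < (s : ℝ) / r :=
    div_pos (NNReal.coe_pos.mpr hs) (NNReal.coe_pos.mpr (hs.trans_le hsr))
  have h := (NNReal.continuous_rpow_const hq0.le).continuousAt.tendsto.comp hx'
  rw [NNReal.zero_rpow hq0.ne'] at h
  exact tendsto_of_tendsto_of_tendsto_of_le_of_le tendsto_const_nhds h (fun _ => zero_le)
    fun n => gaussTerm_le_rpow p hs hsr x n

theorem gaussTerm_le_gaussNorm {r : ℝ≥0} {x : WittVector p (PerfectClosure E p)}
    (hx : x ∈ wittSubring p r) (n : ℕ) : gaussTerm p r x n ≤ gaussNorm p r x :=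
  le_ciSup (Tendsto.bddAbove_range hx) n

theorem gaussNorm_neg (r : ℝ≥0) (x : WittVector p (PerfectClosure E p)) :
    gaussNorm p r (-x) = gaussNorm p r x := by
  simp only [gaussNorm, gaussTerm_neg]

theorem gaussNorm_add_le {r : ℝ≥0} {x y : WittVector p (PerfectClosure E p)}
    (hx : x ∈ wittSubring p r) (hy : y ∈ wittSubring p r) :
    gaussNorm p r (x + y) ≤ max (gaussNorm p r x) (gaussNorm p r y) :=
  ciSup_le fun n => (gaussTerm_add_le p r x y n).trans
    (max_le_max (gaussTerm_le_gaussNorm p hx n) (gaussTerm_le_gaussNorm p hy n))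

theorem gaussNorm_mul_le {r : ℝ≥0} {x y : WittVector p (PerfectClosure E p)}
    (hx : x ∈ wittSubring p r) (hy : y ∈ wittSubring p r) :
    gaussNorm p r (x * y) ≤ gaussNorm p r x * gaussNorm p r y := by
  refine ciSup_le fun n => ?_
  obtain ⟨i, j, k, -, h⟩ := exists_gaussTerm_mul_le p r x y n
  exact h.trans ((mul_le_of_le_one_left zero_le
    (pow_le_one₀ zero_le (inv_p_lt_one p).le)).trans
      (mul_le_mul' (gaussTerm_le_gaussNorm p hx i) (gaussTerm_le_gaussNorm p hy j)))

theorem gaussNorm_p_mul {r : ℝ≥0} (hr : 0 < r) {x : WittVector p (PerfectClosure E p)}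
    (hx : x ∈ wittSubring p r) :
    gaussNorm p r ((p : WittVector p (PerfectClosure E p)) * x) = (p : ℝ≥0)⁻¹ * gaussNorm p r x := by
  have h : ∀ n, gaussTerm p r ((p : WittVector p (PerfectClosure E p)) * x) (n + 1) =
      (p : ℝ≥0)⁻¹ * gaussTerm p r x n := fun n => by
    rw [gaussTerm, gaussTerm, partialNorm_p_mul, pow_succ]; ring
  have h0 : gaussTerm p r ((p : WittVector p (PerfectClosure E p)) * x) 0 = 0 := by
    have h1 : teichCoord p ((p : WittVector p (PerfectClosure E p)) * x) 0 = 0 :=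
      teichCoord_of_coeff p (by rw [mul_comm, WittVector.mul_charP_coeff_zero]; simp)
    simp [gaussTerm, partialNorm, h1, pfNorm_zero, NNReal.zero_rpow, hr.ne']
  have hpx : (p : WittVector p (PerfectClosure E p)) * x ∈ wittSubring p r :=
    mul_mem (natCast_mem _ p) hx
  refine le_antisymm (ciSup_le fun n => ?_) ?_
  · cases n with
    | zero => rw [h0]; exact zero_le
    | succ n => rw [h]; exact mul_le_mul_right (gaussTerm_le_gaussNorm p hx n) _
  · rw [gaussNorm, NNReal.mul_iSup]
    exact ciSup_le fun n => (h n).symm.le.trans (gaussTerm_le_gaussNorm p hpx _)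

theorem gaussNorm_one (r : ℝ≥0) :
    gaussNorm p r (1 : WittVector p (PerfectClosure E p)) = 1 := by
  have h : ∀ n, partialNorm p n (1 : WittVector p (PerfectClosure E p)) = 1 := by
    intro n
    refine le_antisymm ?_ ?_
    · have h := partialNorm_teichmuller_mul_pow p (1 : PerfectClosure E p) 0 n
      rwa [map_one, pow_zero, mul_one, if_pos (Nat.zero_le n), pfNorm_one] at h
    · have h := le_partialNorm p (1 : WittVector p (PerfectClosure E p)) (Nat.zero_le n)
      rwa [teichCoord_of_coeff p (c := 1) (by simp), pfNorm_one] at h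
  have h2 : ∀ n, gaussTerm p r (1 : WittVector p (PerfectClosure E p)) n = (p : ℝ≥0)⁻¹ ^ n :=
    fun n => by rw [gaussTerm, h, NNReal.one_rpow, mul_one]
  refine le_antisymm (ciSup_le fun n => ?_) ?_
  · rw [h2]; exact pow_le_one₀ zero_le (inv_p_lt_one p).le
  · have := gaussTerm_le_gaussNorm p (one_mem (wittSubring p (E := E) r)) 0
    rwa [h2, pow_zero] at this

end WittNorm
section AwaySeminorm

variable {A : Type*} [CommRing A] (q : A) (c : ℝ≥0) (hc : c ≠ 0) (N : A → ℝ≥0)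
  (hN0 : N 0 = 0) (hN1 : N 1 = 1) (hneg : ∀ x, N (-x) = N x)
  (hadd : ∀ x y, N (x + y) ≤ max (N x) (N y)) (hmul : ∀ x y, N (x * y) ≤ N x * N y)
  (hq : ∀ x, N (q * x) = c * N x)

theorem away_map_mul {A : Type*} [CommRing A] (q : A) (c : ℝ≥0) (N : A → ℝ≥0)
    (hN1 : N 1 = 1) (hq : ∀ x, N (q * x) = c * N x) (s : Submonoid.powers q) (a : A) :
    N (s * a) = N s * N a := by
  obtain ⟨_, n, rfl⟩ := s
  have h : ∀ (n : ℕ) (a : A), N (q ^ n * a) = c ^ n * N a := by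
    intro n
    induction n with
    | zero => intro a; simp
    | succ n ih => intro a; rw [pow_succ', mul_assoc, hq, ih, pow_succ', mul_assoc]
  have h1 := h n 1
  rw [mul_one, hN1, mul_one] at h1
  show N (q ^ n * a) = N (q ^ n) * N a
  rw [h, h1]

theorem away_map_ne_zero {A : Type*} [CommRing A] (q : A) (c : ℝ≥0) (hc : c ≠ 0) (N : A → ℝ≥0)
    (hN1 : N 1 = 1) (hq : ∀ x, N (q * x) = c * N x) (s : Submonoid.powers q) : N s ≠ 0 := by
  obtain ⟨_, n, rfl⟩ := s
  show N (q ^ n) ≠ 0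
  induction n with
  | zero => simp [hN1]
  | succ n ih => rw [pow_succ', hq]; exact mul_ne_zero hc ih

/-- The function `a / q ^ n ↦ N a / N (q ^ n)`. -/
def awayNorm (y : Localization.Away q) : ℝ≥0 :=
  Localization.liftOn y (fun a s => N a / N s) (by
    intro a b s t h
    obtain ⟨u, hu⟩ := Localization.r_iff_exists.mp h
    have h1 := congrArg N hu
    have m := away_map_mul q c N hN1 hq
    have nz := away_map_ne_zero q c hc N hN1 hq
    simp only [m] at h1
    rw [div_eq_div_iff (nz s) (nz t)]
    have h2 := mul_left_cancel₀ (nz u) h1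
    rw [mul_comm (N a), h2, mul_comm])

/-- The extension `a / q ^ n ↦ N a / N (q ^ n)` of a function `N` with `N (q x) = c N x` to the
localization away from `q`. -/
def awaySeminorm : RingSeminorm (Localization.Away q) where
  toFun y := awayNorm q c hc N hN1 hq y
  map_zero' := by
    rw [← Localization.mk_zero (1 : Submonoid.powers q)]
    show ((N 0 / N (1 : Submonoid.powers q) : ℝ≥0) : ℝ) = 0
    simp [hN0]
  neg' y := by
    induction y using Localization.induction_on with
    | H y =>
      rw [Localization.neg_mk]
      show ((N (-y.1) / N y.2 : ℝ≥0) : ℝ) = ((N y.1 / N y.2 : ℝ≥0) : ℝ)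
      rw [hneg]
  add_le' x y := by
    induction x using Localization.induction_on with
    | H x =>
    induction y using Localization.induction_on with
    | H y =>
      obtain ⟨a, s⟩ := x
      obtain ⟨b, t⟩ := y
      have m := away_map_mul q c N hN1 hq
      have nz := away_map_ne_zero q c hc N hN1 hq
      rw [Localization.add_mk]
      show ((N (s * b + t * a) / N (s * t : Submonoid.powers q) : ℝ≥0) : ℝ) ≤
        ((N a / N s : ℝ≥0) : ℝ) + ((N b / N t : ℝ≥0) : ℝ)
      rw [← NNReal.coe_add, NNReal.coe_le_coe, Submonoid.coe_mul, m]
      have h := (hadd (s * b) (t * a)).trans (max_le_add_of_nonneg zero_le zero_le)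
      rw [m, m] at h
      have h1 : N a / N s + N b / N t = (N s * N b + N t * N a) / (N s * N t) := by
        have := nz s
        have := nz t
        field_simp
        ring
      rw [h1]
      gcongr
  mul_le' x y := by
    induction x using Localization.induction_on with
    | H x =>
    induction y using Localization.induction_on with
    | H y =>
      obtain ⟨a, s⟩ := x
      obtain ⟨b, t⟩ := y
      have m := away_map_mul q c N hN1 hq
      rw [Localization.mk_mul]
      show ((N (a * b) / N (s * t : Submonoid.powers q) : ℝ≥0) : ℝ) ≤
        ((N a / N s : ℝ≥0) : ℝ) * ((N b / N t : ℝ≥0) : ℝ)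
      rw [← NNReal.coe_mul, NNReal.coe_le_coe, Submonoid.coe_mul, m, div_mul_div_comm]
      gcongr
      exact hmul a b

end AwaySeminorm

namespace FrobeniusCohenRing

variable {p : ℕ} [hp : Fact p.Prime] {E : Type*} [NormedField E] [CharP E p]
  {Γ : Type*} [CommRing Γ] (D : FrobeniusCohenRing p E Γ)

theorem torsionFree {p : ℕ} [hp : Fact p.Prime] {E : Type*} [Field E] {Γ : Type*} [CommRing Γ]
    (D : FrobeniusCohenRing p E Γ) (a : Γ) (h : (p : Γ) * a = 0) : a = 0 := by
  have := D.isDomain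
  have := D.charZero
  exact (mul_eq_zero.mp h).resolve_left (Nat.cast_ne_zero.mpr hp.out.ne_zero)

theorem dvd_frob_sub {p : ℕ} {E : Type*} [Field E] {Γ : Type*} [CommRing Γ]
    (D : FrobeniusCohenRing p E Γ) (a : Γ) : (p : Γ) ∣ D.frob a - a ^ p := by
  rw [← Ideal.mem_span_singleton, ← D.ker_residue, RingHom.mem_ker, map_sub, map_pow,
    D.residue_frob, sub_self]

/-- The Frobenius-compatible embedding of `Γ` into `W(E^pf)`, as the composite
`Γ → W(Γ) → W(E) → W(E^pf)`. -/
def embed : Γ →+* WittVector p (PerfectClosure E p) :=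
  (WittVector.map ((PerfectClosure.of E p).comp D.residue)).comp
    (cartierMap D.torsionFree D.frob D.dvd_frob_sub)

theorem embed_coeff_zero (x : Γ) :
    (D.embed x).coeff 0 = PerfectClosure.of E p (D.residue x) := by
  have h := ghostComponent_cartierMap D.torsionFree D.frob D.dvd_frob_sub x 0
  rw [ghost_eq_sum] at h
  simp only [zero_add, Finset.range_one, Finset.sum_singleton, pow_zero, one_mul, pow_one,
    Nat.sub_self, Function.iterate_zero, id_eq] at h
  simp only [embed, RingHom.comp_apply, WittVector.map_coeff, h]

theorem embed_frob (x : Γ) : D.embed (D.frob x) = WittVector.frobenius (D.embed x) := by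
  have h : cartierMap D.torsionFree D.frob D.dvd_frob_sub (D.frob x) =
      WittVector.frobenius (cartierMap D.torsionFree D.frob D.dvd_frob_sub x) := by
    refine ghost_injective D.torsionFree (funext fun n => ?_)
    rw [WittVector.ghostMap_apply, WittVector.ghostMap_apply, WittVector.ghostComponent_frobenius,
      ghostComponent_cartierMap, ghostComponent_cartierMap, Function.iterate_succ_apply]
  simp only [embed, RingHom.comp_apply, h]
  ext n
  rw [WittVector.map_coeff, WittVector.coeff_frobenius, WittVector.coeff_frobenius,
    MvPolynomial.map_aeval, MvPolynomial.aeval_def, MvPolynomial.coe_eval₂Hom]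
  congr 1
  exact Subsingleton.elim _ _

variable [IsUltrametricDist E]

/-- The ring `Γ_r = Γ ∩ W(E^pf)_r`. -/
def overconvergent (r : ℝ≥0) : Subring Γ := (wittSubring p r).comap D.embed

/-- `Γ` has enough `r`-units: every nonzero element of `E` lifts to a unit of `Γ_r`. -/
def HasEnoughUnits (r : ℝ≥0) : Prop :=
  ∀ e : E, e ≠ 0 → ∃ u : (D.overconvergent r)ˣ, D.residue (u : D.overconvergent r) = e

/-- The ring `Γ_r[p⁻¹]`. -/
def OverconvergentLoc (r : ℝ≥0) : Type _ := Localization.Away (p : D.overconvergent r)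

instance instCommRingLoc (r : ℝ≥0) : CommRing (D.OverconvergentLoc r) :=
  inferInstanceAs (CommRing (Localization.Away (p : D.overconvergent r)))

/-- The norm `p ^ (-w_s)` on `Γ_r[p⁻¹]`, for `0 < s ≤ r`. -/
def frechetSeminorm {r s : ℝ≥0} (hs : 0 < s) (hsr : s ≤ r) :
    RingSeminorm (D.OverconvergentLoc r) :=
  have mem : ∀ x : D.overconvergent r, D.embed x ∈ wittSubring p s :=
    fun x => wittSubring_anti p hs hsr x.2
  awaySeminorm (p : D.overconvergent r) (p : ℝ≥0)⁻¹
    (inv_ne_zero (Nat.cast_ne_zero.mpr hp.out.ne_zero))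
    (fun x => gaussNorm p s (D.embed x))
    (by simp [gaussNorm_zero p hs])
    (by simp [gaussNorm_one p])
    (fun x => by simp [gaussNorm_neg p])
    (fun x y => by simpa using gaussNorm_add_le p (mem x) (mem y))
    (fun x y => by simpa using gaussNorm_mul_le p (mem x) (mem y))
    (fun x => by simpa using gaussNorm_p_mul p hs (mem x))

/-- The uniform structure of the Fréchet topology defined by all `w_s` with `0 < s ≤ r`. -/
instance instUniformSpaceLoc (r : ℝ≥0) : UniformSpace (D.OverconvergentLoc r) :=
  ⨅ s : {s : ℝ≥0 // 0 < s ∧ s ≤ r},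
    (D.frechetSeminorm s.2.1 s.2.2).toSeminormedRing.toPseudoMetricSpace.toUniformSpace

instance instIsUniformAddGroupLoc (r : ℝ≥0) : IsUniformAddGroup (D.OverconvergentLoc r) :=
  isUniformAddGroup_iInf fun s =>
    letI := (D.frechetSeminorm s.2.1 s.2.2).toSeminormedRing
    inferInstance

instance instIsTopologicalRingLoc (r : ℝ≥0) : IsTopologicalRing (D.OverconvergentLoc r) where
  continuous_mul := by
    have e : (UniformSpace.toTopologicalSpace : TopologicalSpace (D.OverconvergentLoc r)) =
        ⨅ s : {s : ℝ≥0 // 0 < s ∧ s ≤ r}, (D.frechetSeminorm s.2.1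
          s.2.2).toSeminormedRing.toPseudoMetricSpace.toUniformSpace.toTopologicalSpace :=
      UniformSpace.toTopologicalSpace_iInf
    have h : ContinuousMul (D.OverconvergentLoc r) := by
      rw [e]
      exact continuousMul_iInf fun s =>
        let := (D.frechetSeminorm s.2.1 s.2.2).toSeminormedRing
        inferInstance
    exact h.continuous_mul

/-- The analytic ring `Γ_{an,r}`, the completion of `Γ_r[p⁻¹]` for the Fréchet topology. -/
def Analytic (r : ℝ≥0) : Type _ := UniformSpace.Completion (D.OverconvergentLoc r)

instance instCommRingAnalytic (r : ℝ≥0) : CommRing (D.Analytic r) :=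
  inferInstanceAs (CommRing (UniformSpace.Completion (D.OverconvergentLoc r)))

end FrobeniusCohenRing

/-- The valuation of `E` is discrete. -/
def IsDiscretelyNormed (E : Type*) [NormedField E] : Prop :=
  ∃ ϖ : E, 0 < ‖ϖ‖ ∧ ‖ϖ‖ < 1 ∧ ∀ x : E, x ≠ 0 → ∃ k : ℤ, ‖x‖ = ‖ϖ‖ ^ k

/-- Adequate integral domains in the sense of Helmer; `IsCoprime a b` says `(a, b) = R`. -/
structure IsAdequate (R : Type*) [CommRing R] : Prop where
  isDomain : IsDomain R
  isBezout : IsBezout R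
  exists_factorization : ∀ a b : R, a ≠ 0 → ∃ a₁ a₂ : R, a = a₁ * a₂ ∧ IsCoprime a₁ b ∧
    ∀ a₃ : R, a₃ ∣ a₂ → ¬ IsUnit a₃ → ¬ IsCoprime a₃ b

/-- The elementary divisor theorem for finite free `R`-modules `N ⊆ M` (with `M` in a given
universe). -/
def ElementaryDivisorTheorem.{w, u} (R : Type u) [CommRing R] : Prop :=
  ∀ (M : Type w) [AddCommGroup M] [Module R M] [Module.Free R M] [Module.Finite R M]
    (N : Submodule R M) [Module.Free R N] [Module.Finite R N],
    ∃ (m n : ℕ) (hnm : n ≤ m) (e : Module.Basis (Fin m) R M) (f : Module.Basis (Fin n) R N)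
      (l : Fin n → R), (∀ i, l i ≠ 0) ∧ (∀ i j, i ≤ j → l i ∣ l j) ∧
      ∀ i, (f i : M) = l i • e (Fin.castLE hnm i)

end
end Overconvergent

universe u v w

/-!
# Analytic rings of Cohen rings are adequate

Write `v_t = p ^ (-w_t)` for the Gauss norms on `R = Γ_{an,r}`, where `0 < t ≤ r`. The ring `R`
behaves like the ring of analytic functions of `p` on the punctured disc `0 < |p| ≤ p ^ (-1 / r)`, the
role of the coefficients being played by units of `Γ_r` for which `v_t ^ (1 / t)` is independent of
`t`, while `v_t(p) ^ (1 / t) = p ^ (-1 / t)`. The range `s ≤ t ≤ r` corresponds to a closed annulus,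
denoted by `[s, r]`, and `Γ_r` consists of functions without pole at the centre.

*From `Γ` to an abstract ring.* The Gauss norm is multiplicative (`gaussNorm_mul`): the
Teichmüller terms at the first indices where the norms of two factors are attained multiply without
cancellation. Hence a unit of `Γ_{r₀}` is bounded at `r₀` by its residue (`unit_mem_nearUnits`), and
since `r < r₀`, its higher terms are smaller than the leading one by a uniform factor at all radii
`t ≤ r`. These near units form a group (`exists_inv_mem_nearUnits`), a sum of two of them is a near unit or zero up to a
uniformly smaller error (`exists_add_nearUnits`), and elements of `Γ_r` are limits of sums
`∑ p ^ k u_k` with near units or zeros as digits (`exists_digit_expansion`). Passing to the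
completion, log-convexity of `t ↦ v_t(x)` shows that an element that vanishes at one radius is zero;
at the radius `r` itself this needs an extra argument (`anValuation_top_eq_zero`). All of this is
summarized by the structure `SemiunitRing`, and `semiunitRing` shows that `R` carries one.

*Zeros.* In a `SemiunitRing` the terms of an expansion of `x` that attain `v_t(x)` have a largest and
a smallest index, and both are additive in `x` (`idx_mul`). The difference between the largest one at
`r` and the smallest one at `s` is the number of zeros of `x` in `[s, r]` (`deg`). Elements of degree
zero are invertible on `[s, r]`, and elements of degree zero for all `s` are units (`isUnit_of_deg`).
Division with remainder (`closureDvd_or_exists_deg_lt`) makes the functions on `[s, r]` a Euclidean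
ring, up to closure, and Weierstrass preparation (`exists_weierstrass`) splits off from an element of
`R` a factor in `R` whose zeros are those in `[s, r]`.

*From annuli to `R`.* Common divisors on each `[r / (n + 1), r]` are found by the Euclidean algorithm
(`exists_gcd_on`), and the new factors that appear as `n` grows have no zeros in the earlier annuli,
so that after multiplication by units their product converges (`exists_infinite_product`). Elements
that are coprime on every annulus are coprime (`isCoprime_of_cop`). This gives greatest common
divisors as linear combinations (`exists_gcd`). In the same way, splitting off from `a` on each
annulus the factors that divide a power of `b` gives the decomposition in the definition of an
adequate ring (`exists_adequate_factorization`).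

*Elementary divisors.* Over an adequate domain, if `a ≠ 0`, `b` and `c` generate the unit ideal, then
so do `a` and `b + t c` for some `t` (`exists_isCoprime_add_mul`). It follows that a finitely
generated submodule `N` of a finite projective module `M` contains an element `y` with a linear form
`φ` for which `φ y` divides all values of linear forms on `N` (`exists_mem_dvd`). Dividing `y` by its
content gives the first basis vector, and induction on the rank finishes the proof
(`IsAdequate.elementaryDivisorTheorem`).
-/

namespace Overconvergent

/-! ### Rings with semiunits -/

/-- An axiomatization of rings of analytic functions of `π` on a punctured disc, in which every
element is approximated by finite sums `∑ π ^ k u_k` where the digits `u_k` lie in `G` or are zero. The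
elements of `G` are the semiunits. Radii are parametrized by `0 < t ≤ r`: the absolute value is
`v t ^ (1 / t)`, for which elements of `G` behave like constants and `π` has absolute value
`P ^ (-1 / t)`. Thus the centre of the disc corresponds to `t = 0`.

* `v t` is the absolute value at radius `t`. By `v_le_max`, values at the ends of an interval of
  radii control the values in between. By `exists_limit`, sequences that are Cauchy at all radii
  converge.
* On `G`, absolute values depend on the radius like `c ^ t`, and `v t π = P⁻¹` for all `t`.
* `exists_add` says that sums of digits are digits up to an error that is smaller by the factor
  `δ < 1`, uniformly in the radius.
* `O` is a subring of functions without pole at the centre; it contains `π` and `G`. The maximum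
  principle for such functions is `v_le_rpow`, and `v_le_add` says that no cancellation occurs
  between a digit and a multiple of `π` in `O`.
* In `exists_expansion` the terms are bounded by the element, up to the precision. -/
structure SemiunitRing (R : Type*) [CommRing R] where
  r : ℝ
  r_pos : 0 < r
  v : Set.Ioc (0 : ℝ) r → Valuation R ℝ≥0
  eq_zero_of_v : ∀ {t x}, v t x = 0 → x = 0
  v_le_max : ∀ {s t u} (x), s ≤ t → t ≤ u → v t x ≤ max (v s x) (v u x)
  exists_limit : ∀ x : ℕ → R, (∀ t, Tendsto (fun n => v t (x (n + 1) - x n)) atTop (𝓝 0)) →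
    ∃ y, ∀ t, Tendsto (fun n => v t (x n - y)) atTop (𝓝 0)
  P : ℝ≥0
  one_lt_P : 1 < P
  π : Rˣ
  v_π : ∀ t, v t (π : R) = P⁻¹
  G : Subgroup Rˣ
  neg_one_mem : -1 ∈ G
  exists_abs : ∀ u ∈ G, ∃ c : ℝ≥0, ∀ t, v t (u : R) = c ^ (t : ℝ)
  δ : ℝ≥0
  δ_pos : 0 < δ
  δ_lt_one : δ < 1
  exists_add : ∀ x y : R, (x = 0 ∨ ∃ u ∈ G, x = u) → (y = 0 ∨ ∃ u ∈ G, y = u) →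
    ∃ z : R, (z = 0 ∨ ∃ u ∈ G, z = u) ∧
      ∀ t, v t z ≤ max (v t x) (v t y) ∧ v t (x + y - z) ≤ δ * v t y
  O : Subring R
  π_mem : (π : R) ∈ O
  mem_O : ∀ u ∈ G, (u : R) ∈ O
  v_le_rpow : ∀ x ∈ O, ∀ {s t}, s ≤ t → v s x ≤ v t x ^ ((s : ℝ) / t)
  v_le_add : ∀ u ∈ G, ∀ y ∈ O, ∀ t, v t (u : R) ≤ v t (u + π * y)
  exists_expansion : ∀ (x : R) (s) (ε : ℝ≥0), 0 < ε →
    ∃ (F : Finset ℤ) (f : ℤ → R), (∀ k, f k = 0 ∨ ∃ u ∈ G, f k = u) ∧ (∀ k ∉ F, f k = 0) ∧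
      ∀ t, s ≤ t → (∀ k, v t ((π ^ k : Rˣ) * f k) ≤ max (v t x) ε) ∧
        v t (x - ∑ k ∈ F, (π ^ k : Rˣ) * f k) ≤ ε

namespace SemiunitRing

variable {R : Type*} [CommRing R] (S : SemiunitRing R)

/-- The parameters of the radii of the punctured disc. -/
abbrev Radius : Type := Set.Ioc (0 : ℝ) S.r

/-- The outer radius. -/
def top : S.Radius := ⟨S.r, S.r_pos, le_rfl⟩

variable {S}

theorem le_top (t : S.Radius) : t ≤ S.top := t.2.2

theorem radius_pos (t : S.Radius) : (0 : ℝ) < t := t.2.1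

theorem P_pos : 0 < S.P := zero_lt_one.trans S.one_lt_P

variable (S)

/-- Monomials of index `k`: elements `π ^ k * u` where `u` is a semiunit or zero. -/
def mono (k : ℤ) : Set R := {x | ∃ y : R, (y = 0 ∨ ∃ u ∈ S.G, y = u) ∧ x = (S.π ^ k : Rˣ) * y}

variable {S}

theorem zero_mem_mono (k : ℤ) : (0 : R) ∈ S.mono k := ⟨0, .inl rfl, by simp⟩

theorem pi_zpow_mem_mono (k : ℤ) : ((S.π ^ k : Rˣ) : R) ∈ S.mono k :=
  ⟨1, .inr ⟨1, one_mem _, by simp⟩, by simp⟩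

theorem mono_mul {k l : ℤ} {x y : R} (hx : x ∈ S.mono k) (hy : y ∈ S.mono l) :
    x * y ∈ S.mono (k + l) := by
  obtain ⟨a, ha, rfl⟩ := hx
  obtain ⟨b, hb, rfl⟩ := hy
  refine ⟨a * b, ?_, by rw [zpow_add]; push_cast; ring⟩
  rcases ha with rfl | ⟨u, hu, rfl⟩
  · simp
  rcases hb with rfl | ⟨w, hw, rfl⟩
  · simp
  exact .inr ⟨u * w, mul_mem hu hw, by simp⟩

theorem mono_neg {k : ℤ} {x : R} (hx : x ∈ S.mono k) : -x ∈ S.mono k := by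
  obtain ⟨a, ha, rfl⟩ := hx
  refine ⟨-a, ?_, by ring⟩
  rcases ha with rfl | ⟨u, hu, rfl⟩
  · simp
  exact .inr ⟨-1 * u, mul_mem S.neg_one_mem hu, by simp⟩

/-- A nonzero monomial is invertible, with a monomial as inverse. -/
theorem exists_mono_inv {k : ℤ} {x : R} (hx : x ∈ S.mono k) (h0 : x ≠ 0) :
    ∃ y ∈ S.mono (-k), x * y = 1 := by
  obtain ⟨a, ha, rfl⟩ := hx
  rcases ha with rfl | ⟨u, hu, rfl⟩
  · simp at h0
  refine ⟨(S.π ^ (-k) : Rˣ) * (u⁻¹ : Rˣ), ⟨_, .inr ⟨u⁻¹, inv_mem hu, rfl⟩, rfl⟩, ?_⟩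
  rw [← Units.val_mul, ← Units.val_mul, ← Units.val_mul, zpow_neg, mul_mul_mul_comm,
    mul_inv_cancel, mul_inv_cancel, one_mul, Units.val_one]

theorem v_zpow (t : S.Radius) (k : ℤ) : S.v t ((S.π ^ k : Rˣ) : R) = S.P ^ (-k) := by
  have h : ∀ n : ℕ, S.v t ((S.π ^ n : Rˣ) : R) = S.P⁻¹ ^ n := fun n => by
    rw [Units.val_pow_eq_pow_val, map_pow, S.v_π]
  obtain ⟨n, rfl | rfl⟩ := Int.eq_nat_or_neg k
  · rw [zpow_natCast, h, zpow_neg, zpow_natCast, inv_pow]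
  · have h1 : S.v t ((S.π ^ (-(n : ℤ)) : Rˣ) : R) * S.v t ((S.π ^ n : Rˣ) : R) = 1 := by
      rw [← map_mul, ← Units.val_mul]; simp
    rw [h] at h1
    have h2 := eq_inv_of_mul_eq_one_left h1
    rw [h2]; simp

/-- The absolute value of a monomial of index `k` is `P ^ (-k) * c ^ t` for a constant `c`. -/
theorem mono_abs {k : ℤ} {x : R} (hx : x ∈ S.mono k) :
    ∃ c : ℝ≥0, ∀ t, S.v t x = S.P ^ (-k) * c ^ (t : ℝ) := by
  obtain ⟨a, ha, rfl⟩ := hx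
  rcases ha with rfl | ⟨u, hu, rfl⟩
  · exact ⟨0, fun t => by simp [NNReal.zero_rpow (radius_pos t).ne']⟩
  · obtain ⟨c, hc⟩ := S.exists_abs u hu
    exact ⟨c, fun t => by rw [map_mul, v_zpow, hc]⟩

theorem v_pos {t : S.Radius} {x : R} (hx : x ≠ 0) : 0 < S.v t x :=
  pos_iff_ne_zero.mpr fun h => hx (S.eq_zero_of_v h)

theorem mul_rpow_le_of_le {a c γ : ℝ≥0} {t t' : ℝ} (ht : 0 < t) (ht' : 0 < t')
    (ha : a ≤ a ^ (t' / t)) (h : a * c ^ t ≤ γ ^ t) : a * c ^ t' ≤ γ ^ t' := by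
  have e : ∀ y : ℝ≥0, (y ^ t) ^ (t' / t) = y ^ t' := fun y => by
    rw [← NNReal.rpow_mul, mul_div_cancel₀ _ ht.ne']
  calc a * c ^ t' ≤ a ^ (t' / t) * (c ^ t) ^ (t' / t) := by rw [e]; gcongr
    _ = (a * c ^ t) ^ (t' / t) := by rw [NNReal.mul_rpow]
    _ ≤ (γ ^ t) ^ (t' / t) := NNReal.rpow_le_rpow h (div_pos ht' ht).le
    _ = γ ^ t' := e γ

theorem mono_le_of_nonneg {k : ℤ} {x : R} (hx : x ∈ S.mono k) (hk : 0 ≤ k) {t t' : S.Radius}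
    (h : t ≤ t') {γ : ℝ≥0} (hv : S.v t' x ≤ γ ^ (t' : ℝ)) : S.v t x ≤ γ ^ (t : ℝ) := by
  obtain ⟨c, hc⟩ := mono_abs hx
  rw [hc] at hv ⊢
  refine mul_rpow_le_of_le (radius_pos t') (radius_pos t) ?_ hv
  have h1 : S.P ^ (-k) ≤ 1 := zpow_le_one_of_nonpos₀ S.one_lt_P.le (by omega)
  have h2 : (t : ℝ) / t' ≤ 1 := (div_le_one (radius_pos t')).mpr h
  calc S.P ^ (-k) = (S.P ^ (-k)) ^ (1 : ℝ) := (NNReal.rpow_one _).symm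
    _ ≤ _ := NNReal.rpow_le_rpow_of_exponent_ge (zpow_pos P_pos _) h1 h2

theorem mono_le_of_nonpos {k : ℤ} {x : R} (hx : x ∈ S.mono k) (hk : k ≤ 0) {t t' : S.Radius}
    (h : t ≤ t') {γ : ℝ≥0} (hv : S.v t x ≤ γ ^ (t : ℝ)) : S.v t' x ≤ γ ^ (t' : ℝ) := by
  obtain ⟨c, hc⟩ := mono_abs hx
  rw [hc] at hv ⊢
  refine mul_rpow_le_of_le (radius_pos t) (radius_pos t') ?_ hv
  have h1 : 1 ≤ S.P ^ (-k) := one_le_zpow₀ S.one_lt_P.le (by omega)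
  have h2 : 1 ≤ (t' : ℝ) / t := (one_le_div (radius_pos t)).mpr h
  calc S.P ^ (-k) = (S.P ^ (-k)) ^ (1 : ℝ) := (NNReal.rpow_one _).symm
    _ ≤ _ := NNReal.rpow_le_rpow_of_exponent_le h1 h2

/-- Monomials of equal index and equal absolute value at one radius agree at all radii. -/
theorem mono_v_eq {k : ℤ} {x y : R} (hx : x ∈ S.mono k) (hy : y ∈ S.mono k) {t : S.Radius}
    (h : S.v t x = S.v t y) (t' : S.Radius) : S.v t' x = S.v t' y := by
  obtain ⟨c, hc⟩ := mono_abs hx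
  obtain ⟨d, hd⟩ := mono_abs hy
  rw [hc, hd] at h ⊢
  have h1 := mul_left_cancel₀ (zpow_pos P_pos _).ne' h
  rw [NNReal.rpow_left_injective (radius_pos t).ne' h1]

theorem mono_add {k : ℤ} {x y : R} (hx : x ∈ S.mono k) (hy : y ∈ S.mono k) :
    ∃ z ∈ S.mono k, ∀ t, S.v t z ≤ max (S.v t x) (S.v t y) ∧
      S.v t (x + y - z) ≤ S.δ * S.v t y := by
  obtain ⟨a, ha, rfl⟩ := hx
  obtain ⟨b, hb, rfl⟩ := hy
  obtain ⟨c, hc, h⟩ := S.exists_add a b ha hb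
  refine ⟨_, ⟨c, hc, rfl⟩, fun t => ?_⟩
  rw [← mul_add, ← mul_sub, map_mul, map_mul, map_mul, map_mul,
    ← mul_max_of_nonneg _ _ zero_le, mul_left_comm]
  exact ⟨mul_le_mul_right (h t).1 _, mul_le_mul_right (h t).2 _⟩

theorem mono_mem_O {k : ℤ} {x : R} (hx : x ∈ S.mono k) (hk : 0 ≤ k) : x ∈ S.O := by
  obtain ⟨a, ha, rfl⟩ := hx
  obtain ⟨n, rfl⟩ := Int.eq_ofNat_of_zero_le hk
  refine mul_mem ?_ ?_
  · rw [zpow_natCast, Units.val_pow_eq_pow_val]; exact pow_mem S.π_mem n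
  · rcases ha with rfl | ⟨u, hu, rfl⟩
    · exact zero_mem _
    · exact S.mem_O u hu

theorem v_mono_le_add {k : ℤ} {x y : R} (hx : x ∈ S.mono k)
    (hy : ∃ z ∈ S.O, y = (S.π ^ (k + 1) : Rˣ) * z) (t : S.Radius) :
    S.v t x ≤ S.v t (x + y) := by
  obtain ⟨a, ha, rfl⟩ := hx
  obtain ⟨z, hz, rfl⟩ := hy
  rcases ha with rfl | ⟨u, hu, rfl⟩
  · simp
  · rw [zpow_add_one, Units.val_mul, mul_assoc, ← mul_add, map_mul, map_mul]
    exact mul_le_mul_right (S.v_le_add u hu z hz t) _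

/-- A finite sum of monomials with distinct indices is at least as large as each term. -/
theorem le_v_sum (F : Finset ℤ) {f : ℤ → R} (hf : ∀ k ∈ F, f k ∈ S.mono k) (t : S.Radius) :
    ∀ k ∈ F, S.v t (f k) ≤ S.v t (∑ k ∈ F, f k) := by
  induction F using Finset.induction_on_min with
  | empty => simp
  | insert a F ha ih =>
    have haF : a ∉ F := fun h => lt_irrefl _ (ha a h)
    rw [Finset.sum_insert haF]
    have h1 : S.v t (f a) ≤ S.v t (f a + ∑ k ∈ F, f k) := by
      refine v_mono_le_add (hf a (Finset.mem_insert_self a F)) ?_ t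
      refine ⟨(S.π ^ (-(a + 1)) : Rˣ) * ∑ k ∈ F, f k, ?_, ?_⟩
      · rw [Finset.mul_sum]
        refine sum_mem fun k hk => ?_
        exact mono_mem_O (mono_mul (pi_zpow_mem_mono _)
          (hf k (Finset.mem_insert_of_mem hk))) (by have := ha k hk; omega)
      · rw [← mul_assoc, ← Units.val_mul, ← zpow_add]; simp
    have h2 : S.v t (∑ k ∈ F, f k) ≤ S.v t (f a + ∑ k ∈ F, f k) := by
      have := (S.v t).map_sub_le (le_refl (S.v t (f a + ∑ k ∈ F, f k))) h1
      rwa [add_sub_cancel_left] at this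
    intro k hk
    rcases Finset.mem_insert.mp hk with rfl | hk
    · exact h1
    · exact (ih (fun k hk => hf k (Finset.mem_insert_of_mem hk)) k hk).trans h2

theorem exists_mono_expansion (x : R) (s : S.Radius) {ε : ℝ≥0} (hε : 0 < ε) :
    ∃ (F : Finset ℤ) (f : ℤ → R), (∀ k, f k ∈ S.mono k) ∧ (∀ k ∉ F, f k = 0) ∧
      ∀ t, s ≤ t → (∀ k, S.v t (f k) ≤ max (S.v t x) ε) ∧ S.v t (x - ∑ k ∈ F, f k) ≤ ε := by
  obtain ⟨F, f, h1, h2, h3⟩ := S.exists_expansion x s ε hε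
  exact ⟨F, fun k => (S.π ^ k : Rˣ) * f k, fun k => ⟨_, h1 k, rfl⟩, fun k hk => by simp [h2 k hk],
    h3⟩

/-! ### Leading indices -/

variable (S)

/-- Sums of monomials with indices in `K` of absolute value at most `M`, up to elements of
absolute value less than `M`. -/
def monoSpan (t : S.Radius) (K : Set ℤ) (M : ℝ≥0) : AddSubgroup R :=
  AddSubgroup.closure ({y | ∃ k ∈ K, y ∈ S.mono k ∧ S.v t y ≤ M} ∪ {y | S.v t y < M})

variable {S}

theorem mono_mem_monoSpan {t : S.Radius} {K : Set ℤ} {M : ℝ≥0} {k : ℤ} {x : R} (hk : k ∈ K)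
    (hx : x ∈ S.mono k) (h : S.v t x ≤ M) : x ∈ S.monoSpan t K M :=
  AddSubgroup.subset_closure (.inl ⟨k, hk, hx, h⟩)

theorem mem_monoSpan_of_lt {t : S.Radius} {K : Set ℤ} {M : ℝ≥0} {x : R} (h : S.v t x < M) :
    x ∈ S.monoSpan t K M :=
  AddSubgroup.subset_closure (.inr h)

theorem monoSpan_mono {t : S.Radius} {K K' : Set ℤ} {M : ℝ≥0} (h : K ⊆ K') :
    S.monoSpan t K M ≤ S.monoSpan t K' M := by
  refine AddSubgroup.closure_mono (Set.union_subset_union ?_ le_rfl)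
  rintro y ⟨k, hk, hy⟩
  exact ⟨k, h hk, hy⟩

theorem monoSpan_mul {t : S.Radius} {K K' K'' : Set ℤ} {M M' : ℝ≥0} (hM : 0 < M) (hM' : 0 < M')
    (hK : ∀ k ∈ K, ∀ l ∈ K', k + l ∈ K'') {x y : R} (hx : x ∈ S.monoSpan t K M)
    (hy : y ∈ S.monoSpan t K' M') : x * y ∈ S.monoSpan t K'' (M * M') := by
  have small : ∀ {a b : R}, S.v t a ≤ M → S.v t b < M' → S.v t (a * b) < M * M' := by
    intro a b ha hb
    rw [map_mul]
    exact (mul_le_mul_left ha _).trans_lt (mul_lt_mul_of_pos_left hb hM)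
  have small' : ∀ {a b : R}, S.v t a < M → S.v t b ≤ M' → S.v t (a * b) < M * M' := by
    intro a b ha hb
    rw [map_mul]
    exact (mul_le_mul_right hb _).trans_lt (mul_lt_mul_of_pos_right ha hM')
  induction hx using AddSubgroup.closure_induction with
  | zero => rw [zero_mul]; exact zero_mem _
  | neg a _ ih => rw [neg_mul]; exact neg_mem ih
  | add a b _ _ iha ihb => rw [add_mul]; exact add_mem iha ihb
  | mem a ha =>
    induction hy using AddSubgroup.closure_induction with
    | zero => rw [mul_zero]; exact zero_mem _
    | neg b _ ih => rw [mul_neg]; exact neg_mem ih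
    | add b c _ _ ihb ihc => rw [mul_add]; exact add_mem ihb ihc
    | mem b hb =>
      rcases ha with ⟨k, hk, hak, hav⟩ | ha
      · rcases hb with ⟨l, hl, hbl, hbv⟩ | hb
        · refine mono_mem_monoSpan (hK k hk l hl) (mono_mul hak hbl) ?_
          rw [map_mul]; exact mul_le_mul' hav hbv
        · exact mem_monoSpan_of_lt (small hav hb)
      · refine mem_monoSpan_of_lt (small' ha ?_)
        rcases hb with ⟨l, hl, hbl, hbv⟩ | hb
        · exact hbv
        · exact le_of_lt hb

/-- Elements of `monoSpan` can be represented with distinct indices. -/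
theorem exists_repr_of_mem_monoSpan {t : S.Radius} {K : Set ℤ} {M : ℝ≥0} (hM : 0 < M) {x : R}
    (hx : x ∈ S.monoSpan t K M) : ∃ (F : Finset ℤ) (f : ℤ → R), (↑F ⊆ K) ∧ (∀ k, f k ∈ S.mono k) ∧
      (∀ k ∉ F, f k = 0) ∧ S.v t (x - ∑ k ∈ F, f k) < M ∧ ∀ k, S.v t (f k) ≤ M := by
  classical
  induction hx using AddSubgroup.closure_induction with
  | zero => exact ⟨∅, 0, by simp, fun k => zero_mem_mono k, by simp, by simpa, by simp⟩
  | neg a _ ih =>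
    obtain ⟨F, f, h1, h2, h3, h4, h5⟩ := ih
    refine ⟨F, -f, h1, fun k => mono_neg (h2 k), fun k hk => by simp [h3 k hk], ?_,
      fun k => by simpa using h5 k⟩
    rw [← Valuation.map_neg]
    convert h4 using 2
    simp only [Pi.neg_apply, Finset.sum_neg_distrib]; ring
  | mem a ha =>
    rcases ha with ⟨k, hk, hak, hav⟩ | ha
    · refine ⟨{k}, fun l => if l = k then a else 0, by simpa, fun l => ?_, fun l hl => ?_, ?_,
        fun l => ?_⟩
      · dsimp only; split_ifs with h
        · exact h ▸ hak
        · exact zero_mem_mono l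
      · exact if_neg (by simpa using hl)
      · simpa using hM
      · dsimp only; split_ifs
        · exact hav
        · simp
    · exact ⟨∅, 0, by simp, fun k => zero_mem_mono k, by simp, by simpa using ha, by simp⟩
  | add a b _ _ iha ihb =>
    obtain ⟨F, f, h1, h2, h3, h4, h5⟩ := iha
    obtain ⟨F', f', h1', h2', h3', h4', h5'⟩ := ihb
    choose g hg hgv using fun k => mono_add (h2 k) (h2' k)
    have hF : ∀ k ∉ F ∪ F', f k = 0 ∧ f' k = 0 := fun k hk => by
      rw [Finset.mem_union, not_or] at hk
      exact ⟨h3 k hk.1, h3' k hk.2⟩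
    refine ⟨F ∪ F', g, by simpa using ⟨h1, h1'⟩, hg, fun k hk => ?_, ?_, fun k => ?_⟩
    · have h := (hgv k t).1
      rw [(hF k hk).1, (hF k hk).2, map_zero, max_self] at h
      exact S.eq_zero_of_v (le_antisymm h zero_le)
    · have e : a + b - ∑ k ∈ F ∪ F', g k = (a - ∑ k ∈ F, f k) + (b - ∑ k ∈ F', f' k)
          + ∑ k ∈ F ∪ F', (f k + f' k - g k) := by
        rw [Finset.sum_sub_distrib, Finset.sum_add_distrib,
          Finset.sum_subset (Finset.subset_union_left (s₂ := F')) (fun k _ hk => h3 k hk),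
          Finset.sum_subset (Finset.subset_union_right (s₁ := F)) (fun k _ hk => h3' k hk)]
        ring
      rw [e]
      refine Valuation.map_add_lt _ (Valuation.map_add_lt _ h4 h4') ?_
      refine Valuation.map_sum_lt' _ hM fun k _ => ?_
      refine ((hgv k t).2.trans (mul_le_mul_right (h5' k) _)).trans_lt ?_
      exact mul_lt_of_lt_one_left hM S.δ_lt_one
    · exact (hgv k t).1.trans (max_le (h5 k) (h5' k))

/-- A nonzero monomial is not, up to smaller elements, a sum of monomials of other indices of at most
the same size. -/
theorem mono_notMem_monoSpan {t : S.Radius} {K : Set ℤ} {k : ℤ} {x : R} (hk : k ∉ K)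
    (hx : x ∈ S.mono k) (h0 : x ≠ 0) : x ∉ S.monoSpan t K (S.v t x) := by
  classical
  intro h
  obtain ⟨F, f, h1, h2, -, h4, -⟩ := exists_repr_of_mem_monoSpan (v_pos h0) h
  have hkF : k ∉ F := fun h => hk (h1 h)
  have h5 := le_v_sum (insert k F) (f := fun l => if l = k then x else - f l) (fun l _ => by
    split_ifs with hl
    · exact hl ▸ hx
    · exact mono_neg (h2 l)) t k (Finset.mem_insert_self k F)
  rw [Finset.sum_insert hkF, if_pos rfl, Finset.sum_congr (g := fun l => - f l) rfl
    (fun l hl => if_neg (ne_of_mem_of_not_mem hl hkF)), Finset.sum_neg_distrib, ← sub_eq_add_neg] at h5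
  exact absurd h4 (not_lt.mpr h5)

variable (S)

/-- `k` is the leading index of `x` at radius `t`: up to smaller elements, `x` is the sum of
a monomial of index `k` with the absolute value of `x` and of monomials that precede it, with at most
this absolute value. For `σ = 1` the preceding indices are the smaller ones, so that `k` is the
largest index of a term that attains the absolute value of `x`; for `σ = -1` it is the smallest
one. -/
def IsLead (σ : ℤ) (t : S.Radius) (k : ℤ) (x : R) : Prop :=
  ∃ u ∈ S.mono k, S.v t u = S.v t x ∧ x - u ∈ S.monoSpan t {l | σ * l < σ * k} (S.v t x)

variable {S}

theorem IsLead.unique {σ : ℤ} {t : S.Radius} {k l : ℤ} {x : R} (hσ : σ ≠ 0) (hx : x ≠ 0)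
    (hk : S.IsLead σ t k x) (hl : S.IsLead σ t l x) : k = l := by
  have key : ∀ {k l : ℤ}, S.IsLead σ t k x → S.IsLead σ t l x → ¬ σ * k < σ * l := by
    rintro k l ⟨u, hu, huv, hux⟩ ⟨w, hw, hwv, hwx⟩ hkl
    have hw0 : w ≠ 0 := fun h => by
      rw [h, map_zero] at hwv; exact hx (S.eq_zero_of_v hwv.symm)
    refine mono_notMem_monoSpan (t := t) (K := {m | σ * m < σ * l}) (lt_irrefl (σ * l)) hw hw0 ?_
    rw [hwv]
    have h1 := add_mem (sub_mem (monoSpan_mono (K' := {m | σ * m < σ * l})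
      (fun m hm => lt_trans hm hkl) hux) hwx) (mono_mem_monoSpan (t := t) (k := k)
        (K := {m | σ * m < σ * l}) hkl hu huv.le)
    convert h1 using 1
    ring
  have h := le_antisymm (not_lt.mp (key hl hk)) (not_lt.mp (key hk hl))
  exact mul_left_cancel₀ hσ h

theorem IsLead.mul {σ : ℤ} {t : S.Radius} {k l : ℤ} {x y : R} (hx : x ≠ 0) (hy : y ≠ 0)
    (hk : S.IsLead σ t k x) (hl : S.IsLead σ t l y) : S.IsLead σ t (k + l) (x * y) := by
  obtain ⟨u, hu, huv, hux⟩ := hk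
  obtain ⟨w, hw, hwv, hwy⟩ := hl
  refine ⟨u * w, mono_mul hu hw, by rw [map_mul, map_mul, huv, hwv], ?_⟩
  have hx' := v_pos (t := t) hx
  have hy' := v_pos (t := t) hy
  have e : x * y - u * w = (x - u) * (y - w) + ((x - u) * w + u * (y - w)) := by ring
  rw [e, map_mul]
  refine add_mem (monoSpan_mul hx' hy' ?_ hux hwy) (add_mem (monoSpan_mul hx' hy' ?_ hux
    (mono_mem_monoSpan (K := {l}) rfl hw hwv.le)) (monoSpan_mul hx' hy' ?_
    (mono_mem_monoSpan (K := {k}) rfl hu huv.le) hwy)) <;>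
  · intro a ha b hb
    simp only [Set.mem_ofPred_eq, Set.mem_singleton_iff] at ha hb ⊢
    subst_vars
    linarith

theorem IsLead.congr {σ : ℤ} {t : S.Radius} {k : ℤ} {x y : R} (hk : S.IsLead σ t k x)
    (h : S.v t (x - y) < S.v t x) : S.IsLead σ t k y := by
  obtain ⟨u, hu, huv, hux⟩ := hk
  have hy : S.v t y = S.v t x := by
    have := (S.v t).map_sub_eq_of_lt_left h
    rwa [sub_sub_cancel] at this
  refine ⟨u, hu, huv.trans hy.symm, ?_⟩
  rw [hy]
  have := sub_mem hux (mem_monoSpan_of_lt (K := {l | σ * l < σ * k}) h)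
  convert this using 1
  ring

theorem isLead_of_mono {σ : ℤ} {t : S.Radius} {k : ℤ} {x : R} (hx : x ∈ S.mono k) :
    S.IsLead σ t k x := ⟨x, hx, rfl, by rw [sub_self]; exact zero_mem _⟩

/-- Reading off the leading index from an expansion. -/
theorem isLead_of_expansion {σ : ℤ} {t : S.Radius} {x : R} {F : Finset ℤ} {f : ℤ → R}
    (hf : ∀ k ∈ F, f k ∈ S.mono k) (hle : ∀ k ∈ F, S.v t (f k) ≤ S.v t x)
    (hx : S.v t (x - ∑ k ∈ F, f k) < S.v t x) {N : ℤ} (hN : N ∈ F) (hNv : S.v t (f N) = S.v t x)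
    (h : ∀ k ∈ F, S.v t (f k) = S.v t x → σ * k ≤ σ * N) (hσ : σ ≠ 0) : S.IsLead σ t N x := by
  refine ⟨f N, hf N hN, hNv, ?_⟩
  have e : x - f N = (x - ∑ k ∈ F, f k) + ∑ k ∈ F.erase N, f k := by
    rw [← Finset.add_sum_erase F f hN]; ring
  rw [e]
  refine add_mem (mem_monoSpan_of_lt hx) (sum_mem fun k hk => ?_)
  obtain ⟨hkN, hkF⟩ := Finset.mem_erase.mp hk
  rcases (hle k hkF).lt_or_eq with hlt | heq
  · exact mem_monoSpan_of_lt hlt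
  · exact mono_mem_monoSpan (lt_of_le_of_ne (h k hkF heq) fun e => hkN (mul_left_cancel₀ hσ e))
      (hf k hkF) heq.le

/-- Among the terms of maximal absolute value in a good enough expansion, the last one in the order
given by `σ` has the leading index. -/
theorem exists_isLead_of_expansion {σ : ℤ} (hσ : σ ≠ 0) {t : S.Radius} {x : R} {F : Finset ℤ}
    {f : ℤ → R}
    (hf : ∀ k ∈ F, f k ∈ S.mono k) (hle : ∀ k ∈ F, S.v t (f k) ≤ S.v t x)
    (hx : S.v t (x - ∑ k ∈ F, f k) < S.v t x) :
    ∃ N ∈ F, S.v t (f N) = S.v t x ∧ (∀ k ∈ F, S.v t (f k) = S.v t x → σ * k ≤ σ * N) ∧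
      S.IsLead σ t N x := by
  classical
  have hne : (F.filter fun k => S.v t (f k) = S.v t x).Nonempty := by
    by_contra h
    rw [Finset.not_nonempty_iff_eq_empty, Finset.filter_eq_empty_iff] at h
    have h1 : S.v t (∑ k ∈ F, f k) < S.v t x :=
      Valuation.map_sum_lt' _ (zero_le.trans_lt hx) fun k hk => lt_of_le_of_ne (hle k hk) (h hk)
    have h2 := Valuation.map_add_lt _ hx h1
    rw [sub_add_cancel] at h2
    exact lt_irrefl _ h2
  obtain ⟨N, hN, hmax⟩ := Finset.exists_max_image _ (fun k => σ * k) hne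
  rw [Finset.mem_filter] at hN
  have hm : ∀ k ∈ F, S.v t (f k) = S.v t x → σ * k ≤ σ * N := fun k hk hkv =>
    hmax k (Finset.mem_filter.mpr ⟨hk, hkv⟩)
  exact ⟨N, hN.1, hN.2, hm, isLead_of_expansion hf hle hx hN.1 hN.2 hm hσ⟩

/-- An expansion that is good at two radii. -/
theorem exists_expansion_of_ne_zero {x : R} (hx : x ≠ 0) (s t : S.Radius) :
    ∃ (F : Finset ℤ) (f : ℤ → R), (∀ k, f k ∈ S.mono k) ∧
      (∀ k, S.v s (f k) ≤ S.v s x) ∧ S.v s (x - ∑ k ∈ F, f k) < S.v s x ∧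
      (∀ k, S.v t (f k) ≤ S.v t x) ∧ S.v t (x - ∑ k ∈ F, f k) < S.v t x := by
  obtain ⟨ε, h0, h1⟩ := exists_between (lt_min (v_pos (t := s) hx) (v_pos (t := t) hx))
  obtain ⟨h1, h2⟩ := lt_min_iff.mp h1
  obtain ⟨F, f, hf, -, h⟩ := exists_mono_expansion x (min s t) h0
  have hs := h s (min_le_left _ _)
  have ht := h t (min_le_right _ _)
  exact ⟨F, f, hf, fun k => (hs.1 k).trans (max_le le_rfl h1.le), hs.2.trans_lt h1,
    fun k => (ht.1 k).trans (max_le le_rfl h2.le), ht.2.trans_lt h2⟩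

theorem exists_isLead {σ : ℤ} (hσ : σ ≠ 0) (t : S.Radius) {x : R} (hx : x ≠ 0) :
    ∃ N, S.IsLead σ t N x := by
  obtain ⟨F, f, h1, h2, h3, -, -⟩ := exists_expansion_of_ne_zero hx t t
  obtain ⟨N, -, -, -, h⟩ := exists_isLead_of_expansion hσ (fun k _ => h1 k) (fun k _ => h2 k) h3
  exact ⟨N, h⟩

/-! ### Extremal leading indices as functions of the radius -/
theorem tendsto_zero_of_eventually_le {f g : ℕ → ℝ≥0} (hg : Tendsto g atTop (𝓝 0))
    (h : ∀ᶠ n in atTop, f n ≤ g n) : Tendsto f atTop (𝓝 0) :=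
  tendsto_of_tendsto_of_tendsto_of_le_of_le' tendsto_const_nhds hg
    (Eventually.of_forall fun _ => zero_le) h

theorem isDomain (S : SemiunitRing R) : IsDomain R := by
  have : Nontrivial R := ⟨1, 0, fun h => by
    have := (S.v S.top).map_one
    rw [h, map_zero] at this
    exact zero_ne_one this⟩
  have : NoZeroDivisors R := ⟨fun {a b} h => by
    have h1 : S.v S.top a * S.v S.top b = 0 := by rw [← map_mul, h, map_zero]
    exact (mul_eq_zero.mp h1).imp S.eq_zero_of_v S.eq_zero_of_v⟩
  exact NoZeroDivisors.to_isDomain R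

theorem v_eq_of_sub_lt {t : S.Radius} {x y : R} (h : S.v t (x - y) < S.v t x) :
    S.v t y = S.v t x := by
  have := (S.v t).map_sub_eq_of_lt_left h
  rwa [sub_sub_cancel] at this

theorem ne_zero_of_v_sub_lt {t : S.Radius} {x y : R} (h : S.v t (x - y) < S.v t x) :
    y ≠ 0 := fun hy => by
  rw [hy, sub_zero] at h; exact lt_irrefl _ h

theorem v_of_mul_eq_one {x y : R} (h : x * y = 1) (t : S.Radius) : S.v t y = (S.v t x)⁻¹ := by
  have h1 : S.v t y * S.v t x = 1 := by rw [← map_mul, mul_comm, h, map_one]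
  exact eq_inv_of_mul_eq_one_left h1

theorem exists_rpow_lt_one {a : ℝ≥0} (ha : a < 1) (t : S.Radius) :
    ∃ γ : ℝ≥0, γ < 1 ∧ a = γ ^ (t : ℝ) :=
  ⟨a ^ ((t : ℝ)⁻¹), NNReal.rpow_lt_one ha (inv_pos.mpr (radius_pos t)), by
    rw [← NNReal.rpow_mul, inv_mul_cancel₀ (radius_pos t).ne', NNReal.rpow_one]⟩

theorem mono_lt_one_of_nonpos {k : ℤ} {x : R} (hx : x ∈ S.mono k) (hk : k ≤ 0) {t t' : S.Radius}
    (h : t ≤ t') (hv : S.v t x < 1) : S.v t' x < 1 := by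
  obtain ⟨γ, hγ, e⟩ := exists_rpow_lt_one hv t
  exact (mono_le_of_nonpos hx hk h e.le).trans_lt (NNReal.rpow_lt_one hγ (radius_pos t'))

theorem mono_lt_one_of_nonneg {k : ℤ} {x : R} (hx : x ∈ S.mono k) (hk : 0 ≤ k) {t t' : S.Radius}
    (h : t ≤ t') (hv : S.v t' x < 1) : S.v t x < 1 := by
  obtain ⟨γ, hγ, e⟩ := exists_rpow_lt_one hv t'
  exact (mono_le_of_nonneg hx hk h e.le).trans_lt (NNReal.rpow_lt_one hγ (radius_pos t))

variable (S) in
/-- The leading index of a nonzero element at radius `t`: the largest one for `σ = 1`, the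
smallest one for `σ = -1`. -/
noncomputable def idx (σ : ℤ) (t : S.Radius) (x : R) : ℤ :=
  Classical.epsilon fun k => S.IsLead σ t k x

theorem isLead_idx {σ : ℤ} (hσ : σ ≠ 0) (t : S.Radius) {x : R} (hx : x ≠ 0) :
    S.IsLead σ t (S.idx σ t x) x :=
  Classical.epsilon_spec (exists_isLead hσ t hx)

theorem IsLead.idx_eq {σ : ℤ} (hσ : σ ≠ 0) {t : S.Radius} {x : R} (hx : x ≠ 0) {k : ℤ}
    (h : S.IsLead σ t k x) : S.idx σ t x = k :=
  (isLead_idx hσ t hx).unique hσ hx h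

theorem idx_mul {σ : ℤ} (hσ : σ ≠ 0) (t : S.Radius) {x y : R} (hx : x ≠ 0) (hy : y ≠ 0) :
    S.idx σ t (x * y) = S.idx σ t x + S.idx σ t y :=
  have := S.isDomain
  ((isLead_idx hσ t hx).mul hx hy (isLead_idx hσ t hy)).idx_eq hσ (mul_ne_zero hx hy)

theorem idx_congr {σ : ℤ} (hσ : σ ≠ 0) {t : S.Radius} {x y : R}
    (h : S.v t (x - y) < S.v t x) : S.idx σ t y = S.idx σ t x :=
  have hx : x ≠ 0 := fun h0 => by simp [h0] at h
  ((isLead_idx hσ t hx).congr h).idx_eq hσ (ne_zero_of_v_sub_lt h)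

theorem idx_mono_eq {σ : ℤ} (hσ : σ ≠ 0) (t : S.Radius) {x : R} (hx : x ≠ 0) {k : ℤ}
    (h : x ∈ S.mono k) : S.idx σ t x = k :=
  (isLead_of_mono h).idx_eq hσ hx

theorem idx_neg_le_idx (t : S.Radius) {x : R} (hx : x ≠ 0) : S.idx (-1) t x ≤ S.idx 1 t x := by
  obtain ⟨F, f, h1, h2, h3, -, -⟩ := exists_expansion_of_ne_zero hx t t
  obtain ⟨N, hN, hNv, -, h⟩ := exists_isLead_of_expansion (σ := -1) (by norm_num) (fun k _ => h1 k)
    (fun k _ => h2 k) h3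
  obtain ⟨N', -, -, hN', h'⟩ := exists_isLead_of_expansion (σ := 1) (by norm_num) (fun k _ => h1 k)
    (fun k _ => h2 k) h3
  rw [h.idx_eq (by norm_num) hx, h'.idx_eq (by norm_num) hx]
  have := hN' N hN hNv
  omega

/-- Leading indices increase with the radius, since a term of larger index that attains the maximum
at one radius has a larger constant `c` in its absolute value `P ^ (-k) * c ^ t`. -/
theorem idx_neg_le_idx_neg {s t : S.Radius} (hts : t ≤ s) {x : R} (hx : x ≠ 0) :
    S.idx (-1) t x ≤ S.idx (-1) s x := by
  obtain ⟨F, f, h1, h2, h3, h4, h5⟩ := exists_expansion_of_ne_zero hx s t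
  obtain ⟨n, hn, hnv, -, h⟩ := exists_isLead_of_expansion (σ := -1) (by norm_num) (fun k _ => h1 k)
    (fun k _ => h2 k) h3
  obtain ⟨m, -, hmv, hm, h'⟩ := exists_isLead_of_expansion (σ := -1) (by norm_num)
    (fun k _ => h1 k) (fun k _ => h4 k) h5
  rw [h.idx_eq (by norm_num) hx, h'.idx_eq (by norm_num) hx]
  by_contra hlt
  have hm0 : f m ≠ 0 := fun h0 => (v_pos (t := t) hx).ne' (by rw [← hmv, h0, map_zero])
  obtain ⟨y, hy, hfy⟩ := exists_mono_inv (h1 m) hm0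
  have hv : S.v t (f n) < S.v t x := lt_of_le_of_ne (h4 n) fun e => by
    have := hm n hn e
    omega
  have h6 : S.v t (f n * y) < 1 := by
    rw [map_mul, v_of_mul_eq_one hfy, ← div_eq_mul_inv, div_lt_one₀ (v_pos hm0), hmv]
    exact hv
  have h7 := mono_lt_one_of_nonpos (mono_mul (h1 n) hy) (by omega) hts h6
  rw [map_mul, v_of_mul_eq_one hfy, ← div_eq_mul_inv, div_lt_one₀ (v_pos hm0), hnv] at h7
  exact absurd (h2 m) (not_le.mpr h7)

theorem idx_one_le_idx_one {s t : S.Radius} (hts : t ≤ s) {x : R} (hx : x ≠ 0) :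
    S.idx 1 t x ≤ S.idx 1 s x := by
  obtain ⟨F, f, h1, h2, h3, h4, h5⟩ := exists_expansion_of_ne_zero hx s t
  obtain ⟨n, -, hnv, hn, h⟩ := exists_isLead_of_expansion (σ := 1) (by norm_num) (fun k _ => h1 k)
    (fun k _ => h2 k) h3
  obtain ⟨m, hm, hmv, -, h'⟩ := exists_isLead_of_expansion (σ := 1) (by norm_num)
    (fun k _ => h1 k) (fun k _ => h4 k) h5
  rw [h.idx_eq (by norm_num) hx, h'.idx_eq (by norm_num) hx]
  by_contra hlt
  have hn0 : f n ≠ 0 := fun h0 => (v_pos (t := s) hx).ne' (by rw [← hnv, h0, map_zero])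
  obtain ⟨y, hy, hfy⟩ := exists_mono_inv (h1 n) hn0
  have hv : S.v s (f m) < S.v s x := lt_of_le_of_ne (h2 m) fun e => by
    have := hn m hm e
    omega
  have h6 : S.v s (f m * y) < 1 := by
    rw [map_mul, v_of_mul_eq_one hfy, ← div_eq_mul_inv, div_lt_one₀ (v_pos hn0), hnv]
    exact hv
  have h7 := mono_lt_one_of_nonneg (mono_mul (h1 m) hy) (by omega) hts h6
  rw [map_mul, v_of_mul_eq_one hfy, ← div_eq_mul_inv, div_lt_one₀ (v_pos hn0), hmv] at h7
  exact absurd (h4 n) (not_le.mpr h7)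

/-! ### Degrees -/

variable (S) in
/-- The number of zeros with multiplicity in the closed annulus `[s, r]`: the difference of the
largest leading index at the outer radius and of the smallest one at the inner radius, as read off
from a Newton polygon. -/
noncomputable def deg (s : S.Radius) (x : R) : ℤ := S.idx 1 S.top x - S.idx (-1) s x

theorem deg_mul (s : S.Radius) {x y : R} (hx : x ≠ 0) (hy : y ≠ 0) :
    S.deg s (x * y) = S.deg s x + S.deg s y := by
  rw [deg, deg, deg, idx_mul (by norm_num) _ hx hy, idx_mul (by norm_num) _ hx hy]
  ring

theorem deg_nonneg (s : S.Radius) {x : R} (hx : x ≠ 0) : 0 ≤ S.deg s x := by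
  have h1 := idx_neg_le_idx s hx
  have h2 := idx_one_le_idx_one (le_top s) hx
  rw [deg]
  omega

theorem deg_anti {s t : S.Radius} (h : t ≤ s) {x : R} (hx : x ≠ 0) : S.deg s x ≤ S.deg t x := by
  have h1 := idx_neg_le_idx_neg h hx
  rw [deg, deg]
  omega

theorem deg_congr {s : S.Radius} {x y : R} (hs : S.v s (x - y) < S.v s x)
    (ht : S.v S.top (x - y) < S.v S.top x) : S.deg s y = S.deg s x := by
  rw [deg, deg, idx_congr (by norm_num) hs, idx_congr (by norm_num) ht]

theorem deg_mono (s : S.Radius) {x : R} (hx : x ≠ 0) {k : ℤ} (h : x ∈ S.mono k) :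
    S.deg s x = 0 := by
  rw [deg, idx_mono_eq (by norm_num) _ hx h, idx_mono_eq (by norm_num) _ hx h, sub_self]

theorem one_mem_mono : (1 : R) ∈ S.mono 0 := by simpa using pi_zpow_mem_mono (S := S) 0

theorem deg_one (s : S.Radius) : S.deg s (1 : R) = 0 :=
  have := S.isDomain
  deg_mono s one_ne_zero one_mem_mono

theorem deg_eq_zero_of_dvd {s : S.Radius} {x y : R} (h : x ∣ y) (hy : y ≠ 0)
    (h0 : S.deg s y = 0) : S.deg s x = 0 := by
  obtain ⟨z, rfl⟩ := h
  have hx := left_ne_zero_of_mul hy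
  have hz := right_ne_zero_of_mul hy
  have := deg_nonneg s hx
  have := deg_nonneg s hz
  rw [deg_mul s hx hz] at h0
  omega

theorem v_le_of_endpoints {s t : S.Radius} (hst : s ≤ t) {x : R} {ε : ℝ≥0} (hs : S.v s x ≤ ε)
    (ht : S.v S.top x ≤ ε) : S.v t x ≤ ε :=
  (S.v_le_max x hst (le_top t)).trans (max_le hs ht)

theorem v_lt_of_endpoints {s t : S.Radius} (hst : s ≤ t) {x : R} {ε : ℝ≥0} (hs : S.v s x < ε)
    (ht : S.v S.top x < ε) : S.v t x < ε :=
  (S.v_le_max x hst (le_top t)).trans_lt (max_lt hs ht)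

/-- An element without zeros in `[s, r]` is a monomial times a factor close to `1`. -/
theorem exists_mono_near_of_deg_eq_zero {s : S.Radius} {x : R} (hx : x ≠ 0) (h : S.deg s x = 0) :
    ∃ k, ∃ u ∈ S.mono k, ∃ c ∈ S.mono (-k), u * c = 1 ∧
      ∀ t, s ≤ t → S.v t (1 - c * x) < 1 := by
  classical
  obtain ⟨F, f, h1, h2, h3, h4, h5⟩ := exists_expansion_of_ne_zero hx s S.top
  obtain ⟨n, hn, hnv, hn', hl⟩ := exists_isLead_of_expansion (σ := -1) (by norm_num)
    (fun k _ => h1 k) (fun k _ => h2 k) h3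
  obtain ⟨m, hm, hmv, hm', hl'⟩ := exists_isLead_of_expansion (σ := 1) (by norm_num)
    (fun k _ => h1 k) (fun k _ => h4 k) h5
  have hnm : n = m := by
    rw [deg, hl.idx_eq (by norm_num) hx, hl'.idx_eq (by norm_num) hx] at h
    omega
  subst hnm
  have other : ∀ (t : S.Radius), s ≤ t → (∀ k, S.v t (f k) ≤ S.v t x) →
      S.v t (x - ∑ k ∈ F, f k) < S.v t x → S.v t (x - f n) < S.v t x := by
    intro t hst hle hlt
    have e : x - f n = (x - ∑ k ∈ F, f k) + ∑ k ∈ F.erase n, f k := by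
      rw [← Finset.add_sum_erase F f hn]; ring
    rw [e]
    refine Valuation.map_add_lt _ hlt (Valuation.map_sum_lt' _ (v_pos hx) fun k hk => ?_)
    obtain ⟨hkn, hkF⟩ := Finset.mem_erase.mp hk
    refine lt_of_le_of_ne (hle k) fun heq => hkn ?_
    obtain ⟨N, -, hNv, hNm, hNl⟩ := exists_isLead_of_expansion (σ := -1) (by norm_num)
      (fun k _ => h1 k) (fun k _ => hle k) hlt
    obtain ⟨M, -, hMv, hMm, hMl⟩ := exists_isLead_of_expansion (σ := 1) (by norm_num)
      (fun k _ => h1 k) (fun k _ => hle k) hlt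
    have a1 := hNm k hkF heq
    have a2 := hMm k hkF heq
    have b1 := idx_one_le_idx_one (le_top t) hx
    rw [hMl.idx_eq (by norm_num) hx, hl'.idx_eq (by norm_num) hx] at b1
    have b2 := idx_neg_le_idx_neg hst hx
    rw [hNl.idx_eq (by norm_num) hx, hl.idx_eq (by norm_num) hx] at b2
    omega
  have hn0 : f n ≠ 0 := fun h0 => (v_pos (t := s) hx).ne' (by rw [← hnv, h0, map_zero])
  obtain ⟨c, hc, hfc⟩ := exists_mono_inv (h1 n) hn0
  refine ⟨n, f n, h1 n, c, hc, hfc, fun t hst => ?_⟩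
  have near : ∀ t : S.Radius, S.v t (f n) = S.v t x → S.v t (x - f n) < S.v t x →
      S.v t (1 - c * x) < 1 := by
    intro t h1 h2
    have e : 1 - c * x = -(c * (x - f n)) := by linear_combination -hfc
    rw [e, Valuation.map_neg, map_mul, v_of_mul_eq_one hfc, mul_comm, ← div_eq_mul_inv,
      div_lt_one₀ (v_pos hn0), h1]
    exact h2
  exact v_lt_of_endpoints hst (near s hnv (other s le_rfl h2 h3))
    (near S.top hmv (other S.top (le_top s) h4 h5))

theorem exists_pow_le {s : S.Radius} {x : R} (h : ∀ t, s ≤ t → S.v t x < 1) {ε : ℝ≥0}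
    (hε : 0 < ε) : ∃ m, ∀ n, m ≤ n → ∀ t, s ≤ t → S.v t (x ^ n) ≤ ε := by
  have lim : ∀ t, s ≤ t → ∀ᶠ n in atTop, S.v t (x ^ n) ≤ ε := fun t ht => by
    have h1 := NNReal.tendsto_pow_atTop_nhds_zero_of_lt_one (h t ht)
    filter_upwards [(tendsto_order.mp h1).2 ε hε] with n hn
    rw [map_pow]; exact hn.le
  obtain ⟨m, hm⟩ := eventually_atTop.mp ((lim s le_rfl).and (lim S.top (le_top s)))
  exact ⟨m, fun n hn t ht => v_le_of_endpoints ht (hm n hn).1 (hm n hn).2⟩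

variable (S) in
/-- `b` lies in the closure of the ideal generated by `a` in the ring of functions on `[s, r]`. -/
def ClosureDvd (s : S.Radius) (a b : R) : Prop :=
  ∀ ε : ℝ≥0, 0 < ε → ∃ q, ∀ t, s ≤ t → S.v t (b - q * a) ≤ ε

theorem exists_v_bound (x : R) (s : S.Radius) : ∃ B : ℝ≥0, 0 < B ∧ ∀ t, s ≤ t → S.v t x ≤ B :=
  ⟨max (S.v s x) (S.v S.top x) + 1, by positivity, fun t ht =>
    (v_le_of_endpoints ht (le_max_left _ _) (le_max_right _ _)).trans le_self_add⟩

theorem ClosureDvd.mul_left {s : S.Radius} {a b : R} (h : S.ClosureDvd s a b) (c : R) :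
    S.ClosureDvd s (c * a) (c * b) := by
  intro ε hε
  obtain ⟨B, hB, hc⟩ := exists_v_bound c s
  obtain ⟨q, hq⟩ := h (ε / B) (div_pos hε hB)
  refine ⟨q, fun t ht => ?_⟩
  have e : c * b - q * (c * a) = c * (b - q * a) := by ring
  rw [e, map_mul]
  calc _ ≤ B * (ε / B) := mul_le_mul' (hc t ht) (hq t ht)
    _ = ε := mul_div_cancel₀ ε hB.ne'

/-- A multiple close to `1` makes `x` invertible on `[s, r]`, by the geometric series. -/
theorem closureDvd_one_of_lt {s : S.Radius} {x c : R} (h : ∀ t, s ≤ t → S.v t (1 - c * x) < 1) :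
    S.ClosureDvd s x 1 := by
  intro ε hε
  obtain ⟨m, hm⟩ := exists_pow_le h hε
  obtain ⟨q, hq⟩ : x ∣ 1 - (1 - c * x) ^ m := by
    have h1 := sub_dvd_pow_sub_pow (1 : R) (1 - c * x) m
    rw [one_pow, sub_sub_cancel] at h1
    exact (dvd_mul_left x c).trans h1
  refine ⟨q, fun t ht => ?_⟩
  have e : 1 - q * x = (1 - c * x) ^ m := by linear_combination hq
  rw [e]
  exact hm m le_rfl t ht

theorem closureDvd_one_of_deg {s : S.Radius} {x : R} (hx : x ≠ 0) (h : S.deg s x = 0) :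
    S.ClosureDvd s x 1 := by
  obtain ⟨k, u, -, c, -, -, hc⟩ := exists_mono_near_of_deg_eq_zero hx h
  exact closureDvd_one_of_lt hc

theorem deg_eq_zero_of_lt {s : S.Radius} {x c : R} (h : ∀ t, s ≤ t → S.v t (1 - c * x) < 1) :
    S.deg s x = 0 := by
  have h1 : S.deg s (c * x) = 0 := by
    rw [← deg_one (S := S) s]
    exact deg_congr (by rw [map_one]; exact h s le_rfl) (by rw [map_one]; exact h S.top (le_top s))
  refine deg_eq_zero_of_dvd (dvd_mul_left x c) ?_ h1
  exact ne_zero_of_v_sub_lt (x := 1) (t := s) (by rw [map_one]; exact h s le_rfl)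

variable (S) in
/-- A sequence of radii tending to zero. -/
noncomputable def rad (n : ℕ) : S.Radius :=
  ⟨S.r / (n + 1), div_pos S.r_pos (by positivity),
    div_le_self S.r_pos.le (by have : (0 : ℝ) ≤ n := n.cast_nonneg; linarith)⟩

theorem rad_anti {m n : ℕ} (h : m ≤ n) : S.rad n ≤ S.rad m := by
  show S.r / (n + 1) ≤ S.r / (m + 1)
  have := S.r_pos
  gcongr

theorem eventually_rad_le (t : S.Radius) : ∀ᶠ n in atTop, S.rad n ≤ t := by
  obtain ⟨N, hN⟩ := exists_nat_gt (S.r / t)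
  filter_upwards [eventually_ge_atTop N] with n hn
  show S.r / (n + 1) ≤ (t : ℝ)
  have h1 : (N : ℝ) ≤ n := by exact_mod_cast hn
  rw [div_le_iff₀ (by positivity)]
  rw [div_lt_iff₀ (radius_pos t)] at hN
  nlinarith [radius_pos t]

theorem tendsto_inv_succ : Tendsto (fun n : ℕ => ((n : ℝ≥0) + 1)⁻¹) atTop (𝓝 0) := by
  have := tendsto_one_div_add_atTop_nhds_zero_nat (𝕜 := ℝ≥0)
  simpa using this

/-- Principal ideals are closed: for `a ≠ 0` the approximate quotients form a Cauchy sequence at each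
radius, because the absolute values are multiplicative. -/
theorem dvd_of_closureDvd {a b : R} (h : ∀ n, S.ClosureDvd (S.rad n) a b) : a ∣ b := by
  by_cases ha : a = 0
  · have hb : b = 0 := S.eq_zero_of_v (t := S.top) <| le_antisymm
      (le_of_forall_gt fun ε hε => by
        obtain ⟨δ, h0, hδ⟩ := exists_between hε
        obtain ⟨q, hq⟩ := h 0 δ h0
        have := hq S.top (le_top _)
        rw [ha, mul_zero, sub_zero] at this
        exact this.trans_lt hδ) zero_le
    rw [hb]; exact dvd_zero a
  choose q hq using fun n => h n ((n : ℝ≥0) + 1)⁻¹ (by positivity)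
  have hq' : ∀ t, ∀ᶠ n in atTop, S.v t (b - q n * a) ≤ ((n : ℝ≥0) + 1)⁻¹ := fun t => by
    filter_upwards [eventually_rad_le t] with n hn using hq n t hn
  have lim : ∀ t, Tendsto (fun n => S.v t (b - q n * a)) atTop (𝓝 0) := fun t =>
    tendsto_zero_of_eventually_le tendsto_inv_succ (hq' t)
  obtain ⟨y, hy⟩ := S.exists_limit q fun t => by
    have h1 := ((lim t).max ((lim t).comp (tendsto_add_atTop_nat 1))).div_const (S.v t a)
    rw [max_self, zero_div] at h1
    refine tendsto_zero_of_eventually_le h1 (Eventually.of_forall fun n => ?_)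
    rw [le_div_iff₀ (v_pos ha), ← map_mul]
    have e : (q (n + 1) - q n) * a = (b - q n * a) - (b - q (n + 1) * a) := by ring
    rw [e]
    exact Valuation.map_sub _ _ _
  refine ⟨y, sub_eq_zero.mp (S.eq_zero_of_v (t := S.top) ?_)⟩
  have h1 := (lim S.top).max ((hy S.top).mul_const (S.v S.top a))
  rw [zero_mul, max_self] at h1
  refine le_antisymm (ge_of_tendsto h1 (Eventually.of_forall fun n => ?_)) zero_le
  have e : b - a * y = (b - q n * a) + (q n - y) * a := by ring
  rw [e, ← map_mul]
  exact Valuation.map_add _ _ _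

/-- An element without zeros is a unit. -/
theorem isUnit_of_deg {x : R} (hx : x ≠ 0) (h : ∀ n, S.deg (S.rad n) x = 0) : IsUnit x :=
  isUnit_of_dvd_one (dvd_of_closureDvd fun n => closureDvd_one_of_deg hx (h n))

theorem deg_of_isUnit {x : R} (hx : IsUnit x) (s : S.Radius) : S.deg s x = 0 :=
  have := S.isDomain
  deg_eq_zero_of_dvd (isUnit_iff_dvd_one.mp hx) one_ne_zero (deg_one s)

theorem min_le_v_mono {k : ℤ} {x : R} (hx : x ∈ S.mono k) {s t : S.Radius} (hst : s ≤ t) :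
    min (S.v s x) (S.v S.top x) ≤ S.v t x := by
  by_cases h0 : x = 0
  · simp [h0]
  obtain ⟨y, -, hy⟩ := exists_mono_inv hx h0
  have h1 := S.v_le_max y hst (le_top t)
  rw [v_of_mul_eq_one hy, v_of_mul_eq_one hy, v_of_mul_eq_one hy] at h1
  rcases le_max_iff.mp h1 with h | h
  · exact (min_le_left _ _).trans ((inv_le_inv₀ (v_pos h0) (v_pos h0)).mp h)
  · exact (min_le_right _ _).trans ((inv_le_inv₀ (v_pos h0) (v_pos h0)).mp h)

/-- Absolute values of a nonzero element are bounded below on `[s, r]`. -/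
theorem exists_le_v {x : R} (hx : x ≠ 0) (s : S.Radius) :
    ∃ m : ℝ≥0, 0 < m ∧ ∀ t, s ≤ t → m ≤ S.v t x := by
  obtain ⟨u, hu, huv, hux⟩ := isLead_idx (σ := -1) (by norm_num) s hx
  have hu0 : u ≠ 0 := fun h0 => (v_pos (t := s) hx).ne' (by rw [← huv, h0, map_zero])
  set m := min (S.v s u) (S.v S.top u) with hm
  have hm0 : 0 < m := lt_min (v_pos hu0) (v_pos hu0)
  obtain ⟨ε, h0, hε⟩ := exists_between hm0
  obtain ⟨F, f, h1, -, h2⟩ := exists_mono_expansion x s h0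
  have hεs : ε < S.v s x := hε.trans_le ((min_le_left _ _).trans huv.le)
  obtain ⟨N, -, hNv, -, hN⟩ := exists_isLead_of_expansion (σ := -1) (by norm_num) (fun k _ => h1 k)
    (fun k _ => ((h2 s le_rfl).1 k).trans (max_le le_rfl hεs.le)) ((h2 s le_rfl).2.trans_lt hεs)
  have hNk := hN.idx_eq (by norm_num) hx
  refine ⟨m, hm0, fun t ht => ?_⟩
  have h3 := min_le_v_mono hu ht
  rw [← mono_v_eq (h1 N) (hNk ▸ hu) (hNv.trans huv.symm) t] at h3
  rcases le_max_iff.mp (h3.trans ((h2 t ht).1 N)) with h | h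
  · exact h
  · exact absurd h (not_le.mpr hε)

/-! ### Division with remainder -/

variable (S) in
/-- The filtration used for division by `a`: a bound for all radii in `[s, r]`, relative to `a`. -/
def Bdd (s : S.Radius) (a : R) (γ : ℝ≥0) (x : R) : Prop :=
  ∀ t, s ≤ t → S.v t x ≤ γ ^ (t : ℝ) * S.v t a

theorem Bdd.add {s : S.Radius} {a : R} {γ : ℝ≥0} {x y : R} (hx : S.Bdd s a γ x)
    (hy : S.Bdd s a γ y) : S.Bdd s a γ (x + y) := fun t ht =>
  Valuation.map_add_le _ (hx t ht) (hy t ht)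

theorem Bdd.neg {s : S.Radius} {a : R} {γ : ℝ≥0} {x : R} (hx : S.Bdd s a γ x) :
    S.Bdd s a γ (-x) := fun t ht => by rw [Valuation.map_neg]; exact hx t ht

theorem Bdd.sub {s : S.Radius} {a : R} {γ : ℝ≥0} {x y : R} (hx : S.Bdd s a γ x)
    (hy : S.Bdd s a γ y) : S.Bdd s a γ (x - y) := sub_eq_add_neg x y ▸ hx.add hy.neg

theorem bdd_zero {s : S.Radius} {a : R} {γ : ℝ≥0} : S.Bdd s a γ 0 := fun t _ => by simp

theorem Bdd.sum {s : S.Radius} {a : R} {γ : ℝ≥0} {ι : Type*} {F : Finset ι} {f : ι → R}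
    (h : ∀ i ∈ F, S.Bdd s a γ (f i)) : S.Bdd s a γ (∑ i ∈ F, f i) := fun t ht =>
  Valuation.map_sum_le _ fun i hi => h i hi t ht

theorem Bdd.le {s : S.Radius} {a : R} {γ γ' : ℝ≥0} {x : R} (hx : S.Bdd s a γ x) (h : γ ≤ γ') :
    S.Bdd s a γ' x := fun t ht =>
  (hx t ht).trans (mul_le_mul_left (NNReal.rpow_le_rpow h (radius_pos t).le) _)

theorem Bdd.mul {s : S.Radius} {a : R} {γ γ' : ℝ≥0} {x y : R} (hx : S.Bdd s 1 γ x)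
    (hy : S.Bdd s a γ' y) : S.Bdd s a (γ * γ') (x * y) := fun t ht => by
  have h := hx t ht
  rw [map_one, mul_one] at h
  rw [map_mul, NNReal.mul_rpow, mul_assoc]
  exact mul_le_mul' h (hy t ht)

theorem Bdd.of_self {s : S.Radius} {a : R} {γ : ℝ≥0} {x : R} (hx : ∀ t, s ≤ t → S.v t x ≤ S.v t a)
    {y : R} (hy : S.Bdd s 1 γ y) : S.Bdd s a γ (y * x) := by
  have : S.Bdd s a 1 x := fun t ht => by rw [NNReal.one_rpow, one_mul]; exact hx t ht
  simpa using hy.mul this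

variable (S) in
/-- The terms of `a` that matter on the annulus `[s, r]`: monomials with indices between the
smallest leading index at radius `s` and the largest one at radius `r`, up to a relative error
given by `ρ`. -/
structure PrincipalPart (s : S.Radius) (a : R) where
  ne_zero : a ≠ 0
  f : ℤ → R
  ρ : ℝ≥0
  ρ_pos : 0 < ρ
  ρ_lt_one : ρ < 1
  δ_le : ∀ t : S.Radius, S.δ ≤ ρ ^ (t : ℝ)
  f_mem : ∀ k, f k ∈ S.mono k
  f_le : ∀ k t, s ≤ t → S.v t (f k) ≤ S.v t a
  f_lo : S.v s (f (S.idx (-1) s a)) = S.v s a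
  f_hi : S.v S.top (f (S.idx 1 S.top a)) = S.v S.top a
  tail : S.Bdd s a ρ (a - ∑ k ∈ Finset.Icc (S.idx (-1) s a) (S.idx 1 S.top a), f k)

theorem exists_principalPart {a : R} (ha : a ≠ 0) (s : S.Radius) :
    Nonempty (S.PrincipalPart s a) := by
  classical
  obtain ⟨m, hm0, hm⟩ := exists_le_v ha s
  have hε : 0 < S.δ * m := mul_pos S.δ_pos hm0
  have hεm : S.δ * m < m := mul_lt_of_lt_one_left hm0 S.δ_lt_one
  obtain ⟨F, f, f1, f0, f2⟩ := exists_mono_expansion a s hε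
  have f_le : ∀ k t, s ≤ t → S.v t (f k) ≤ S.v t a := fun k t ht =>
    ((f2 t ht).1 k).trans (max_le le_rfl (hεm.le.trans (hm t ht)))
  have f_lt : ∀ t, s ≤ t → S.v t (a - ∑ k ∈ F, f k) < S.v t a := fun t ht =>
    (f2 t ht).2.trans_lt (hεm.trans_le (hm t ht))
  obtain ⟨k₀, -, hlo, hlo', hl⟩ := exists_isLead_of_expansion (σ := -1) (by norm_num)
    (fun k _ => f1 k) (fun k _ => f_le k s le_rfl) (f_lt s le_rfl)
  obtain ⟨k₁, -, hhi, hhi', hl'⟩ := exists_isLead_of_expansion (σ := 1) (by norm_num)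
    (fun k _ => f1 k) (fun k _ => f_le k S.top (le_top s)) (f_lt S.top (le_top s))
  have e0 := hl.idx_eq (by norm_num) ha
  have e1 := hl'.idx_eq (by norm_num) ha
  let e : ℤ → ℝ≥0 := fun k => if k₁ < k then (S.v S.top (f k) / S.v S.top a) ^ (S.r)⁻¹
    else if k < k₀ then (S.v s (f k) / S.v s a) ^ (s : ℝ)⁻¹ else 0
  let ρ := max (S.δ ^ (S.r)⁻¹) (F.sup e)
  have hρ1 : ρ < 1 := by
    refine max_lt (NNReal.rpow_lt_one S.δ_lt_one (inv_pos.mpr S.r_pos))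
      ((Finset.sup_lt_iff (by simp)).mpr fun k hk => ?_)
    simp only [e]
    split_ifs with h h'
    · refine NNReal.rpow_lt_one ?_ (inv_pos.mpr S.r_pos)
      refine (div_lt_one₀ (v_pos ha)).mpr (lt_of_le_of_ne (f_le k _ (le_top s)) fun e => ?_)
      have := hhi' k hk e
      omega
    · refine NNReal.rpow_lt_one ?_ (inv_pos.mpr (radius_pos s))
      refine (div_lt_one₀ (v_pos ha)).mpr (lt_of_le_of_ne (f_le k _ le_rfl) fun e => ?_)
      have := hlo' k hk e
      omega
    · exact zero_lt_one
  have hρ0 : 0 < ρ := (NNReal.rpow_pos S.δ_pos).trans_le (le_max_left _ _)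
  have hδr : S.δ ≤ ρ ^ S.r := by
    calc S.δ = (S.δ ^ (S.r)⁻¹) ^ S.r := by
          rw [← NNReal.rpow_mul, inv_mul_cancel₀ S.r_pos.ne', NNReal.rpow_one]
      _ ≤ _ := NNReal.rpow_le_rpow (le_max_left _ _) S.r_pos.le
  have hδ : ∀ t : S.Radius, S.δ ≤ ρ ^ (t : ℝ) := fun t =>
    hδr.trans (NNReal.rpow_le_rpow_of_exponent_ge hρ0 hρ1.le t.2.2)
  have hratio : ∀ (t : S.Radius) (x : R), (S.v t x / S.v t a) ^ (t : ℝ)⁻¹ ≤ ρ →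
      S.v t x ≤ ρ ^ (t : ℝ) * S.v t a := by
    intro t x h
    rw [← div_le_iff₀ (v_pos ha)]
    calc S.v t x / S.v t a = ((S.v t x / S.v t a) ^ (t : ℝ)⁻¹) ^ (t : ℝ) := by
          rw [← NNReal.rpow_mul, inv_mul_cancel₀ (radius_pos t).ne', NNReal.rpow_one]
      _ ≤ _ := NNReal.rpow_le_rpow h (radius_pos t).le
  have ne : ∀ {t : S.Radius} {k : ℤ}, S.v t (f k) = S.v t a → f k ≠ 0 := fun {t k} h h0 =>
    (v_pos (t := t) ha).ne' (by rw [← h, h0, map_zero])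
  have outside : ∀ k ∈ F, k ∉ Finset.Icc k₀ k₁ → S.Bdd s a ρ (f k) := by
    intro k hk hkI
    have hek : e k ≤ ρ := (Finset.le_sup hk).trans (le_max_right _ _)
    simp only [e] at hek
    by_cases h : k₁ < k
    · rw [if_pos h] at hek
      obtain ⟨y, hy, hfy⟩ := exists_mono_inv (f1 k₁) (ne hhi)
      have hv := hratio S.top (f k) hek
      have h1 : S.v S.top (f k * y) ≤ ρ ^ (S.top : ℝ) := by
        rw [map_mul, v_of_mul_eq_one hfy, ← div_eq_mul_inv, div_le_iff₀ (v_pos (ne hhi)), hhi]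
        exact hv
      intro t ht
      have h2 := mono_le_of_nonneg (mono_mul (f1 k) hy) (by omega) (le_top t) h1
      rw [map_mul, v_of_mul_eq_one hfy, ← div_eq_mul_inv, div_le_iff₀ (v_pos (ne hhi))] at h2
      exact h2.trans (mul_le_mul_right (f_le k₁ t ht) _)
    · have h' : k < k₀ := by
        by_contra h'
        exact hkI (Finset.mem_Icc.mpr ⟨by omega, by omega⟩)
      rw [if_neg h, if_pos h'] at hek
      obtain ⟨y, hy, hfy⟩ := exists_mono_inv (f1 k₀) (ne hlo)
      have hv := hratio s (f k) hek
      have h1 : S.v s (f k * y) ≤ ρ ^ (s : ℝ) := by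
        rw [map_mul, v_of_mul_eq_one hfy, ← div_eq_mul_inv, div_le_iff₀ (v_pos (ne hlo)), hlo]
        exact hv
      intro t ht
      have h2 := mono_le_of_nonpos (mono_mul (f1 k) hy) (by omega) ht h1
      rw [map_mul, v_of_mul_eq_one hfy, ← div_eq_mul_inv, div_le_iff₀ (v_pos (ne hlo))] at h2
      exact h2.trans (mul_le_mul_right (f_le k₀ t ht) _)
  refine ⟨⟨ha, f, ρ, hρ0, hρ1, hδ, f1, f_le, by rw [e0]; exact hlo, by rw [e1]; exact hhi, ?_⟩⟩
  rw [e0, e1]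
  have e2 : a - ∑ k ∈ Finset.Icc k₀ k₁, f k =
      (a - ∑ k ∈ F, f k) + ∑ k ∈ F \ Finset.Icc k₀ k₁, f k := by
    have h1 : ∑ k ∈ Finset.Icc k₀ k₁, f k = ∑ k ∈ F ∩ Finset.Icc k₀ k₁, f k :=
      (Finset.sum_subset Finset.inter_subset_right fun k hk hk' =>
        f0 k fun h => hk' (Finset.mem_inter.mpr ⟨h, hk⟩)).symm
    rw [h1, ← Finset.sum_inter_add_sum_sdiff F (Finset.Icc k₀ k₁) f]
    ring
  rw [e2]
  refine Bdd.add (fun t ht => (f2 t ht).2.trans (mul_le_mul' (hδ t) (hm t ht))) (Bdd.sum fun k hk => ?_)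
  obtain ⟨hk1, hk2⟩ := Finset.mem_sdiff.mp hk
  exact outside k hk1 hk2

namespace PrincipalPart

variable {s : S.Radius} {a : R} (p : S.PrincipalPart s a)

/-- Remainders: sums of monomials with indices in `[k₀, k₁)` where `k₀` and `k₁` are the extremal
leading indices of `a`. Such a sum has at most `k₁ - k₀ - 1` zeros in `[s, r]`, if it is not zero. -/
def IsRem (_p : S.PrincipalPart s a) (γ : ℝ≥0) (z : R) : Prop :=
  ∃ g : ℤ → R, (∀ k, g k ∈ S.mono k) ∧ (∀ k, S.Bdd s a γ (g k)) ∧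
    z = ∑ k ∈ Finset.Ico (S.idx (-1) s a) (S.idx 1 S.top a), g k

variable {p}

theorem IsRem.bdd {γ : ℝ≥0} {z : R} (h : p.IsRem γ z) : S.Bdd s a γ z := by
  obtain ⟨g, -, h2, rfl⟩ := h
  exact Bdd.sum fun k _ => h2 k

theorem isRem_zero {γ : ℝ≥0} : p.IsRem γ 0 :=
  ⟨0, fun k => zero_mem_mono k, fun _ => bdd_zero, by simp⟩

theorem IsRem.neg {γ : ℝ≥0} {z : R} (h : p.IsRem γ z) : p.IsRem γ (-z) := by
  obtain ⟨g, h1, h2, rfl⟩ := h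
  exact ⟨-g, fun k => mono_neg (h1 k), fun k => (h2 k).neg, by simp⟩

/-- The sum of a remainder and of a smaller one is a remainder, up to an error that is small
compared to the smaller one. -/
theorem IsRem.add {γ γ' : ℝ≥0} {z z' : R} (h : p.IsRem γ z) (h' : p.IsRem γ' z') (hγ : γ' ≤ γ) :
    ∃ z'', p.IsRem γ z'' ∧ S.Bdd s a (p.ρ * γ') (z + z' - z'') := by
  obtain ⟨g, h1, h2, rfl⟩ := h
  obtain ⟨g', h1', h2', rfl⟩ := h'
  choose g'' hg hgv using fun k => mono_add (h1 k) (h1' k)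
  refine ⟨_, ⟨g'', hg, fun k t ht => (hgv k t).1.trans
    (max_le (h2 k t ht) ((h2' k).le hγ t ht)), rfl⟩, ?_⟩
  rw [← Finset.sum_add_distrib, ← Finset.sum_sub_distrib]
  refine Bdd.sum fun k _ t ht => (hgv k t).2.trans ?_
  rw [NNReal.mul_rpow, mul_assoc]
  exact mul_le_mul' (p.δ_le t) (h2' k t ht)

variable (p)

/-- Elements that can be divided by `a` up to a relative error given by `ρ`. -/
def divisible (γ : ℝ≥0) : AddSubgroup R where
  carrier := {x | ∃ q z, S.Bdd s 1 γ q ∧ p.IsRem γ z ∧ S.Bdd s a (p.ρ * γ) (x - (q * a + z))}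
  zero_mem' := ⟨0, 0, bdd_zero, isRem_zero, by simpa using bdd_zero⟩
  neg_mem' := by
    rintro x ⟨q, z, hq, hz, h⟩
    refine ⟨-q, -z, hq.neg, hz.neg, ?_⟩
    convert h.neg using 1
    ring
  add_mem' := by
    rintro x y ⟨q, z, hq, hz, h⟩ ⟨q', z', hq', hz', h'⟩
    obtain ⟨z'', hz'', hw⟩ := hz.add hz' le_rfl
    refine ⟨q + q', z'', hq.add hq', hz'', ?_⟩
    convert (h.add h').add hw using 1
    ring

variable {p}

theorem mem_divisible_of_small {γ : ℝ≥0} {x : R} (hx : S.Bdd s a (p.ρ * γ) x) :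
    x ∈ p.divisible γ :=
  ⟨0, 0, bdd_zero, isRem_zero, by simpa using hx⟩

theorem mul_mem_divisible {γ : ℝ≥0} {q : R} (hq : S.Bdd s 1 γ q) : q * a ∈ p.divisible γ :=
  ⟨q, 0, hq, isRem_zero, by simpa using bdd_zero⟩

theorem mem_divisible_of_mono_mid {γ : ℝ≥0} {k : ℤ} {x : R} (hk : S.idx (-1) s a ≤ k)
    (hk' : k < S.idx 1 S.top a) (hx : x ∈ S.mono k) (hb : S.Bdd s a γ x) :
    x ∈ p.divisible γ := by
  classical
  refine ⟨0, x, bdd_zero, ⟨fun l => if l = k then x else 0, fun l => ?_, fun l => ?_, ?_⟩, by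
    simpa using bdd_zero⟩
  · dsimp only; split_ifs with h
    · exact h ▸ hx
    · exact zero_mem_mono l
  · dsimp only; split_ifs
    · exact hb
    · exact bdd_zero
  · rw [Finset.sum_ite_eq', if_pos (Finset.mem_Ico.mpr ⟨hk, hk'⟩)]

theorem idx_le (p : S.PrincipalPart s a) : S.idx (-1) s a ≤ S.idx 1 S.top a := by
  have := deg_nonneg s p.ne_zero
  rw [deg] at this
  omega

theorem f_hi_ne (p : S.PrincipalPart s a) : p.f (S.idx 1 S.top a) ≠ 0 := fun h0 =>
  (v_pos (t := S.top) p.ne_zero).ne' (by rw [← p.f_hi, h0, map_zero])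

theorem f_lo_ne (p : S.PrincipalPart s a) : p.f (S.idx (-1) s a) ≠ 0 := fun h0 =>
  (v_pos (t := s) p.ne_zero).ne' (by rw [← p.f_lo, h0, map_zero])

/-- Monomials of index at least the smallest leading index of `a` can be divided by `a` with remainder.
If the index is less than the largest one, they are remainders; otherwise subtract the multiple of
`a` with the same leading monomial at the outer radius, which replaces the monomial by monomials of
smaller index. Bounds at the outer radius suffice because the index of the quotient is
nonnegative. -/
theorem mem_divisible_of_mono_high {γ : ℝ≥0} (n : ℕ) : ∀ {k : ℤ} {x : R},
    S.idx (-1) s a ≤ k → k < S.idx 1 S.top a + n → x ∈ S.mono k → S.Bdd s a γ x →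
    x ∈ p.divisible γ := by
  induction n with
  | zero =>
    intro k x hk hk' hx hb
    exact mem_divisible_of_mono_mid hk (by simpa using hk') hx hb
  | succ n ih =>
    intro k x hk hk' hx hb
    have hle := p.idx_le
    rcases lt_or_ge k (S.idx 1 S.top a) with h | h
    · exact mem_divisible_of_mono_mid hk h hx hb
    obtain ⟨y, hy, hfy⟩ := exists_mono_inv (p.f_mem _) p.f_hi_ne
    have hqm := mono_mul hx hy
    have hq : S.Bdd s 1 γ (x * y) := by
      intro t ht
      rw [map_one, mul_one]
      refine mono_le_of_nonneg hqm (by omega) (le_top t) ?_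
      rw [map_mul, v_of_mul_eq_one hfy, ← div_eq_mul_inv, div_le_iff₀ (v_pos p.f_hi_ne), p.f_hi]
      exact hb S.top (le_top s)
    have e : x = x * y * a - x * y * (a - ∑ k ∈ Finset.Icc (S.idx (-1) s a) (S.idx 1 S.top a), p.f k)
        - ∑ j ∈ Finset.Ico (S.idx (-1) s a) (S.idx 1 S.top a), x * y * p.f j := by
      rw [← Finset.mul_sum, ← Finset.sum_Ico_add_eq_sum_Icc hle]
      linear_combination (-x) * hfy
    rw [e]
    refine sub_mem (sub_mem (mul_mem_divisible hq) (mem_divisible_of_small ?_))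
      (sum_mem fun j hj => ?_)
    · rw [mul_comm p.ρ]; exact hq.mul p.tail
    · rw [Finset.mem_Ico] at hj
      refine ih (k := k + -S.idx 1 S.top a + j) (by omega) (by push_cast at hk'; omega)
        (mono_mul hqm (p.f_mem j)) (Bdd.of_self (p.f_le j) hq)

/-- Monomials of arbitrary index can be divided by `a` with remainder: below the smallest leading index
of `a`, the same argument applies at the inner radius. -/
theorem mem_divisible_of_mono_low {γ : ℝ≥0} (n : ℕ) : ∀ {k : ℤ} {x : R},
    S.idx (-1) s a - n ≤ k → x ∈ S.mono k → S.Bdd s a γ x → x ∈ p.divisible γ := by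
  induction n with
  | zero =>
    intro k x hk hx hb
    exact mem_divisible_of_mono_high (k - S.idx 1 S.top a + 1).toNat (by simpa using hk)
      (by omega) hx hb
  | succ n ih =>
    intro k x hk hx hb
    have hle := p.idx_le
    rcases le_or_gt (S.idx (-1) s a) k with h | h
    · exact mem_divisible_of_mono_high (k - S.idx 1 S.top a + 1).toNat h (by omega) hx hb
    obtain ⟨y, hy, hfy⟩ := exists_mono_inv (p.f_mem _) p.f_lo_ne
    have hqm := mono_mul hx hy
    have hq : S.Bdd s 1 γ (x * y) := by
      intro t ht
      rw [map_one, mul_one]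
      refine mono_le_of_nonpos hqm (by omega) ht ?_
      rw [map_mul, v_of_mul_eq_one hfy, ← div_eq_mul_inv, div_le_iff₀ (v_pos p.f_lo_ne), p.f_lo]
      exact hb s le_rfl
    have e : x = x * y * a - x * y * (a - ∑ k ∈ Finset.Icc (S.idx (-1) s a) (S.idx 1 S.top a), p.f k)
        - ∑ j ∈ Finset.Ioc (S.idx (-1) s a) (S.idx 1 S.top a), x * y * p.f j := by
      rw [← Finset.mul_sum, ← Finset.sum_Ioc_add_eq_sum_Icc hle]
      linear_combination (-x) * hfy
    rw [e]
    refine sub_mem (sub_mem (mul_mem_divisible hq) (mem_divisible_of_small ?_))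
      (sum_mem fun j hj => ?_)
    · rw [mul_comm p.ρ]; exact hq.mul p.tail
    · rw [Finset.mem_Ioc] at hj
      refine ih (k := k + -S.idx (-1) s a + j) (by push_cast at hk; omega)
        (mono_mul hqm (p.f_mem j)) (Bdd.of_self (p.f_le j) hq)

theorem rpow_lower (γ : ℝ≥0) (hγ : 0 < γ) (s : S.Radius) :
    ∃ m : ℝ≥0, 0 < m ∧ ∀ t : S.Radius, s ≤ t → m ≤ γ ^ (t : ℝ) := by
  rcases le_or_gt γ 1 with h | h
  · exact ⟨γ ^ S.r, NNReal.rpow_pos hγ, fun t _ =>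
      NNReal.rpow_le_rpow_of_exponent_ge hγ h t.2.2⟩
  · exact ⟨1, zero_lt_one, fun t _ => NNReal.one_le_rpow h.le (radius_pos t).le⟩

theorem mem_divisible {γ : ℝ≥0} (hγ : 0 < γ) {x : R} (hx : S.Bdd s a γ x) :
    x ∈ p.divisible γ := by
  obtain ⟨m, hm0, hm⟩ := exists_le_v p.ne_zero s
  obtain ⟨m', hm0', hm'⟩ := rpow_lower (p.ρ * γ) (mul_pos p.ρ_pos hγ) s
  obtain ⟨F, f, f1, -, f2⟩ := exists_mono_expansion x s (mul_pos hm0' hm0)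
  have small : ∀ t, s ≤ t → m' * m ≤ (p.ρ * γ) ^ (t : ℝ) * S.v t a := fun t ht =>
    mul_le_mul' (hm' t ht) (hm t ht)
  have e : x = (x - ∑ k ∈ F, f k) + ∑ k ∈ F, f k := by ring
  rw [e]
  refine add_mem (mem_divisible_of_small fun t ht => (f2 t ht).2.trans (small t ht))
    (sum_mem fun k _ => ?_)
  have hb : S.Bdd s a γ (f k) := fun t ht => ((f2 t ht).1 k).trans (max_le (hx t ht)
    ((small t ht).trans (mul_le_mul_left (NNReal.rpow_le_rpow
      (mul_le_of_le_one_left zero_le p.ρ_lt_one.le) (radius_pos t).le) _)))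
  exact mem_divisible_of_mono_low (S.idx (-1) s a - k).toNat (by omega) (f1 k) hb

/-- Division by `a` to any given precision. -/
theorem exists_division {γ : ℝ≥0} (hγ : 0 < γ) {x : R} (hx : S.Bdd s a γ x) (n : ℕ) :
    ∃ q z, S.Bdd s 1 γ q ∧ p.IsRem γ z ∧ S.Bdd s a (p.ρ ^ n * γ) (x - (q * a + z)) := by
  induction n with
  | zero => exact ⟨0, 0, bdd_zero, isRem_zero, by simpa using hx⟩
  | succ n ih =>
    obtain ⟨q, z, hq, hz, hw⟩ := ih
    have hle : p.ρ ^ n * γ ≤ γ :=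
      mul_le_of_le_one_left zero_le (pow_le_one₀ zero_le p.ρ_lt_one.le)
    obtain ⟨q', z', hq', hz', hw'⟩ := mem_divisible (p := p) (mul_pos (pow_pos p.ρ_pos n) hγ) hw
    obtain ⟨z'', hz'', hw''⟩ := hz.add hz' hle
    refine ⟨q + q', z'', hq.add (hq'.le hle), hz'', ?_⟩
    rw [pow_succ', mul_assoc]
    convert hw'.add hw'' using 1
    ring

end PrincipalPart

theorem exists_bdd {a : R} (ha : a ≠ 0) (s : S.Radius) (x : R) :
    ∃ γ : ℝ≥0, 0 < γ ∧ S.Bdd s a γ x := by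
  obtain ⟨m, hm0, hm⟩ := exists_le_v ha s
  obtain ⟨B, hB0, hB⟩ := exists_v_bound x s
  set c := max (B / m) 1 with hc
  have hc1 : 1 ≤ c := le_max_right _ _
  have hγ : 1 ≤ c ^ (s : ℝ)⁻¹ := NNReal.one_le_rpow hc1 (inv_nonneg.mpr (radius_pos s).le)
  refine ⟨c ^ (s : ℝ)⁻¹, zero_lt_one.trans_le hγ, fun t ht => ?_⟩
  have h1 : c ≤ (c ^ (s : ℝ)⁻¹) ^ (t : ℝ) := by
    calc c = (c ^ (s : ℝ)⁻¹) ^ (s : ℝ) := by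
          rw [← NNReal.rpow_mul, inv_mul_cancel₀ (radius_pos s).ne', NNReal.rpow_one]
      _ ≤ _ := NNReal.rpow_le_rpow_of_exponent_le hγ ht
  calc S.v t x ≤ B := hB t ht
    _ = B / m * m := (div_mul_cancel₀ _ hm0.ne').symm
    _ ≤ _ := mul_le_mul' ((le_max_left _ _).trans h1) (hm t ht)

/-- A monomial of given index that is small at one radius is small on `[s, r]`. -/
theorem exists_mono_small (k : ℤ) (s t₀ : S.Radius) {ε : ℝ≥0} (hε : 0 < ε) :
    ∃ η : ℝ≥0, 0 < η ∧ ∀ x ∈ S.mono k, S.v t₀ x ≤ η → ∀ t, s ≤ t → S.v t x ≤ ε := by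
  have hP : 0 < S.P ^ (-k) := zpow_pos P_pos _
  set c₀ := min 1 ((ε / S.P ^ (-k)) ^ (s : ℝ)⁻¹) with hc₀
  have h0 : 0 < c₀ := lt_min zero_lt_one (NNReal.rpow_pos (div_pos hε hP))
  refine ⟨S.P ^ (-k) * c₀ ^ (t₀ : ℝ), mul_pos hP (NNReal.rpow_pos h0), fun x hx hv t ht => ?_⟩
  obtain ⟨c, hc⟩ := mono_abs hx
  rw [hc] at hv ⊢
  have h1 : c ≤ c₀ := (NNReal.rpow_le_rpow_iff (radius_pos t₀)).mp (le_of_mul_le_mul_left hv hP)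
  calc S.P ^ (-k) * c ^ (t : ℝ) ≤ S.P ^ (-k) * c₀ ^ (t : ℝ) :=
        mul_le_mul_right (NNReal.rpow_le_rpow h1 (radius_pos t).le) _
    _ ≤ S.P ^ (-k) * c₀ ^ (s : ℝ) :=
        mul_le_mul_right (NNReal.rpow_le_rpow_of_exponent_ge h0 (min_le_left _ _) ht) _
    _ ≤ S.P ^ (-k) * ((ε / S.P ^ (-k)) ^ (s : ℝ)⁻¹) ^ (s : ℝ) :=
        mul_le_mul_right (NNReal.rpow_le_rpow (min_le_right _ _) (radius_pos s).le) _
    _ = ε := by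
        rw [← NNReal.rpow_mul, inv_mul_cancel₀ (radius_pos s).ne', NNReal.rpow_one,
          mul_div_cancel₀ _ hP.ne']

namespace PrincipalPart

variable {s : S.Radius} {a : R} {p : S.PrincipalPart s a}

/-- A remainder that is small at one radius is small on `[s, r]`. -/
theorem exists_isRem_small (p : S.PrincipalPart s a) (t₀ : S.Radius) {ε : ℝ≥0} (hε : 0 < ε) :
    ∃ η : ℝ≥0, 0 < η ∧ ∀ γ z, p.IsRem γ z → S.v t₀ z ≤ η → ∀ t, s ≤ t → S.v t z ≤ ε := by
  choose η h0 hη using fun k => exists_mono_small (S := S) k s t₀ hε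
  by_cases hne : (Finset.Ico (S.idx (-1) s a) (S.idx 1 S.top a)).Nonempty
  · refine ⟨_, (Finset.lt_inf'_iff hne).mpr fun k _ => h0 k, ?_⟩
    rintro γ z ⟨g, hg, -, rfl⟩ hz t ht
    refine Valuation.map_sum_le _ fun k hk => hη k (g k) (hg k) ?_ t ht
    exact ((le_v_sum _ (fun k _ => hg k) t₀ k hk).trans hz).trans (Finset.inf'_le _ hk)
  · refine ⟨1, zero_lt_one, ?_⟩
    rintro γ z ⟨g, -, -, rfl⟩ - t ht
    rw [Finset.not_nonempty_iff_eq_empty.mp hne, Finset.sum_empty, map_zero]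
    exact zero_le

theorem IsRem.exists_isLead {γ : ℝ≥0} {z : R} (h : p.IsRem γ z) (hz : z ≠ 0) {σ : ℤ} (hσ : σ ≠ 0)
    (t : S.Radius) : S.idx (-1) s a ≤ S.idx σ t z ∧ S.idx σ t z < S.idx 1 S.top a := by
  obtain ⟨g, hg, -, rfl⟩ := h
  obtain ⟨N, hN, -, -, hl⟩ := exists_isLead_of_expansion hσ (t := t) (fun k _ => hg k)
    (fun k hk => le_v_sum _ (fun k _ => hg k) t k hk) (by rw [sub_self, map_zero]; exact v_pos hz)
  rw [hl.idx_eq hσ hz]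
  exact Finset.mem_Ico.mp hN

end PrincipalPart

theorem tendsto_rpow_pow {ρ : ℝ≥0} (hρ : ρ < 1) (c d : ℝ≥0) {t : ℝ} (ht : 0 < t) :
    Tendsto (fun n : ℕ => (ρ ^ n * c) ^ t * d) atTop (𝓝 0) := by
  have h1 := (NNReal.tendsto_pow_atTop_nhds_zero_of_lt_one hρ).mul_const c
  rw [zero_mul] at h1
  have h2 := ((NNReal.continuous_rpow_const ht.le).tendsto 0).comp h1
  rw [NNReal.zero_rpow ht.ne'] at h2
  simpa using h2.mul_const d

/-- Euclidean division on `[s, r]`: if the remainders in successively better divisions do not tend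
to zero, one of them dominates the error and has the degree of a remainder. -/
theorem closureDvd_or_exists_deg_lt {a : R} (ha : a ≠ 0) (b : R) (s : S.Radius) :
    S.ClosureDvd s a b ∨ ∃ q, b - q * a ≠ 0 ∧ S.deg s (b - q * a) < S.deg s a := by
  obtain ⟨p⟩ := exists_principalPart ha s
  obtain ⟨γ, hγ, hb⟩ := exists_bdd ha s b
  refine or_iff_not_imp_right.mpr fun hdeg ε hε => ?_
  obtain ⟨η, hη0, hη⟩ := p.exists_isRem_small s hε
  obtain ⟨η', hη0', hη'⟩ := p.exists_isRem_small S.top hε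
  have lim : ∀ t : S.Radius, ∀ᶠ n : ℕ in atTop,
      (p.ρ ^ n * γ) ^ (t : ℝ) * S.v t a < min ε (min η η') := fun t =>
    (tendsto_order.mp (tendsto_rpow_pow p.ρ_lt_one γ (S.v t a) (radius_pos t))).2 _
      (lt_min hε (lt_min hη0 hη0'))
  obtain ⟨n, hn, hn'⟩ := ((lim s).and (lim S.top)).exists
  obtain ⟨q, z, -, hz, hw⟩ := p.exists_division hγ hb n
  have hws := (hw s le_rfl).trans_lt hn
  have hwt := (hw S.top (le_top s)).trans_lt hn'
  set w := b - (q * a + z) with hwdef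
  have e : b - q * a = z + w := by rw [hwdef]; ring
  have small : (∀ t, s ≤ t → S.v t z ≤ ε) → ∀ t, s ≤ t → S.v t (b - q * a) ≤ ε := by
    intro h t ht
    rw [e]
    exact Valuation.map_add_le _ (h t ht) (v_le_of_endpoints ht
      (hws.le.trans (min_le_left _ _)) (hwt.le.trans (min_le_left _ _)))
  refine ⟨q, ?_⟩
  rcases le_or_gt (S.v s z) (S.v s w) with h1 | h1
  · exact small (hη γ z hz (h1.trans (hws.le.trans ((min_le_right _ _).trans (min_le_left _ _)))))
  rcases le_or_gt (S.v S.top z) (S.v S.top w) with h2 | h2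
  · exact small (hη' γ z hz
      (h2.trans (hwt.le.trans ((min_le_right _ _).trans (min_le_right _ _)))))
  have hz0 : z ≠ 0 := fun h => by simp [h] at h1
  have h1' : S.v s (z - (b - q * a)) < S.v s z := by
    rwa [e, sub_add_cancel_left, Valuation.map_neg]
  have h2' : S.v S.top (z - (b - q * a)) < S.v S.top z := by
    rwa [e, sub_add_cancel_left, Valuation.map_neg]
  refine absurd ⟨q, ne_zero_of_v_sub_lt h1', ?_⟩ hdeg
  rw [deg_congr h1' h2', deg, deg]
  have h3 := hz.exists_isLead hz0 (σ := 1) (by norm_num) S.top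
  have h4 := hz.exists_isLead hz0 (σ := -1) (by norm_num) s
  omega

theorem ClosureDvd.of_le {s t : S.Radius} {a b : R} (h : S.ClosureDvd s a b) (hst : s ≤ t) :
    S.ClosureDvd t a b := fun ε hε =>
  let ⟨q, hq⟩ := h ε hε
  ⟨q, fun u hu => hq u (hst.trans hu)⟩

/-- If all zeros of `a` lie in `[s, r]`, divisibility by `a` can be tested on `[s, r]`. -/
theorem ClosureDvd.dvd {s : S.Radius} {a b : R} (ha : a ≠ 0)
    (hdeg : ∀ t, t ≤ s → S.deg t a = S.deg s a) (h : S.ClosureDvd s a b) : a ∣ b := by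
  refine dvd_of_closureDvd (S := S) fun n => ?_
  rcases le_total s (S.rad n) with hn | hn
  · exact h.of_le hn
  refine (closureDvd_or_exists_deg_lt ha b (S.rad n)).resolve_right ?_
  rintro ⟨q, hq0, hq⟩
  obtain ⟨m, hm0, hm⟩ := exists_le_v hq0 s
  obtain ⟨ε, hε0, hε⟩ := exists_between hm0
  obtain ⟨q', hq'⟩ := h ε hε0
  have hlt : ∀ t, s ≤ t → S.v t (b - q * a - (q' - q) * a) < S.v t (b - q * a) := fun t ht => by
    have e : b - q * a - (q' - q) * a = b - q' * a := by ring
    rw [e]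
    exact ((hq' t ht).trans_lt hε).trans_le (hm t ht)
  have h0 := ne_zero_of_v_sub_lt (hlt s le_rfl)
  have h1 := deg_congr (hlt s le_rfl) (hlt S.top (le_top s))
  rw [deg_mul s (left_ne_zero_of_mul h0) ha] at h1
  have h2 := deg_nonneg s (left_ne_zero_of_mul h0)
  have h3 := deg_anti hn hq0
  rw [hdeg _ hn] at hq
  omega

/-- Elements of `S.O` have no leading terms with negative index. -/
theorem idx_nonneg_of_mem_O {x : R} (hx : x ≠ 0) (hO : x ∈ S.O) (t : S.Radius) :
    0 ≤ S.idx (-1) t x := by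
  let t' : S.Radius := ⟨t / 2, half_pos (radius_pos t), (half_le_self (radius_pos t).le).trans t.2.2⟩
  have htt : t' ≤ t := half_le_self (radius_pos t).le
  obtain ⟨F, f, h1, h2, h3, h4, h5⟩ := exists_expansion_of_ne_zero hx t t'
  obtain ⟨m, -, hmv, -, h⟩ := exists_isLead_of_expansion (σ := -1) (by norm_num) (fun k _ => h1 k)
    (fun k _ => h2 k) h3
  rw [h.idx_eq (by norm_num) hx]
  by_contra hm
  obtain ⟨c, hc⟩ := mono_abs (h1 m)
  have h6 := (h4 m).trans (S.v_le_rpow x hO htt)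
  have hP : 1 < S.P ^ (-m) := one_lt_zpow₀ S.one_lt_P (by omega)
  have hc0 : 0 < c := by
    have := v_pos (t := t) hx
    rw [← hmv, hc] at this
    refine pos_iff_ne_zero.mpr fun h0 => ?_
    rw [h0, NNReal.zero_rpow (radius_pos t).ne', mul_zero] at this
    exact lt_irrefl _ this
  rw [← hmv, hc, hc, NNReal.mul_rpow, ← NNReal.rpow_mul, mul_div_cancel₀ _ (radius_pos t).ne'] at h6
  have h7 := le_of_mul_le_mul_right h6 (NNReal.rpow_pos hc0)
  have h8 : (S.P ^ (-m)) ^ ((t' : ℝ) / t) < (S.P ^ (-m)) ^ (1 : ℝ) := by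
    refine NNReal.rpow_lt_rpow_of_exponent_lt hP ?_
    rw [div_lt_one (radius_pos t)]
    exact half_lt_self (radius_pos t)
  rw [NNReal.rpow_one] at h8
  exact absurd h7 (not_le.mpr h8)

/-- Dependent choice, with a property of the terms and a relation between successive ones. -/
theorem exists_seq_of_step {α : Type*} (P : ℕ → α → Prop) (Q : ℕ → α → α → Prop) {x₀ : α}
    (h0 : P 0 x₀) (step : ∀ n x, P n x → ∃ y, P (n + 1) y ∧ Q n x y) :
    ∃ u : ℕ → α, u 0 = x₀ ∧ (∀ n, P n (u n)) ∧ ∀ n, Q n (u n) (u (n + 1)) := by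
  have step' : ∀ n x, ∃ y, P n x → P (n + 1) y ∧ Q n x y := fun n x => by
    by_cases h : P n x
    · obtain ⟨y, hy⟩ := step n x h
      exact ⟨y, fun _ => hy⟩
    · exact ⟨x, fun h' => absurd h' h⟩
  choose g hg using step'
  let u : ℕ → α := fun n => Nat.rec x₀ (fun n x => g n x) n
  have hu : ∀ n, P n (u n) := fun n => by
    induction n with
    | zero => exact h0
    | succ n ih => exact (hg n (u n) ih).1
  exact ⟨u, rfl, hu, fun n => (hg n (u n) (hu n)).2⟩

/-- Weierstrass preparation, up to normalization: an approximate divisor `A` on `[s, r]`, all of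
whose zeros lie in `[s, r]`. It is the limit of a Newton iteration for a factorization `a = q * A`
that starts with the principal part of `a` and corrects `A` by remainders. As these have nonnegative
index, the limit exists in the whole ring and not only on `[s, r]`, and its leading indices are
nonnegative at all radii, so that it has no zeros outside of `[s, r]`. -/
theorem exists_closureDvd_of_idx_eq_zero {a : R} (ha : a ≠ 0) {s : S.Radius}
    (hlo : S.idx (-1) s a = 0) :
    ∃ A, A ≠ 0 ∧ S.ClosureDvd s A a ∧ ∀ t, t ≤ s → S.deg t A = S.deg s a := by
  obtain ⟨p⟩ := exists_principalPart ha s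
  set A₀ := ∑ k ∈ Finset.Icc (S.idx (-1) s a) (S.idx 1 S.top a), p.f k with hA₀
  have hA₀O : A₀ ∈ S.O := sum_mem fun k hk => mono_mem_O (p.f_mem k) (by
    have := (Finset.mem_Icc.mp hk).1
    omega)
  have hρ1 : ∀ n : ℕ, p.ρ ^ (n + 1) ≤ p.ρ := fun n => by
    rw [pow_succ]; exact mul_le_of_le_one_left zero_le (pow_le_one₀ zero_le p.ρ_lt_one.le)
  obtain ⟨u, hu0, hu, hstep⟩ := exists_seq_of_step (α := R × R)
    (fun n x => x.1 ∈ S.O ∧ S.Bdd s a p.ρ (x.1 - A₀) ∧ S.Bdd s 1 p.ρ (x.2 - 1) ∧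
      S.Bdd s a (p.ρ ^ (n + 1)) (a - x.2 * x.1))
    (fun n x y => y.1 - x.1 ∈ S.O ∧ S.Bdd s a (p.ρ ^ (n + 1)) (y.1 - x.1))
    (x₀ := (A₀, 1)) ⟨hA₀O, by simpa using bdd_zero, by simpa using bdd_zero, by
      simpa using p.tail⟩ (by
    rintro n ⟨A, q⟩ ⟨hA, hA', hq, hE⟩
    dsimp only at hA hA' hq hE ⊢
    have hγ0 : 0 < p.ρ ^ (n + 1) := pow_pos p.ρ_pos _
    obtain ⟨q', z, hq', hz, hw⟩ := PrincipalPart.mem_divisible (p := p) hγ0 hE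
    have hzO : z ∈ S.O := by
      obtain ⟨g, hg, -, rfl⟩ := hz
      exact sum_mem fun k hk => mono_mem_O (hg k) (by
        have := (Finset.mem_Ico.mp hk).1
        omega)
    refine ⟨(A + z, q + q'), ⟨add_mem hA hzO, ?_, ?_, ?_⟩, by simpa using hzO, by
      simpa using hz.bdd⟩
    · convert hA'.add (hz.bdd.le (hρ1 n)) using 1
      ring
    · convert hq.add (hq'.le (hρ1 n)) using 1
      ring
    · have e : a - (q + q') * (A + z) = (a - q * A - (q' * a + z)) + q' * (a - A₀)
          - q' * (A - A₀) - (q - 1) * z - q' * z := by ring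
      dsimp only
      have small : ∀ {y}, S.Bdd s a p.ρ y → S.Bdd s a (p.ρ * p.ρ ^ (n + 1)) (q' * y) :=
        fun hy => by rw [mul_comm p.ρ]; exact hq'.mul hy
      rw [e, pow_succ' _ (n + 1)]
      exact (((hw.add (small p.tail)).sub (small hA')).sub (hq.mul hz.bdd)).sub
        (small (hz.bdd.le (hρ1 n))))
  have hlim0 : ∀ t : S.Radius, Tendsto (fun n => (p.ρ ^ (n + 1)) ^ (t : ℝ) * S.v t a) atTop
      (𝓝 0) := fun t => by
    have := tendsto_rpow_pow p.ρ_lt_one p.ρ (S.v t a) (radius_pos t)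
    simpa only [← pow_succ] using this
  obtain ⟨A, hA⟩ := S.exists_limit (fun n => (u n).1) fun t => by
    have h1 : Tendsto (fun n => S.v S.top ((u (n + 1)).1 - (u n).1)) atTop (𝓝 0) :=
      tendsto_zero_of_eventually_le (hlim0 S.top)
        (Eventually.of_forall fun n => (hstep n).2 S.top (le_top s))
    have hq : 0 < (t : ℝ) / S.top := div_pos (radius_pos t) (radius_pos S.top)
    have h2 := ((NNReal.continuous_rpow_const hq.le).tendsto 0).comp h1
    rw [NNReal.zero_rpow hq.ne'] at h2
    exact tendsto_zero_of_eventually_le h2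
      (Eventually.of_forall fun n => S.v_le_rpow _ (hstep n).1 (le_top t))
  have hAA₀ : S.Bdd s a p.ρ (A - A₀) := fun t ht => by
    have hpos : 0 < p.ρ ^ (t : ℝ) * S.v t a := mul_pos (NNReal.rpow_pos p.ρ_pos) (v_pos ha)
    obtain ⟨n, hn⟩ := ((tendsto_order.mp (hA t)).2 _ hpos).exists
    have e : A - A₀ = ((u n).1 - A₀) - ((u n).1 - A) := by ring
    rw [e]
    exact Valuation.map_sub_le _ ((hu n).2.1 t ht) hn.le
  have hlt : ∀ t, s ≤ t → S.v t (a - A) < S.v t a := fun t ht => by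
    have e : a - A = (a - A₀) - (A - A₀) := by ring
    rw [e]
    refine ((p.tail.sub hAA₀) t ht).trans_lt ?_
    exact mul_lt_of_lt_one_left (v_pos ha) (NNReal.rpow_lt_one p.ρ_lt_one (radius_pos t))
  have hA0 := ne_zero_of_v_sub_lt (hlt s le_rfl)
  refine ⟨A, hA0, ?_, ?_⟩
  · intro ε hε
    have hq1 : ∀ n t, s ≤ t → S.v t (u n).2 ≤ 1 := fun n t ht => by
      have h1 := (hu n).2.2.1 t ht
      rw [map_one, mul_one] at h1
      have h2 := h1.trans (NNReal.rpow_le_one p.ρ_lt_one.le (radius_pos t).le)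
      have h3 := Valuation.map_add_le (S.v t) h2 (S.v t).map_one.le
      rwa [sub_add_cancel] at h3
    have key : ∀ t, s ≤ t → ∀ᶠ n in atTop, S.v t (a - (u n).2 * A) ≤ ε := fun t ht => by
      filter_upwards [(tendsto_order.mp (hlim0 t)).2 ε hε, (tendsto_order.mp (hA t)).2 ε hε]
        with n hn hn'
      have e : a - (u n).2 * A = (a - (u n).2 * (u n).1) + (u n).2 * ((u n).1 - A) := by ring
      rw [e]
      refine Valuation.map_add_le _ (((hu n).2.2.2 t ht).trans hn.le) ?_
      rw [map_mul]
      exact (mul_le_of_le_one_left zero_le (hq1 n t ht)).trans hn'.le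
    obtain ⟨n, hn, hn'⟩ := ((key s le_rfl).and (key S.top (le_top s))).exists
    exact ⟨(u n).2, fun t ht => v_le_of_endpoints ht hn hn'⟩
  · intro t ht
    have h1 := idx_congr (σ := 1) (by norm_num) (hlt S.top (le_top s))
    have h2 := idx_congr (σ := -1) (by norm_num) (hlt s le_rfl)
    have h3 := idx_neg_le_idx_neg ht hA0
    have h4 : 0 ≤ S.idx (-1) t A := by
      obtain ⟨n, hn⟩ := ((tendsto_order.mp (hA t)).2 _ (v_pos hA0)).exists
      rw [Valuation.map_sub_swap] at hn
      have := idx_congr (σ := -1) (by norm_num) hn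
      rw [← this]
      exact idx_nonneg_of_mem_O (ne_zero_of_v_sub_lt hn) (hu n).1 t
    rw [deg, deg, h1]
    omega

/-- Weierstrass preparation: `a = A * C` where all zeros of `A` lie in `[s, r]` and `C` has no
zeros there. -/
theorem exists_weierstrass {a : R} (ha : a ≠ 0) (s : S.Radius) :
    ∃ A C, a = A * C ∧ S.deg s C = 0 ∧ ∀ t, t ≤ s → S.deg t A = S.deg s a := by
  have := S.isDomain
  set k := S.idx (-1) s a with hk
  have hm := pi_zpow_mem_mono (S := S) (-k)
  have hu : IsUnit ((S.π ^ (-k) : Rˣ) : R) := Units.isUnit _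
  have ha' : ((S.π ^ (-k) : Rˣ) : R) * a ≠ 0 := mul_ne_zero hu.ne_zero ha
  obtain ⟨A, hA0, hA, hdeg⟩ := exists_closureDvd_of_idx_eq_zero ha' (s := s) (by
    rw [idx_mul (by norm_num) _ hu.ne_zero ha, idx_mono_eq (by norm_num) _ hu.ne_zero hm]
    omega)
  have hd : S.deg s (((S.π ^ (-k) : Rˣ) : R) * a) = S.deg s a := by
    rw [deg_mul s hu.ne_zero ha, deg_mono s hu.ne_zero hm, zero_add]
  rw [hd] at hdeg
  have hA' := hA.dvd hA0 fun t ht => (hdeg t ht).trans (hdeg s le_rfl).symm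
  rw [hu.dvd_mul_left] at hA'
  obtain ⟨C, rfl⟩ := hA'
  refine ⟨A, C, rfl, ?_, hdeg⟩
  have h1 := hdeg s le_rfl
  rw [deg_mul s hA0 (right_ne_zero_of_mul ha)] at h1
  omega

/-! ### Coprimality -/

variable (S) in
/-- `a` and `b` generate the unit ideal on `[s, r]`. The condition that a linear combination be
close to `1` suffices for this. -/
def Cop (s : S.Radius) (a b : R) : Prop :=
  ∃ f g, ∀ t, s ≤ t → S.v t (1 - (f * a + g * b)) < 1

theorem Cop.symm {s : S.Radius} {a b : R} (h : S.Cop s a b) : S.Cop s b a := by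
  obtain ⟨f, g, h⟩ := h
  exact ⟨g, f, fun t ht => by rw [add_comm]; exact h t ht⟩

theorem Cop.of_mul_left {s : S.Radius} {a b c : R} (h : S.Cop s (c * a) b) : S.Cop s a b := by
  obtain ⟨f, g, h⟩ := h
  exact ⟨f * c, g, fun t ht => by rw [mul_assoc]; exact h t ht⟩

theorem cop_of_deg {s : S.Radius} {a b : R} (hb : b ≠ 0) (h : S.deg s b = 0) : S.Cop s a b := by
  obtain ⟨k, u, -, c, -, -, hc⟩ := exists_mono_near_of_deg_eq_zero hb h
  exact ⟨0, c, fun t ht => by rw [zero_mul, zero_add]; exact hc t ht⟩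

theorem Cop.mul_right {s : S.Radius} {a b c : R} (h : S.Cop s a b) (h' : S.Cop s a c) :
    S.Cop s a (b * c) := by
  obtain ⟨f, g, h⟩ := h
  obtain ⟨f', g', h'⟩ := h'
  refine ⟨f * f' * a + f * (g' * c) + g * b * f', g * g', fun t ht => ?_⟩
  set x := f * a + g * b with hx
  set y := f' * a + g' * c with hy
  have e : 1 - ((f * f' * a + f * (g' * c) + g * b * f') * a + g * g' * (b * c)) =
      (1 - x) + x * (1 - y) := by rw [hx, hy]; ring
  have hx1 : S.v t x ≤ 1 := by
    have := Valuation.map_sub_le (S.v t) (S.v t).map_one.le (h t ht).le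
    rwa [sub_sub_cancel] at this
  rw [e]
  refine Valuation.map_add_lt _ (h t ht) ?_
  rw [map_mul]
  exact (mul_le_of_le_one_left zero_le hx1).trans_lt (h' t ht)

theorem Cop.deg_eq_zero {s : S.Radius} {a b c : R} (h : S.Cop s a b) (ha : c ∣ a) (hb : c ∣ b) :
    S.deg s c = 0 := by
  obtain ⟨f, g, h⟩ := h
  obtain ⟨a, rfl⟩ := ha
  obtain ⟨b, rfl⟩ := hb
  refine deg_eq_zero_of_lt (c := f * a + g * b) fun t ht => ?_
  convert h t ht using 2
  ring

/-- Greatest common divisors up to zeros outside of `[s, r]`, by the Euclidean algorithm. Weierstrass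
preparation makes all factors elements of the whole ring. -/
theorem exists_gcd_on (s : S.Radius) (n : ℕ) : ∀ a b : R, a ≠ 0 → S.deg s a < n →
    ∃ d a' b', a = d * a' ∧ b = d * b' ∧ S.Cop s a' b' := by
  induction n with
  | zero =>
    intro a b ha h
    have := deg_nonneg s ha
    simp only [Nat.cast_zero] at h
    omega
  | succ n ih =>
    intro a b ha h
    obtain ⟨A, C, rfl, hC, hA⟩ := exists_weierstrass ha s
    have hA0 := left_ne_zero_of_mul ha
    have hC0 := right_ne_zero_of_mul ha
    rcases closureDvd_or_exists_deg_lt hA0 b s with hb | ⟨q, hq0, hq⟩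
    · obtain ⟨b', rfl⟩ := hb.dvd hA0 fun t ht => (hA t ht).trans (hA s le_rfl).symm
      exact ⟨A, C, b', rfl, rfl, (cop_of_deg hC0 hC).symm⟩
    · obtain ⟨d, z, A', hz, hA', f, g, hfg⟩ := ih (b - q * A) A hq0 (by
        rw [hA s le_rfl] at hq
        push_cast at h
        omega)
      refine ⟨d, A' * C, z + q * A', by rw [hA']; ring, ?_, ?_⟩
      · linear_combination hz + q * hA'
      · refine (Cop.mul_right ⟨f, g - f * q, fun t ht => ?_⟩ (cop_of_deg hC0 hC)).symm
        convert hfg t ht using 2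
        ring

/-- Coefficients in linear combinations arbitrarily close to `1` can be chosen with a common bound,
by the geometric series. -/
theorem Cop.exists_approx {s : S.Radius} {a b : R} (h : S.Cop s a b) :
    ∃ C : ℝ≥0, ∀ ε : ℝ≥0, 0 < ε → ∃ f g, ∀ t, s ≤ t → S.v t f ≤ C ∧ S.v t g ≤ C ∧
      S.v t (1 - (f * a + g * b)) ≤ ε := by
  obtain ⟨f, g, h⟩ := h
  obtain ⟨C, -, hC⟩ := exists_v_bound f s
  obtain ⟨C', -, hC'⟩ := exists_v_bound g s
  set y := 1 - (f * a + g * b) with hy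
  refine ⟨max C C', fun ε hε => ?_⟩
  obtain ⟨m, hm⟩ := exists_pow_le h hε
  have hgeom : ∀ t, s ≤ t → S.v t (∑ i ∈ Finset.range m, y ^ i) ≤ 1 := fun t ht =>
    Valuation.map_sum_le _ fun i _ => by rw [map_pow]; exact pow_le_one₀ zero_le (h t ht).le
  refine ⟨f * ∑ i ∈ Finset.range m, y ^ i, g * ∑ i ∈ Finset.range m, y ^ i,
    fun t ht => ⟨?_, ?_, ?_⟩⟩
  · rw [map_mul]
    exact (mul_le_of_le_one_right zero_le (hgeom t ht)).trans ((hC t ht).trans (le_max_left _ _))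
  · rw [map_mul]
    exact (mul_le_of_le_one_right zero_le (hgeom t ht)).trans ((hC' t ht).trans (le_max_right _ _))
  · have e : 1 - (f * (∑ i ∈ Finset.range m, y ^ i) * a + g * (∑ i ∈ Finset.range m, y ^ i) * b) =
        y ^ m := by
      have h1 := mul_neg_geom_sum y m
      have h2 : 1 - y = f * a + g * b := by rw [hy]; ring
      rw [h2] at h1
      linear_combination -h1
    rw [e]
    exact hm m le_rfl t ht

/-- Two elements that are coprime on all `[s, r]` are coprime. Approximate solutions `(f n, g n)` of
`f * a + g * b = 1` on growing annuli are corrected by multiples of `(-b, a)`, which do not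
affect the equation, so as to form Cauchy sequences. -/
theorem isCoprime_of_cop {a b : R} (h : ∀ n, S.Cop (S.rad n) a b) : IsCoprime a b := by
  choose C hC using fun n => (h n).exists_approx
  let K : ℕ → ℝ≥0 := fun n => 1 + ∑ i ∈ Finset.range (n + 2), C i
  have hK0 : ∀ n, 0 < K n := fun n => by positivity
  have hCK : ∀ {i n}, i ≤ n + 1 → C i ≤ K n := fun {i n} hi =>
    (Finset.single_le_sum (f := C) (fun _ _ => zero_le) (Finset.mem_range.mpr (by omega))).trans
      le_add_self
  have hKK : ∀ n, K n ≤ K (n + 1) := fun n => by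
    simp only [K, Finset.sum_range_succ _ (n + 2), ← add_assoc]
    exact le_self_add
  choose f g hfg using fun n => hC n (((n : ℝ≥0) + 1) * K n)⁻¹
    (inv_pos.mpr (mul_pos (by positivity) (hK0 n)))
  set η : ℕ → R := fun n => 1 - (f n * a + g n * b) with hη
  -- if both pairs were exact solutions, their difference would be `h' n` times `(b, -a)`
  let h' : ℕ → R := fun n => (f (n + 1) - f n) * g n - (g (n + 1) - g n) * f n
  have small : ∀ {n t x y}, S.rad n ≤ t → S.v t x ≤ K n →
      S.v t y ≤ (((n : ℝ≥0) + 1) * K n)⁻¹ → S.v t (x * y) ≤ ((n : ℝ≥0) + 1)⁻¹ := by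
    intro n t x y _ hx hy
    rw [map_mul]
    refine (mul_le_mul' hx hy).trans_eq ?_
    have := (hK0 n).ne'
    field_simp
  have hfv : ∀ {n t}, S.rad n ≤ t → S.v t (f n) ≤ K n ∧ S.v t (g n) ≤ K n ∧
      S.v t (f (n + 1)) ≤ K n ∧ S.v t (g (n + 1)) ≤ K n := fun {n t} ht => by
    have h1 := hfg n t ht
    have h2 := hfg (n + 1) t ((rad_anti (Nat.le_succ n)).trans ht)
    exact ⟨h1.1.trans (hCK (by omega)), h1.2.1.trans (hCK (by omega)),
      h2.1.trans (hCK le_rfl), h2.2.1.trans (hCK le_rfl)⟩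
  have hηv : ∀ {n t}, S.rad n ≤ t → S.v t (η n) ≤ (((n : ℝ≥0) + 1) * K n)⁻¹ ∧
      S.v t (η (n + 1)) ≤ (((n : ℝ≥0) + 1) * K n)⁻¹ := fun {n t} ht => by
    refine ⟨(hfg n t ht).2.2, (hfg (n + 1) t ((rad_anti (Nat.le_succ n)).trans ht)).2.2.trans ?_⟩
    have h1 : (n : ℝ≥0) + 1 ≤ ((n + 1 : ℕ) : ℝ≥0) + 1 := by push_cast; exact le_self_add
    exact (inv_le_inv₀ (mul_pos (by positivity) (hK0 _)) (mul_pos (by positivity) (hK0 _))).mpr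
      (mul_le_mul' h1 (hKK n))
  have lim : ∀ F : ℕ → R, (∀ n t, S.rad n ≤ t → S.v t (F (n + 1) - F n) ≤ ((n : ℝ≥0) + 1)⁻¹) →
      ∃ y, ∀ t, Tendsto (fun n => S.v t (F n - y)) atTop (𝓝 0) := fun F hF =>
    S.exists_limit F fun t => tendsto_zero_of_eventually_le tendsto_inv_succ (by
      filter_upwards [eventually_rad_le t] with n hn using hF n t hn)
  obtain ⟨F, hF⟩ := lim (fun n => f n - (∑ i ∈ Finset.range n, h' i) * b) (by
    intro n t ht
    obtain ⟨f1, -, f2, -⟩ := hfv ht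
    obtain ⟨η1, η2⟩ := hηv ht
    have e : f (n + 1) - (∑ i ∈ Finset.range (n + 1), h' i) * b -
        (f n - (∑ i ∈ Finset.range n, h' i) * b) =
        (f (n + 1) - f n) * η n + f n * (η n - η (n + 1)) := by
      rw [Finset.sum_range_succ]
      simp only [h', hη]
      ring
    rw [e]
    exact Valuation.map_add_le _ (small ht (Valuation.map_sub_le _ f2 f1) η1)
      (small ht f1 (Valuation.map_sub_le _ η1 η2)))
  obtain ⟨G, hG⟩ := lim (fun n => g n + (∑ i ∈ Finset.range n, h' i) * a) (by
    intro n t ht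
    obtain ⟨-, g1, -, g2⟩ := hfv ht
    obtain ⟨η1, η2⟩ := hηv ht
    have e : g (n + 1) + (∑ i ∈ Finset.range (n + 1), h' i) * a -
        (g n + (∑ i ∈ Finset.range n, h' i) * a) =
        (g (n + 1) - g n) * η n + g n * (η n - η (n + 1)) := by
      rw [Finset.sum_range_succ]
      simp only [h', hη]
      ring
    rw [e]
    exact Valuation.map_add_le _ (small ht (Valuation.map_sub_le _ g2 g1) η1)
      (small ht g1 (Valuation.map_sub_le _ η1 η2)))
  refine ⟨F, G, (sub_eq_zero.mp (S.eq_zero_of_v (t := S.top) ?_)).symm⟩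
  have hηlim : Tendsto (fun n => S.v S.top (η n)) atTop (𝓝 0) :=
    tendsto_zero_of_eventually_le tendsto_inv_succ (Eventually.of_forall fun n => by
      have h1 := small (le_top (S.rad n)) (x := 1) (y := η n)
        (by rw [map_one]; exact le_self_add) (hηv (le_top (S.rad n))).1
      rwa [one_mul] at h1)
  have h1 := hηlim.max (((hF S.top).mul_const (S.v S.top a)).max
    ((hG S.top).mul_const (S.v S.top b)))
  rw [zero_mul, zero_mul, max_self, max_self] at h1
  refine le_antisymm (ge_of_tendsto h1 (Eventually.of_forall fun n => ?_)) zero_le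
  set H := ∑ i ∈ Finset.range n, h' i with hH
  have e : 1 - (F * a + G * b) = η n + ((f n - H * b - F) * a + (g n + H * a - G) * b) := by
    simp only [hη]
    ring
  rw [e, ← map_mul, ← map_mul]
  exact (Valuation.map_add _ _ _).trans (max_le_max le_rfl (Valuation.map_add _ _ _))

/-! ### Infinite products -/

/-- A monomial of negative index that is bounded by `1` at radius `s` decays exponentially at larger
radii, at a rate that grows as `s` tends to zero. -/
theorem mono_le_of_neg {k : ℤ} {x : R} (hx : x ∈ S.mono k) (hk : k < 0) {s t : S.Radius}
    (hst : s ≤ t) (hv : S.v s x ≤ 1) : S.v t x ≤ S.P ^ (1 - (t : ℝ) / s) := by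
  have hP := (P_pos (S := S)).ne'
  have h1 : S.v s ((S.π ^ (1 : ℤ) : Rˣ) * x) ≤ (S.P ^ (-(s : ℝ)⁻¹)) ^ (s : ℝ) := by
    rw [map_mul, v_zpow, zpow_neg_one, ← NNReal.rpow_mul, neg_mul,
      inv_mul_cancel₀ (radius_pos s).ne', NNReal.rpow_neg_one]
    exact mul_le_of_le_one_right zero_le hv
  have h2 := mono_le_of_nonpos (mono_mul (pi_zpow_mem_mono 1) hx) (by omega) hst h1
  rw [map_mul, v_zpow, zpow_neg_one, ← NNReal.rpow_mul, inv_mul_le_iff₀ P_pos] at h2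
  refine h2.trans_eq ?_
  rw [sub_eq_add_neg, NNReal.rpow_add hP, NNReal.rpow_one]
  congr 2
  field_simp

/-- An element without zeros in `[s, r]` can be brought close to `1` by a global unit. On `[s, r]` it
is a monomial times `1 + y`. The part of `y` of nonnegative index is small at all radii, so that
adding it to `1` gives a unit; the part of negative index decays away from the radius `s`. -/
theorem exists_normalization {s : S.Radius} {x : R} (hx : x ≠ 0) (h : S.deg s x = 0) {ε : ℝ≥0}
    (hε : 0 < ε) :
    ∃ c, IsUnit c ∧ ∀ t, s ≤ t → S.v t (c * x - 1) ≤ max ε (S.P ^ (1 - (t : ℝ) / s)) := by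
  classical
  have := S.isDomain
  obtain ⟨k, u, -, c, -, huc, hcx⟩ := exists_mono_near_of_deg_eq_zero hx h
  set y := c * x - 1 with hy
  have hyv : ∀ t, s ≤ t → S.v t y < 1 := fun t ht => by
    rw [hy, Valuation.map_sub_swap]; exact hcx t ht
  have hε' : 0 < min ε 2⁻¹ := lt_min hε (by positivity)
  have hε1 : min ε 2⁻¹ < 1 := (min_le_right _ _).trans_lt (by
    rw [← NNReal.coe_lt_coe]; push_cast; norm_num)
  obtain ⟨F, f, f1, -, f2⟩ := exists_mono_expansion y s hε'
  have f3 : ∀ k t, s ≤ t → S.v t (f k) < 1 := fun k t ht =>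
    ((f2 t ht).1 k).trans_lt (max_lt (hyv t ht) hε1)
  set yp := ∑ k ∈ F.filter (fun k => 0 ≤ k), f k with hyp
  set yn := ∑ k ∈ F.filter (fun k => ¬ 0 ≤ k), f k with hyn
  have hypO : yp ∈ S.O := sum_mem fun k hk => mono_mem_O (f1 k) (Finset.mem_filter.mp hk).2
  have hypv : ∀ t, S.v t yp < 1 := fun t => by
    rcases le_total s t with ht | ht
    · exact Valuation.map_sum_lt' _ zero_lt_one fun k _ => f3 k t ht
    · exact (S.v_le_rpow yp hypO ht).trans_lt (NNReal.rpow_lt_one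
        (Valuation.map_sum_lt' _ zero_lt_one fun k _ => f3 k s le_rfl)
        (div_pos (radius_pos t) (radius_pos s)))
  have hlt : ∀ t, S.v t (1 - 1 * (1 + yp)) < 1 := fun t => by
    rw [one_mul, sub_add_cancel_left, Valuation.map_neg]; exact hypv t
  have hunit : IsUnit (1 + yp) := by
    refine isUnit_of_deg (S := S) (ne_zero_of_v_sub_lt (x := 1) (t := s) ?_)
      fun n => deg_eq_zero_of_lt fun t _ => hlt t
    rw [map_one]; simpa using hlt s
  obtain ⟨w, hw⟩ := hunit.exists_right_inv
  have hwv : ∀ t, S.v t w = 1 := fun t => by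
    rw [v_of_mul_eq_one hw, Valuation.map_one_add_of_lt _ (hypv t), inv_one]
  refine ⟨c * w, (IsUnit.of_mul_eq_one u (by rw [mul_comm]; exact huc)).mul
    (IsUnit.of_mul_eq_one (1 + yp) (by rw [mul_comm]; exact hw)), fun t ht => ?_⟩
  have hsum : yp + yn = ∑ k ∈ F, f k := Finset.sum_filter_add_sum_filter_not F _ f
  have e : c * w * x - 1 = w * (yn + (y - ∑ k ∈ F, f k)) := by
    have h1 : c * x = 1 + y := by rw [hy]; ring
    rw [← hsum]
    linear_combination w * h1 + hw
  rw [e, map_mul, hwv, one_mul]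
  refine Valuation.map_add_le _ ?_ (((f2 t ht).2.trans (min_le_left _ _)).trans (le_max_left _ _))
  refine (Valuation.map_sum_le _ fun k hk => ?_).trans (le_max_right _ _)
  exact mono_le_of_neg (f1 k) (not_le.mp (Finset.mem_filter.mp hk).2) ht (f3 k s le_rfl).le

theorem tendsto_rpow_rad (t : S.Radius) :
    Tendsto (fun n => S.P ^ (1 - (t : ℝ) / S.rad n)) atTop (𝓝 0) := by
  have h1 : ∀ n : ℕ, S.P ^ (1 - (t : ℝ) / S.rad n) =
      S.P ^ (1 - (t : ℝ) / S.r) * (S.P ^ (-((t : ℝ) / S.r))) ^ n := fun n => by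
    rw [← NNReal.rpow_natCast, ← NNReal.rpow_mul, ← NNReal.rpow_add P_pos.ne']
    congr 1
    have : ((S.rad n : S.Radius) : ℝ) = S.r / (n + 1) := rfl
    rw [this]
    have := S.r_pos.ne'
    field_simp
    ring
  have h2 : S.P ^ (-((t : ℝ) / S.r)) < 1 :=
    NNReal.rpow_lt_one_of_one_lt_of_neg S.one_lt_P (by
      have := div_pos (radius_pos t) S.r_pos
      linarith)
  simpa only [h1, mul_zero] using
    (NNReal.tendsto_pow_atTop_nhds_zero_of_lt_one h2).const_mul (S.P ^ (1 - (t : ℝ) / S.r))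

theorem deg_prod {s : S.Radius} {e : ℕ → R} (he : ∀ n, e n ≠ 0) {F : Finset ℕ} :
    S.deg s (∏ i ∈ F, e i) = ∑ i ∈ F, S.deg s (e i) := by
  classical
  have := S.isDomain
  induction F using Finset.induction_on with
  | empty => rw [Finset.prod_empty, Finset.sum_empty, deg_one]
  | insert i F hi ih =>
    rw [Finset.prod_insert hi, Finset.sum_insert hi,
      deg_mul s (he i) (Finset.prod_ne_zero_iff.mpr fun i _ => he i), ih]

theorem deg_eq_zero_of_rad_le {m n : ℕ} (h : m ≤ n) {x : R} (hx : x ≠ 0)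
    (h0 : S.deg (S.rad n) x = 0) : S.deg (S.rad m) x = 0 :=
  le_antisymm (h0 ▸ deg_anti (rad_anti h) hx) (deg_nonneg _ hx)

/-- Infinite products: if the `n`-th factor has no zeros in `[r / (n + 1), r]`, there is an element
whose zeros are those of all factors. -/
theorem exists_infinite_product {e : ℕ → R} (he : ∀ n, e n ≠ 0)
    (hdeg : ∀ n, S.deg (S.rad n) (e n) = 0) :
    ∃ D, ∀ n, ∃ T, T ≠ 0 ∧ D = (∏ i ∈ Finset.range n, e i) * T ∧ S.deg (S.rad n) T = 0 := by
  have := S.isDomain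
  choose c hc hcv using fun n => exists_normalization (he n) (hdeg n)
    (ε := ((n : ℝ≥0) + 1)⁻¹) (by positivity)
  let Q : ℕ → R := fun n => ∏ i ∈ Finset.range n, (c i * e i)
  have hce : ∀ i, c i * e i ≠ 0 := fun i => mul_ne_zero (hc i).ne_zero (he i)
  have hQ0 : ∀ n, Q n ≠ 0 := fun n => Finset.prod_ne_zero_iff.mpr fun i _ => hce i
  have hfac : ∀ t, Tendsto (fun n => S.v t (c n * e n - 1)) atTop (𝓝 0) := fun t => by
    have h1 := tendsto_inv_succ.max (tendsto_rpow_rad t)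
    rw [max_self] at h1
    exact tendsto_zero_of_eventually_le h1 (by
      filter_upwards [eventually_rad_le t] with n hn using hcv n t hn)
  -- the absolute values of the partial products are eventually constant
  have hconst : ∀ t, ∃ N, ∀ n, N ≤ n → S.v t (Q n) = S.v t (Q N) := fun t => by
    obtain ⟨N, hN⟩ := eventually_atTop.mp ((tendsto_order.mp (hfac t)).2 1 zero_lt_one)
    refine ⟨N, fun n hn => ?_⟩
    induction n, hn using Nat.le_induction with
    | base => rfl
    | succ n hn ih =>
      have h1 : S.v t (c n * e n) = 1 := by
        rw [← map_one (S.v t)]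
        refine v_eq_of_sub_lt ?_
        rw [Valuation.map_sub_swap, map_one]
        exact hN n hn
      simp only [Q] at ih ⊢
      rw [Finset.prod_range_succ, map_mul, h1, mul_one, ih]
  obtain ⟨D, hD⟩ := S.exists_limit Q fun t => by
    obtain ⟨N, hN⟩ := hconst t
    have h1 := (hfac t).const_mul (S.v t (Q N))
    rw [mul_zero] at h1
    refine tendsto_zero_of_eventually_le h1 ?_
    filter_upwards [eventually_ge_atTop N] with n hn
    have e1 : Q (n + 1) - Q n = Q n * (c n * e n - 1) := by
      simp only [Q, Finset.prod_range_succ]; ring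
    rw [e1, map_mul, hN n hn]
  have hnear : ∀ t, ∀ᶠ n in atTop, S.v t (Q n - D) < S.v t (Q n) := fun t => by
    obtain ⟨N, hN⟩ := hconst t
    filter_upwards [(tendsto_order.mp (hD t)).2 _ (v_pos (hQ0 N)), eventually_ge_atTop N]
      with n hn hn'
    rwa [hN n hn']
  have hD0 : D ≠ 0 := by
    obtain ⟨n, hn⟩ := (hnear S.top).exists
    exact ne_zero_of_v_sub_lt hn
  refine ⟨D, fun n => ?_⟩
  have hdvd : ∀ m, n ≤ m → (∏ i ∈ Finset.range n, e i) ∣ Q m := fun m hm =>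
    (Finset.prod_dvd_prod_of_dvd _ _ fun i _ => dvd_mul_left (e i) (c i)).trans
      (Finset.prod_dvd_prod_of_subset _ _ _ (Finset.range_subset_range.mpr hm))
  obtain ⟨T, hT⟩ : (∏ i ∈ Finset.range n, e i) ∣ D := by
    refine dvd_of_closureDvd (S := S) fun k ε hε => ?_
    have hsmall : ∀ t, ∀ᶠ m in atTop, S.v t (D - Q m) ≤ ε := fun t => by
      filter_upwards [(tendsto_order.mp (hD t)).2 ε hε] with m hm
      rw [Valuation.map_sub_swap]
      exact hm.le
    obtain ⟨m, ⟨h1, h2⟩, h3⟩ :=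
      (((hsmall (S.rad k)).and (hsmall S.top)).and (eventually_ge_atTop n)).exists
    obtain ⟨q, hq⟩ := hdvd m h3
    exact ⟨q, fun t ht => by rw [mul_comm q, ← hq]; exact v_le_of_endpoints ht h1 h2⟩
  have hT0 : T ≠ 0 := fun h => hD0 (by rw [hT, h, mul_zero])
  refine ⟨T, hT0, hT, ?_⟩
  obtain ⟨m, ⟨h1, h2⟩, h3⟩ :=
    (((hnear (S.rad n)).and (hnear S.top)).and (eventually_ge_atTop n)).exists
  have hdegD := deg_congr h1 h2
  have hce' : ∀ i, S.deg (S.rad n) (c i * e i) = S.deg (S.rad n) (e i) := fun i => by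
    rw [deg_mul _ (hc i).ne_zero (he i), deg_of_isUnit (hc i), zero_add]
  have hQd : S.deg (S.rad n) (Q m) = ∑ i ∈ Finset.range n, S.deg (S.rad n) (e i) := by
    simp only [Q]
    rw [deg_prod hce, Finset.sum_congr rfl fun i _ => hce' i]
    refine (Finset.sum_subset (Finset.range_subset_range.mpr h3) fun i _ hi => ?_).symm
    exact deg_eq_zero_of_rad_le (by simpa using hi) (he i) (hdeg i)
  rw [hT, deg_mul _ (Finset.prod_ne_zero_iff.mpr fun i _ => he i) hT0, deg_prod he, hQd] at hdegD
  omega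

/-- Divisibility by an infinite product `D` can be tested on its partial products `E`. -/
theorem dvd_of_tails {D x : R} (h : ∀ n, ∃ E T, T ≠ 0 ∧ D = E * T ∧ S.deg (S.rad n) T = 0 ∧ E ∣ x) :
    D ∣ x := by
  refine dvd_of_closureDvd (S := S) fun n => ?_
  obtain ⟨E, T, hT0, rfl, hT, y, rfl⟩ := h n
  have h1 := (closureDvd_one_of_deg hT0 hT).mul_left (E * y)
  intro ε hε
  obtain ⟨q, hq⟩ := h1 ε hε
  refine ⟨q * y, fun t ht => ?_⟩
  convert hq t ht using 2
  ring

/-! ### Greatest common divisors -/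

theorem exists_nat_deg_lt (s : S.Radius) (x : R) : ∃ n : ℕ, S.deg s x < n :=
  ⟨(S.deg s x).toNat + 1, by omega⟩

/-- Greatest common divisors: the infinite product of the common factors that are split off
successively on the annuli `[r / (n + 1), r]`. The factor `e n` that is split off after coprimality
on the `n`-th annulus has been achieved has no zeros there. -/
theorem exists_gcd_of_ne_zero (S : SemiunitRing R) {a : R} (ha : a ≠ 0) (b : R) :
    ∃ d a' b', a = d * a' ∧ b = d * b' ∧ IsCoprime a' b' := by
  have := S.isDomain
  obtain ⟨k, hk⟩ := exists_nat_deg_lt (S.rad 0) a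
  obtain ⟨d, a₀, b₀, rfl, rfl, h0⟩ := exists_gcd_on (S.rad 0) k a b ha hk
  obtain ⟨u, hu0, hu, hstep⟩ := exists_seq_of_step (α := R × R)
    (fun n x => x.1 ≠ 0 ∧ S.Cop (S.rad n) x.1 x.2)
    (fun n x y => ∃ e, x.1 = e * y.1 ∧ x.2 = e * y.2)
    (x₀ := (a₀, b₀)) ⟨right_ne_zero_of_mul ha, h0⟩ (by
    rintro n ⟨a, b⟩ ⟨ha, -⟩
    obtain ⟨k, hk⟩ := exists_nat_deg_lt (S.rad (n + 1)) a
    obtain ⟨e, a', b', rfl, rfl, h⟩ := exists_gcd_on (S.rad (n + 1)) k a b ha hk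
    exact ⟨(a', b'), ⟨right_ne_zero_of_mul ha, h⟩, e, rfl, rfl⟩)
  choose e he1 he2 using hstep
  have he0 : ∀ n, e n ≠ 0 := fun n h => (hu n).1 (by rw [he1, h, zero_mul])
  have hdeg : ∀ n, S.deg (S.rad n) (e n) = 0 := fun n =>
    (hu n).2.deg_eq_zero ⟨_, he1 n⟩ ⟨_, he2 n⟩
  obtain ⟨D, hD⟩ := exists_infinite_product he0 hdeg
  have hE : ∀ n, a₀ = (∏ i ∈ Finset.range n, e i) * (u n).1 ∧
      b₀ = (∏ i ∈ Finset.range n, e i) * (u n).2 := fun n => by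
    induction n with
    | zero => simp [hu0]
    | succ n ih => rw [Finset.prod_range_succ, mul_assoc, mul_assoc, ← he1, ← he2]; exact ih
  obtain ⟨a', ha'⟩ : D ∣ a₀ := dvd_of_tails (S := S) fun n =>
    let ⟨T, h1, h2, h3⟩ := hD n
    ⟨_, T, h1, h2, h3, _, (hE n).1⟩
  obtain ⟨b', hb'⟩ : D ∣ b₀ := dvd_of_tails (S := S) fun n =>
    let ⟨T, h1, h2, h3⟩ := hD n
    ⟨_, T, h1, h2, h3, _, (hE n).2⟩
  refine ⟨d * D, a', b', by rw [ha']; ring, by rw [hb']; ring, isCoprime_of_cop (S := S) fun n => ?_⟩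
  obtain ⟨T, -, hT, -⟩ := hD n
  have hE0 : (∏ i ∈ Finset.range n, e i) ≠ 0 := Finset.prod_ne_zero_iff.mpr fun i _ => he0 i
  have e1 : (u n).1 = T * a' := mul_left_cancel₀ hE0 (by
    rw [← (hE n).1, ha', hT]; ring)
  have e2 : (u n).2 = T * b' := mul_left_cancel₀ hE0 (by
    rw [← (hE n).2, hb', hT]; ring)
  have h := (hu n).2
  rw [e1, e2] at h
  exact h.of_mul_left.symm.of_mul_left.symm

theorem exists_gcd (S : SemiunitRing R) (a b : R) :
    ∃ d a' b', a = d * a' ∧ b = d * b' ∧ IsCoprime a' b' := by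
  by_cases ha : a = 0
  · exact ⟨b, 0, 1, by rw [ha, mul_zero], (mul_one b).symm, isCoprime_one_right⟩
  · exact S.exists_gcd_of_ne_zero ha b

theorem isBezout (S : SemiunitRing R) : IsBezout R := by
  rw [IsBezout.iff_span_pair_isPrincipal]
  intro a b
  obtain ⟨d, a', b', rfl, rfl, f, g, h⟩ := S.exists_gcd a b
  refine ⟨d, le_antisymm ?_ ?_⟩
  · rw [Ideal.span_le]
    rintro _ (rfl | rfl)
    · exact Ideal.mem_span_singleton'.mpr ⟨a', mul_comm _ _⟩
    · exact Ideal.mem_span_singleton'.mpr ⟨b', mul_comm _ _⟩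
  · refine (Ideal.span_singleton_le_iff_mem _).mpr ?_
    exact Ideal.mem_span_pair.mpr ⟨f, g, by linear_combination d * h⟩

/-! ### Adequacy -/

theorem cop_of_isCoprime {s : S.Radius} {a b : R} (h : IsCoprime a b) : S.Cop s a b := by
  obtain ⟨f, g, h⟩ := h
  exact ⟨f, g, fun t _ => by rw [h, sub_self, map_zero]; exact zero_lt_one⟩

theorem Cop.pow_right {s : S.Radius} {a b : R} (h : S.Cop s a b) (N : ℕ) : S.Cop s a (b ^ N) := by
  induction N with
  | zero => rw [pow_zero]; exact cop_of_isCoprime isCoprime_one_right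
  | succ N ih => rw [pow_succ]; exact ih.mul_right h

/-- On `[s, r]`, the part of `a` that is coprime to `b` remains after splitting off common divisors
as long as they have zeros there. -/
theorem exists_coprime_part_on (s : S.Radius) (b : R) (n : ℕ) : ∀ a : R, a ≠ 0 → S.deg s a < n →
    ∃ g a', a = g * a' ∧ (∃ N : ℕ, g ∣ b ^ N) ∧ S.Cop s a' b := by
  induction n with
  | zero =>
    intro a ha h
    have := deg_nonneg s ha
    simp only [Nat.cast_zero] at h
    omega
  | succ n ih =>
    intro a ha h
    obtain ⟨d, a', b', rfl, hb, hco⟩ := S.exists_gcd_of_ne_zero ha b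
    have hd0 := left_ne_zero_of_mul ha
    have ha0 := right_ne_zero_of_mul ha
    by_cases hd : S.deg s d = 0
    · refine ⟨1, d * a', (one_mul _).symm, ⟨0, by simp⟩, Cop.symm ?_⟩
      refine (cop_of_deg hd0 hd).mul_right (Cop.symm ?_)
      rw [hb]
      exact (cop_of_deg hd0 hd).mul_right (cop_of_isCoprime hco)
    · have h1 := deg_nonneg s hd0
      rw [deg_mul s hd0 ha0] at h
      obtain ⟨g, a'', rfl, ⟨N, hN⟩, hcop⟩ := ih a' ha0 (by push_cast at h; omega)
      refine ⟨d * g, a'', by ring, ⟨N + 1, ?_⟩, hcop⟩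
      rw [pow_succ']
      exact mul_dvd_mul ⟨b', hb⟩ hN

/-- The adequate factorization of `a` with respect to `b`: the second factor is an infinite product of
divisors of powers of `b`. A divisor of it that is coprime to `b` is coprime to all partial products
and so has no zeros. -/
theorem exists_adequate_factorization (S : SemiunitRing R) (a b : R) (ha : a ≠ 0) :
    ∃ a₁ a₂ : R, a = a₁ * a₂ ∧ IsCoprime a₁ b ∧
      ∀ a₃ : R, a₃ ∣ a₂ → ¬ IsUnit a₃ → ¬ IsCoprime a₃ b := by
  have := S.isDomain
  obtain ⟨k, hk⟩ := exists_nat_deg_lt (S.rad 0) a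
  obtain ⟨g, a₀, rfl, ⟨N, hg⟩, h0⟩ := exists_coprime_part_on (S.rad 0) b k a ha hk
  have hg0 := left_ne_zero_of_mul ha
  obtain ⟨u, hu0, hu, hstep⟩ := exists_seq_of_step (α := R)
    (fun n x => x ≠ 0 ∧ S.Cop (S.rad n) x b)
    (fun n x y => ∃ e, x = e * y ∧ ∃ N : ℕ, e ∣ b ^ N)
    (x₀ := a₀) ⟨right_ne_zero_of_mul ha, h0⟩ (by
    rintro n a ⟨ha, -⟩
    obtain ⟨k, hk⟩ := exists_nat_deg_lt (S.rad (n + 1)) a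
    obtain ⟨e, a', rfl, hN, h⟩ := exists_coprime_part_on (S.rad (n + 1)) b k a ha hk
    exact ⟨a', ⟨right_ne_zero_of_mul ha, h⟩, e, rfl, hN⟩)
  choose e he1 he2 using hstep
  choose M hM using he2
  have he0 : ∀ n, e n ≠ 0 := fun n h => (hu n).1 (by rw [he1, h, zero_mul])
  have hdeg : ∀ n, S.deg (S.rad n) (e n) = 0 := fun n =>
    ((hu n).2.pow_right (M n)).deg_eq_zero ⟨_, he1 n⟩ (hM n)
  obtain ⟨D, hD⟩ := exists_infinite_product he0 hdeg
  have hE : ∀ n, a₀ = (∏ i ∈ Finset.range n, e i) * u n := fun n => by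
    induction n with
    | zero => simp [hu0]
    | succ n ih => rw [Finset.prod_range_succ, mul_assoc, ← he1]; exact ih
  obtain ⟨a', ha'⟩ : D ∣ a₀ := dvd_of_tails (S := S) fun n =>
    let ⟨T, h1, h2, h3⟩ := hD n
    ⟨_, T, h1, h2, h3, _, hE n⟩
  refine ⟨a', g * D, by rw [ha']; ring, isCoprime_of_cop (S := S) fun n => ?_, ?_⟩
  · obtain ⟨T, -, hT, -⟩ := hD n
    have hE0 : (∏ i ∈ Finset.range n, e i) ≠ 0 := Finset.prod_ne_zero_iff.mpr fun i _ => he0 i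
    have e1 : u n = T * a' := mul_left_cancel₀ hE0 (by rw [← hE n, ha', hT]; ring)
    have h := (hu n).2
    rw [e1] at h
    exact h.of_mul_left
  · intro x hx hxu hxb
    refine hxu ?_
    have hxg : IsCoprime x g := (hxb.pow_right (n := N)).of_isCoprime_of_dvd_right hg
    have hxD : x ∣ D := hxg.dvd_of_dvd_mul_left hx
    obtain ⟨T₀, hT₀, hDT, -⟩ := hD 0
    have hD0 : D ≠ 0 := by simpa [hDT] using hT₀
    refine isUnit_of_deg (S := S) (ne_zero_of_dvd_ne_zero hD0 hxD) fun n => ?_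
    obtain ⟨T, hT0, hT, hTd⟩ := hD n
    have hxE : IsCoprime x (∏ i ∈ Finset.range n, e i) := IsCoprime.prod_right fun i _ =>
      (hxb.pow_right (n := M i)).of_isCoprime_of_dvd_right (hM i)
    exact deg_eq_zero_of_dvd (hxE.dvd_of_dvd_mul_left (hT ▸ hxD)) hT0 hTd

theorem isAdequate (S : SemiunitRing R) : IsAdequate R :=
  ⟨S.isDomain, S.isBezout, S.exists_adequate_factorization⟩

end SemiunitRing
end Overconvergent

/-! ### Elementary divisors over adequate domains -/

namespace Overconvergent
namespace IsAdequate

variable {R : Type*} [CommRing R]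

theorem isCoprime_of_isUnit_of_dvd [IsBezout R] {a b : R} (h : ∀ d, d ∣ a → d ∣ b → IsUnit d) :
    IsCoprime a b := by
  obtain ⟨x, y, hxy⟩ := IsBezout.gcd_eq_sum a b
  obtain ⟨u, hu⟩ := (h _ (IsBezout.gcd_dvd_left a b) (IsBezout.gcd_dvd_right a b)).exists_left_inv
  exact ⟨u * x, u * y, by rw [mul_assoc, mul_assoc, ← mul_add, hxy, hu]⟩

/-- If `a ≠ 0` and `a, b, c` generate the unit ideal, then `a` and `b + t * c` do so for some `t`:
take for `t` the part of `a` that is coprime to `b`. -/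
theorem exists_isCoprime_add_mul (h : IsAdequate R) {a b c : R} (ha : a ≠ 0)
    (habc : ∃ x y z, x * a + y * b + z * c = 1) : ∃ t, IsCoprime a (b + t * c) := by
  have := h.isBezout
  obtain ⟨x, y, z, hxyz⟩ := habc
  obtain ⟨t, a₂, rfl, htb, h₂⟩ := h.exists_factorization a b ha
  refine ⟨t, isCoprime_of_isUnit_of_dvd fun d hda hdb => ?_⟩
  have hdt : IsCoprime d t := isCoprime_of_isUnit_of_dvd fun g hgd hgt =>
    htb.isUnit_of_dvd' hgt ((dvd_add_left (hgt.mul_right c)).mp (hgd.trans hdb))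
  by_contra hd
  refine h₂ d (hdt.dvd_of_dvd_mul_left hda) hd (isCoprime_of_isUnit_of_dvd fun g hgd hgb => ?_)
  have hgt : IsCoprime g t := hdt.of_isCoprime_of_dvd_left hgd
  have hgc : g ∣ c := hgt.dvd_of_dvd_mul_left ((dvd_add_right hgb).mp (hgd.trans hdb))
  refine isUnit_of_dvd_one (hxyz ▸ ?_)
  exact dvd_add (dvd_add ((hgd.trans hda).mul_left x) (hgb.mul_left y)) (hgc.mul_left z)

section Content

variable {M : Type*} [AddCommGroup M] [Module R M] [Module.Finite R M] [Module.Projective R M]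

/-- Over a Bézout ring, an element of a finite projective module is a multiple of its content. -/
theorem exists_content [IsBezout R] (y : M) :
    ∃ (g : R) (e : M) (ψ : M →ₗ[R] R), y = g • e ∧ ψ y = g := by
  obtain ⟨n, f, s, -, -, hfs⟩ := Module.Finite.exists_comp_eq_id_of_projective R M
  have hf : ∀ z, f (s z) = z := fun z => LinearMap.congr_fun hfs z
  obtain ⟨g, hg⟩ := (IsBezout.isPrincipal_of_FG (Ideal.span (Set.range (s y)))
    (Submodule.fg_span (Set.finite_range _))).principal
  have h1 : ∀ i, ∃ d, s y i = d * g := fun i => by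
    have h : s y i ∈ Ideal.span (Set.range (s y)) := Ideal.subset_span ⟨i, rfl⟩
    rw [hg] at h
    obtain ⟨d, hd⟩ := Submodule.mem_span_singleton.mp h
    exact ⟨d, hd.symm⟩
  choose d hd using h1
  have h2 : g ∈ Ideal.span (Set.range (s y)) := by
    rw [hg]; exact Submodule.mem_span_singleton_self g
  obtain ⟨c, hc⟩ := (Submodule.mem_span_range_iff_exists_fun R).mp h2
  refine ⟨g, f d, ∑ i, c i • (LinearMap.proj i).comp s, ?_, ?_⟩
  · rw [← map_smul, show g • d = s y from funext fun i => by
      rw [hd]; simp [mul_comm], hf]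
  · simpa using hc

variable [IsDomain R]

/-- If values of linear forms at two vectors generate the unit ideal, a linear combination of the
vectors is unimodular. In coordinates, this is the reduction of a matrix with rows `(α, 0)` and
`(β, g)` whose entries generate the unit ideal: by adequacy `g` and `β + s * α` are coprime for some
`s`. -/
theorem exists_unimodular_combination (h : IsAdequate R) {y₁ y₂ : M} {ψ₁ ψ₂ : M →ₗ[R] R}
    (h1 : ψ₁ y₁ + ψ₂ y₂ = 1) : ∃ (s t : R) (φ : M →ₗ[R] R), φ (s • y₁ + t • y₂) = 1 := by
  have := h.isBezout
  obtain ⟨α, e, φ, rfl, hφ⟩ := exists_content (R := R) y₁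
  by_cases hα : α = 0
  · exact ⟨0, 1, ψ₂, by simpa [hα] using h1⟩
  have hφe : φ e = 1 := by
    rw [map_smul, smul_eq_mul] at hφ
    exact mul_left_cancel₀ hα (hφ.trans (mul_one α).symm)
  obtain ⟨g, e', ψ, hγ, hψ⟩ := exists_content (R := R) (y₂ - φ y₂ • e)
  set β := φ y₂
  have hy₂ : y₂ = β • e + g • e' := by rw [← hγ]; abel
  have hunit : α * ψ₁ e + (β * ψ₂ e + g * ψ₂ e') = 1 := by
    rw [hy₂] at h1; simpa using h1
  by_cases hg : g = 0
  · refine ⟨ψ₁ e, ψ₂ e, φ, ?_⟩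
    rw [map_add, map_smul, map_smul, map_smul, hφe, smul_eq_mul, smul_eq_mul, smul_eq_mul]
    linear_combination hunit - ψ₂ e' * hg
  obtain ⟨s, A, B, hs⟩ := h.exists_isCoprime_add_mul (a := g) (b := β) (c := α) hg
    ⟨ψ₂ e', ψ₂ e, ψ₁ e, by linear_combination hunit⟩
  refine ⟨s, 1, B • φ + A • (ψ - ψ e • φ), ?_⟩
  have hψ2 : ψ y₂ = g + β * ψ e := by
    rw [map_sub, map_smul, smul_eq_mul, sub_eq_iff_eq_add] at hψ; exact hψ
  have hφ2 : φ y₂ = β := rfl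
  simp only [LinearMap.add_apply, LinearMap.smul_apply, LinearMap.sub_apply, map_add, map_smul,
    smul_eq_mul, hφe, hφ2, hψ2]
  linear_combination hs

/-- The content of the submodule generated by two vectors is the content of one of its elements. -/
theorem exists_combination_dvd (h : IsAdequate R) (y₁ y₂ : M) :
    ∃ (s t : R) (φ : M →ₗ[R] R), ∀ ψ : M →ₗ[R] R,
      φ (s • y₁ + t • y₂) ∣ ψ y₁ ∧ φ (s • y₁ + t • y₂) ∣ ψ y₂ := by
  have := h.isBezout
  obtain ⟨g₁, e₁, ψ₁, rfl, h₁⟩ := exists_content (R := R) y₁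
  obtain ⟨g₂, e₂, ψ₂, rfl, h₂⟩ := exists_content (R := R) y₂
  obtain ⟨x, z, hxz⟩ := IsBezout.gcd_eq_sum g₁ g₂
  obtain ⟨k₁, hk₁⟩ := IsBezout.gcd_dvd_left g₁ g₂
  obtain ⟨k₂, hk₂⟩ := IsBezout.gcd_dvd_right g₁ g₂
  set d := IsBezout.gcd g₁ g₂
  by_cases hd : d = 0
  · exact ⟨0, 0, 0, fun ψ => by simp [hk₁, hk₂, hd]⟩
  have e₁' : ψ₁ (k₁ • e₁) = k₁ := mul_left_cancel₀ hd (by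
    rw [← hk₁, ← smul_eq_mul, ← map_smul, smul_smul, ← hk₁, h₁])
  have e₂' : ψ₂ (k₂ • e₂) = k₂ := mul_left_cancel₀ hd (by
    rw [← hk₂, ← smul_eq_mul, ← map_smul, smul_smul, ← hk₂, h₂])
  have h3 : (x • ψ₁) (k₁ • e₁) + (z • ψ₂) (k₂ • e₂) = 1 := mul_left_cancel₀ hd (by
    rw [LinearMap.smul_apply, LinearMap.smul_apply, e₁', e₂', smul_eq_mul, smul_eq_mul]
    linear_combination hxz - x * hk₁ - z * hk₂)
  obtain ⟨s, t, φ, hφ⟩ := h.exists_unimodular_combination h3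
  have h4 : φ (s • g₁ • e₁ + t • g₂ • e₂) = d := by
    have : s • g₁ • e₁ + t • g₂ • e₂ = d • (s • k₁ • e₁ + t • k₂ • e₂) := by
      rw [hk₁, hk₂, smul_add]
      simp only [smul_smul]
      congr 2 <;> ring
    rw [this, map_smul, hφ, smul_eq_mul, mul_one]
  refine ⟨s, t, φ, fun ψ => ?_⟩
  rw [h4, map_smul, map_smul]
  exact ⟨Dvd.dvd.mul_right ⟨k₁, hk₁⟩ _, Dvd.dvd.mul_right ⟨k₂, hk₂⟩ _⟩

/-- The content of a finitely generated submodule is the content of one of its elements. -/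
theorem exists_mem_dvd (h : IsAdequate R) {N : Submodule R M} (hN : N.FG) :
    ∃ y ∈ N, ∃ φ : M →ₗ[R] R, ∀ x ∈ N, ∀ ψ : M →ₗ[R] R, φ y ∣ ψ x := by
  have := h.isBezout
  induction N, hN using Submodule.fg_induction with
  | singleton x =>
    obtain ⟨g, e, φ, hx, hφ⟩ := exists_content (R := R) x
    refine ⟨x, Submodule.mem_span_singleton_self x, φ, fun w hw ψ => ?_⟩
    obtain ⟨c, rfl⟩ := Submodule.mem_span_singleton.mp hw
    rw [hφ, hx, map_smul, map_smul, smul_eq_mul, smul_eq_mul]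
    exact (dvd_mul_right g _).mul_left c
  | sup N₁ N₂ _ _ ih₁ ih₂ =>
    obtain ⟨y₁, hy₁, φ₁, h₁⟩ := ih₁
    obtain ⟨y₂, hy₂, φ₂, h₂⟩ := ih₂
    obtain ⟨s, t, φ, hφ⟩ := h.exists_combination_dvd y₁ y₂
    refine ⟨s • y₁ + t • y₂, Submodule.add_mem_sup (N₁.smul_mem s hy₁) (N₂.smul_mem t hy₂), φ,
      fun x hx ψ => ?_⟩
    obtain ⟨x₁, hx₁, x₂, hx₂, rfl⟩ := Submodule.mem_sup.mp hx
    rw [map_add ψ]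
    exact dvd_add ((hφ φ₁).1.trans (h₁ x₁ hx₁ ψ)) ((hφ φ₂).2.trans (h₂ x₂ hx₂ ψ))

/-- A finitely generated submodule contains a multiple of a unimodular vector `e` by its content
`a`. -/
theorem exists_smul_unimodular_mem (h : IsAdequate R) {N : Submodule R M} (hN : N.FG)
    (h0 : N ≠ ⊥) : ∃ (a : R) (e : M) (φ : M →ₗ[R] R), a ≠ 0 ∧ φ e = 1 ∧ a • e ∈ N ∧
      ∀ x ∈ N, ∀ ψ : M →ₗ[R] R, a ∣ ψ x := by
  have := h.isBezout
  obtain ⟨y, hy, φ, hφ⟩ := h.exists_mem_dvd hN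
  obtain ⟨a, e, ψ, rfl, hψ⟩ := exists_content (R := R) y
  have hdvd : ∀ x ∈ N, ∀ ψ : M →ₗ[R] R, a ∣ ψ x := fun x hx ψ =>
    (Dvd.intro (φ e) (by simp)).trans (hφ x hx ψ)
  have ha : a ≠ 0 := by
    rintro rfl
    refine h0 ((Submodule.eq_bot_iff N).mpr fun x hx => ?_)
    obtain ⟨g, e', ψ', rfl, hψ'⟩ := exists_content (R := R) x
    rw [← hψ', zero_dvd_iff.mp (hdvd _ hx ψ'), zero_smul]
  refine ⟨a, e, ψ, ha, ?_, hy, hdvd⟩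
  rw [map_smul, smul_eq_mul] at hψ
  exact mul_left_cancel₀ ha (hψ.trans (mul_one a).symm)

end Content

section Split

variable {M : Type*} [AddCommGroup M] [Module R M] (φ : M →ₗ[R] R) {e : M}

/-- The projection of `M` onto the kernel of `φ` along `e`. -/
noncomputable def kerProj (he : φ e = 1) : M →ₗ[R] LinearMap.ker φ :=
  (LinearMap.id - φ.smulRight e).codRestrict _ fun x => by simp [he]

theorem coe_kerProj (he : φ e = 1) (x : M) : (kerProj φ he x : M) = x - φ x • e := rfl

theorem kerProj_apply_coe (he : φ e = 1) (x : LinearMap.ker φ) : kerProj φ he x = x :=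
  Subtype.ext (by rw [coe_kerProj, LinearMap.mem_ker.mp x.2, zero_smul, sub_zero])

theorem finite_ker (he : φ e = 1) [Module.Finite R M] : Module.Finite R (LinearMap.ker φ) :=
  Module.Finite.of_surjective (kerProj φ he) fun x => ⟨x, kerProj_apply_coe φ he x⟩

theorem projective_ker (he : φ e = 1) [Module.Projective R M] : Module.Projective R (LinearMap.ker φ) :=
  Module.Projective.of_split (LinearMap.ker φ).subtype (kerProj φ he)
    (LinearMap.ext fun x => kerProj_apply_coe φ he x)

theorem finrank_ker_add_one (he : φ e = 1) [IsDomain R] [Module.Finite R M] :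
    Module.finrank R (LinearMap.ker φ) + 1 = Module.finrank R M := by
  have h := Submodule.finrank_quotient_add_finrank (LinearMap.ker φ)
  rw [(φ.quotKerEquivOfSurjective fun c => ⟨c • e, by simp [he]⟩).finrank_eq,
    Module.finrank_self] at h
  omega

/-- A vector with `φ e = 1` extends a basis of the kernel of `φ` to a basis. -/
theorem exists_mkFinCons (he : φ e = 1) {n : ℕ} (b : Module.Basis (Fin n) R (LinearMap.ker φ)) :
    ∃ b' : Module.Basis (Fin (n + 1)) R M, (b' : Fin (n + 1) → M) = Fin.cons e ((↑) ∘ b) := by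
  refine ⟨Module.Basis.mkFinCons e b (fun c x hx h => ?_) fun z => ⟨-φ z, ?_⟩,
    Module.Basis.coe_mkFinCons ..⟩
  · simpa [he, LinearMap.mem_ker.mp hx] using congrArg φ h
  · simp [he]

end Split

theorem exists_unimodular [IsDomain R] [IsBezout R] {M : Type*} [AddCommGroup M] [Module R M]
    [Module.Finite R M] [Module.Projective R M] [Nontrivial M] :
    ∃ (e : M) (φ : M →ₗ[R] R), φ e = 1 := by
  obtain ⟨y, hy⟩ := exists_ne (0 : M)
  obtain ⟨a, e, ψ, rfl, hψ⟩ := exists_content (R := R) y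
  have ha : a ≠ 0 := fun h => hy (by rw [h, zero_smul])
  rw [map_smul, smul_eq_mul] at hψ
  exact ⟨e, ψ, mul_left_cancel₀ ha (hψ.trans (mul_one a).symm)⟩

/-- Finite projective modules over a Bézout domain are free. -/
theorem exists_basis [IsDomain R] [IsBezout R] (k : ℕ) : ∀ (M : Type*) [AddCommGroup M]
    [Module R M] [Module.Finite R M] [Module.Projective R M], Module.finrank R M = k →
    ∃ m, Nonempty (Module.Basis (Fin m) R M) := by
  induction k with
  | zero =>
    intro M _ _ _ _ hk
    have : Module.IsTorsionFree R M := inferInstance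
    have : Subsingleton M := Module.finrank_zero_iff.mp hk
    exact ⟨0, ⟨Module.Basis.empty M⟩⟩
  | succ k ih =>
    intro M _ _ _ _ hk
    have : Nontrivial M := Module.nontrivial_of_finrank_eq_succ hk
    obtain ⟨e, φ, he⟩ := exists_unimodular (R := R) (M := M)
    have := finite_ker φ he
    have := projective_ker φ he
    obtain ⟨m, ⟨b⟩⟩ := ih (LinearMap.ker φ) (by have := finrank_ker_add_one φ he; omega)
    obtain ⟨b', -⟩ := exists_mkFinCons φ he b
    exact ⟨m + 1, ⟨b'⟩⟩

/-- The elementary divisor theorem by induction on the rank: `M` splits as `R e₀ ⊕ ker φ`, and since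
`a` divides `φ` on `N` and `a • e₀` lies in `N`, the submodule splits accordingly as
`R (a • e₀) ⊕ (N ∩ ker φ)`. -/
theorem exists_elementaryDivisors [IsDomain R] (h : IsAdequate R) (k : ℕ) : ∀ (M : Type*)
    [AddCommGroup M] [Module R M] [Module.Finite R M] [Module.Projective R M]
    (N : Submodule R M), N.FG → Module.finrank R M = k →
    ∃ (m n : ℕ) (hnm : n ≤ m) (e : Module.Basis (Fin m) R M) (f : Module.Basis (Fin n) R N)
      (l : Fin n → R), (∀ i, l i ≠ 0) ∧ (∀ i j, i ≤ j → l i ∣ l j) ∧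
      ∀ i, (f i : M) = l i • e (Fin.castLE hnm i) := by
  have := h.isBezout
  have bot : ∀ (M : Type _) [AddCommGroup M] [Module R M] [Module.Finite R M]
      [Module.Projective R M] (N : Submodule R M), N = ⊥ →
      ∃ (m n : ℕ) (hnm : n ≤ m) (e : Module.Basis (Fin m) R M) (f : Module.Basis (Fin n) R N)
      (l : Fin n → R), (∀ i, l i ≠ 0) ∧ (∀ i j, i ≤ j → l i ∣ l j) ∧
      ∀ i, (f i : M) = l i • e (Fin.castLE hnm i) := by
    rintro M _ _ _ _ _ rfl
    obtain ⟨m, ⟨b⟩⟩ := exists_basis (R := R) _ M rfl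
    exact ⟨m, 0, m.zero_le, b, Module.Basis.empty _, 0, fun i => i.elim0, fun i => i.elim0,
      fun i => i.elim0⟩
  induction k with
  | zero =>
    intro M _ _ _ _ N _ hk
    have : Subsingleton M := Module.finrank_zero_iff.mp hk
    exact bot M N (Subsingleton.elim _ _)
  | succ k ih =>
    intro M _ _ _ _ N hN hk
    by_cases h0 : N = ⊥
    · exact bot M N h0
    obtain ⟨a, e₀, φ, ha, he, haN, hdvd⟩ := h.exists_smul_unimodular_mem hN h0
    have := finite_ker φ he
    have := projective_ker φ he
    set K := LinearMap.ker φ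
    have hproj : ∀ x ∈ N, (kerProj φ he x : M) ∈ N := fun x hx => by
      obtain ⟨c, hc⟩ := hdvd x hx φ
      rw [coe_kerProj, hc, mul_comm, mul_smul]
      exact N.sub_mem hx (N.smul_mem c haN)
    have hNK : N.comap K.subtype = N.map (kerProj φ he) := by
      ext x
      rw [Submodule.mem_comap, Submodule.mem_map]
      exact ⟨fun hx => ⟨x, hx, kerProj_apply_coe φ he x⟩, fun ⟨y, hy, hyx⟩ => hyx ▸ hproj y hy⟩
    obtain ⟨m, n, hnm, e, f, l, hl0, hl, hf⟩ := ih K (N.comap K.subtype)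
      (hNK ▸ hN.map _) (Nat.succ_injective ((finrank_ker_add_one φ he).trans hk))
    obtain ⟨e', he'⟩ := exists_mkFinCons φ he e
    let f₁ := f.map (Submodule.equivSubtypeMap K (N.comap K.subtype))
    have hle : (N.comap K.subtype).map K.subtype ≤ N := Submodule.map_comap_le _ _
    have hker : ∀ x ∈ (N.comap K.subtype).map K.subtype, φ x = 0 := by
      rintro _ ⟨x, -, rfl⟩
      exact x.2
    let f' := Module.Basis.mkFinConsOfLE (a • e₀) haN f₁ hle
      (fun c x hx hc => by
        have := congrArg φ hc
        rw [map_add, hker x hx, map_smul, map_smul, he, map_zero, add_zero, smul_eq_mul,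
          smul_eq_mul, mul_one] at this
        exact (mul_eq_zero.mp this).resolve_right ha)
      (fun z hz => by
        obtain ⟨c, hc⟩ := hdvd z hz φ
        refine ⟨-c, kerProj φ he z, hproj z hz, ?_⟩
        rw [Submodule.subtype_apply, coe_kerProj, hc, smul_smul, neg_mul, neg_smul, mul_comm,
          ← sub_eq_add_neg])
    have hf' : ∀ i, (f' i : M) = (Fin.cons a l : Fin (n + 1) → R) i •
        e' (Fin.castLE (Nat.succ_le_succ hnm) i) := by
      intro i
      rw [Module.Basis.coe_mkFinConsOfLE, he']
      refine Fin.cases ?_ (fun i => ?_) i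
      · simp
      · have := congrArg (Subtype.val) (hf i)
        simpa [f₁] using this
    refine ⟨m + 1, n + 1, Nat.succ_le_succ hnm, e', f', Fin.cons a l, fun i => ?_, fun i j => ?_,
      hf'⟩
    · exact Fin.cases ha hl0 i
    · refine Fin.cases (fun _ => ?_) (fun i => ?_) i
      · have h1 := hdvd _ (f' j).2 (e'.coord (Fin.castLE (Nat.succ_le_succ hnm) j))
        rwa [hf', map_smul, Module.Basis.coord_apply, Module.Basis.repr_self,
          Finsupp.single_eq_same, smul_eq_mul, mul_one] at h1
      · refine Fin.cases (fun hij => ?_) (fun j hij => ?_) j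
        · simp at hij
        · simpa using hl i j (by simpa using hij)

/-- The elementary divisor theorem over an adequate domain. -/
theorem elementaryDivisorTheorem (h : IsAdequate R) : ElementaryDivisorTheorem R := by
  have := h.isDomain
  intro M _ _ _ _ N _ _
  exact h.exists_elementaryDivisors _ M N (Module.Finite.iff_fg.mp inferInstance) rfl

end IsAdequate
end Overconvergent

/-! ### Multiplicativity of the Gauss norm -/

namespace Overconvergent

section WittNorm

variable (p : ℕ) [hp : Fact p.Prime] {E : Type*} [NormedField E] [CharP E p]

theorem pfNorm_teichCoord_select_ne_le (x : WittVector p (PerfectClosure E p)) (i k : ℕ) :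
    pfNorm p (teichCoord p (x.select fun j => j ≠ i) k) ≤
      if k = i then 0 else pfNorm p (teichCoord p x k) := by
  by_cases h : k = i
  · rw [if_pos h, teichCoord, WittVector.select, WittVector.coeff_mk, if_neg (by simpa using h),
      map_zero, pfNorm_zero]
  · rw [if_neg h, teichCoord, WittVector.select, WittVector.coeff_mk, if_pos h, teichCoord]

/-- Splitting off a single Teichmüller term from a Witt vector. -/
theorem eq_teichmuller_mul_pow_add (x : WittVector p (PerfectClosure E p)) (i : ℕ) :
    x = WittVector.teichmuller p (teichCoord p x i) *
      (p : WittVector p (PerfectClosure E p)) ^ i + x.select fun j => j ≠ i := by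
  conv_lhs => rw [← WittVector.select_add_select_not (fun j => j = i) x]
  congr 1
  ext k
  rw [WittVector.select, WittVector.coeff_mk]
  by_cases h : k = i
  · rw [if_pos h, h, WittVector.teichmuller_mul_pow_coeff, teichCoord_pow]
  · rw [if_neg h, WittVector.teichmuller_mul_pow_coeff_of_ne _ h]

theorem teichCoord_teichmuller_mul (c : PerfectClosure E p)
    (x : WittVector p (PerfectClosure E p)) (k : ℕ) :
    teichCoord p (WittVector.teichmuller p c * x) k = c * teichCoord p x k :=
  teichCoord_of_coeff p (by rw [coeff_teichmuller_mul, mul_pow, teichCoord_pow])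

theorem partialNorm_teichmuller_mul (c : PerfectClosure E p)
    (x : WittVector p (PerfectClosure E p)) (n : ℕ) :
    partialNorm p n (WittVector.teichmuller p c * x) = pfNorm p c * partialNorm p n x := by
  simp only [partialNorm, teichCoord_teichmuller_mul, pfNorm_mul, NNReal.mul_finset_sup]

theorem gaussTerm_zero_right (r : ℝ≥0) (x : WittVector p (PerfectClosure E p)) :
    gaussTerm p r x 0 = pfNorm p (x.coeff 0) ^ (r : ℝ) := by
  simp [gaussTerm, partialNorm, teichCoord]

theorem inv_p_pos : 0 < (p : ℝ≥0)⁻¹ := inv_pos.mpr (by exact_mod_cast hp.out.pos)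

theorem gaussTerm_p_mul_succ (r : ℝ≥0) (x : WittVector p (PerfectClosure E p)) (n : ℕ) :
    gaussTerm p r ((p : WittVector p (PerfectClosure E p)) * x) (n + 1) =
      (p : ℝ≥0)⁻¹ * gaussTerm p r x n := by
  rw [gaussTerm, gaussTerm, partialNorm_p_mul, pow_succ]; ring

theorem gaussTerm_interpolate {a b t : ℝ≥0} {θ θ' : ℝ} (hθ : 0 ≤ θ) (hθ' : 0 ≤ θ')
    (h1 : θ + θ' = 1) (ht : (t : ℝ) = a * θ + b * θ') (x : WittVector p (PerfectClosure E p))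
    (n : ℕ) : gaussTerm p t x n = gaussTerm p a x n ^ θ * gaussTerm p b x n ^ θ' := by
  unfold gaussTerm
  rw [NNReal.mul_rpow, NNReal.mul_rpow, ← NNReal.rpow_mul, ← NNReal.rpow_mul,
    mul_mul_mul_comm, ← NNReal.rpow_add_of_nonneg _ hθ hθ', h1, NNReal.rpow_one, ht,
    NNReal.rpow_add_of_nonneg _ (mul_nonneg a.coe_nonneg hθ) (mul_nonneg b.coe_nonneg hθ')]

variable [IsUltrametricDist E]

/-- The Gauss norm is a log-convex function of the radius. -/
theorem gaussNorm_interpolate {a b t : ℝ≥0} {θ θ' : ℝ} (hθ : 0 ≤ θ) (hθ' : 0 ≤ θ')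
    (h1 : θ + θ' = 1) (ht : (t : ℝ) = a * θ + b * θ') {x : WittVector p (PerfectClosure E p)}
    (ha : x ∈ wittSubring p a) (hb : x ∈ wittSubring p b) :
    gaussNorm p t x ≤ gaussNorm p a x ^ θ * gaussNorm p b x ^ θ' :=
  ciSup_le fun n => by
    rw [gaussTerm_interpolate p hθ hθ' h1 ht]
    exact mul_le_mul' (NNReal.rpow_le_rpow (gaussTerm_le_gaussNorm p ha n) hθ)
      (NNReal.rpow_le_rpow (gaussTerm_le_gaussNorm p hb n) hθ')

theorem gaussNorm_le_rpow {s r : ℝ≥0} (hs : 0 < s) (hsr : s ≤ r)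
    {x : WittVector p (PerfectClosure E p)} (hx : x ∈ wittSubring p r) :
    gaussNorm p s x ≤ gaussNorm p r x ^ ((s : ℝ) / r) :=
  ciSup_le fun n => (gaussTerm_le_rpow p hs hsr x n).trans
    (NNReal.rpow_le_rpow (gaussTerm_le_gaussNorm p hx n) (by positivity))

theorem partialNorm_mul_lt_of (x y : WittVector p (PerfectClosure E p)) (n : ℕ) {c : ℝ≥0}
    (h : ∀ i j, i + j ≤ n → pfNorm p (teichCoord p x i) * pfNorm p (teichCoord p y j) < c) :
    partialNorm p n (x * y) < c := by
  have hc : 0 < c := zero_le.trans_lt (h 0 0 (Nat.zero_le n))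
  let s : Finset (ℕ × ℕ) := (Finset.range (n + 1) ×ˢ Finset.range (n + 1)).filter
    fun a => a.1 + a.2 ≤ n
  let B := s.sup fun a => pfNorm p (teichCoord p x a.1) * pfNorm p (teichCoord p y a.2)
  refine lt_of_le_of_lt (partialNorm_mul_le_of p x y n (B := B) fun i j hij => ?_) ?_
  · refine Finset.le_sup
      (f := fun a : ℕ × ℕ => pfNorm p (teichCoord p x a.1) * pfNorm p (teichCoord p y a.2))
      (b := (i, j)) ?_
    simp only [s, Finset.mem_filter, Finset.mem_product, Finset.mem_range]
    omega
  · exact (Finset.sup_lt_iff hc).mpr fun a ha => h _ _ (Finset.mem_filter.mp ha).2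

/-- The Gauss norm is attained, and at the first index where this happens by the coordinate
itself. -/
theorem exists_first_index {r : ℝ≥0} {x : WittVector p (PerfectClosure E p)}
    (hx : x ∈ wittSubring p r) (h0 : gaussNorm p r x ≠ 0) :
    ∃ i, (p : ℝ≥0)⁻¹ ^ i * pfNorm p (teichCoord p x i) ^ (r : ℝ) = gaussNorm p r x ∧
      gaussTerm p r x i = gaussNorm p r x ∧ ∀ k < i, gaussTerm p r x k < gaussNorm p r x := by
  classical
  have hx' : Tendsto (gaussTerm p r x) atTop (𝓝 0) := hx
  have hex : ∃ i, gaussTerm p r x i = gaussNorm p r x := by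
    obtain ⟨N, hN⟩ := eventually_atTop.mp (hx'.eventually_lt_const
      (half_pos (pos_iff_ne_zero.mpr h0)))
    by_contra! hne
    have hlt : ∀ i, gaussTerm p r x i < gaussNorm p r x := fun i =>
      lt_of_le_of_ne (gaussTerm_le_gaussNorm p hx i) (hne i)
    have h1 : gaussNorm p r x ≤
        max (gaussNorm p r x / 2) ((Finset.range N).sup (gaussTerm p r x)) := by
      refine ciSup_le fun i => ?_
      rcases le_or_gt N i with h | h
      · exact le_max_of_le_left (hN i h).le
      · exact le_max_of_le_right (Finset.le_sup (Finset.mem_range.mpr h))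
    refine absurd h1 (not_le.mpr (max_lt (half_lt_self_iff.mpr (pos_iff_ne_zero.mpr h0)) ?_))
    exact (Finset.sup_lt_iff (pos_iff_ne_zero.mpr h0)).mpr fun i _ => hlt i
  have hmin : ∀ k < Nat.find hex, gaussTerm p r x k < gaussNorm p r x := fun k hk =>
    lt_of_le_of_ne (gaussTerm_le_gaussNorm p hx k) (Nat.find_min hex hk)
  refine ⟨Nat.find hex, ?_, Nat.find_spec hex, hmin⟩
  have hi := Nat.find_spec hex
  generalize Nat.find hex = i at hi hmin
  obtain ⟨k, hk, hkn⟩ := Finset.exists_mem_eq_sup (Finset.range (i + 1)) (by simp)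
    (fun k => pfNorm p (teichCoord p x k))
  change partialNorm p i x = _ at hkn
  rw [Finset.mem_range] at hk
  rcases (Nat.lt_succ_iff.mp hk).lt_or_eq with hlt | rfl
  · -- otherwise the term at `k < i` would be larger than the one at `i`
    refine absurd (hmin k hlt) (not_lt.mpr ?_)
    rw [← hi, gaussTerm, gaussTerm, hkn]
    exact mul_le_mul' (pow_le_pow_of_le_one zero_le (inv_p_lt_one p).le hlt.le)
      (NNReal.rpow_le_rpow (le_partialNorm p x le_rfl) r.2)
  · rw [← hi, gaussTerm, hkn]

/-- The Gauss norm is multiplicative: the product of the Teichmüller terms of `x` and `y` at the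
first indices where the Gauss norms are attained is not cancelled by the other contributions to the
terms of `x * y` up to the sum of these indices. -/
theorem gaussNorm_mul {r : ℝ≥0} (hr : 0 < r) {x y : WittVector p (PerfectClosure E p)}
    (hx : x ∈ wittSubring p r) (hy : y ∈ wittSubring p r) :
    gaussNorm p r (x * y) = gaussNorm p r x * gaussNorm p r y := by
  refine le_antisymm (gaussNorm_mul_le p hx hy) ?_
  by_cases hx0 : gaussNorm p r x = 0
  · rw [hx0, zero_mul]; exact zero_le
  by_cases hy0 : gaussNorm p r y = 0
  · rw [hy0, mul_zero]; exact zero_le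
  obtain ⟨i, hi, -, hi'⟩ := exists_first_index p hx hx0
  obtain ⟨j, hj, -, hj'⟩ := exists_first_index p hy hy0
  have hr' : (0 : ℝ) < r := by exact_mod_cast hr
  set a := teichCoord p x i
  set b := teichCoord p y j
  set c := pfNorm p a * pfNorm p b
  have hc : (p : ℝ≥0)⁻¹ ^ (i + j) * c ^ (r : ℝ) = gaussNorm p r x * gaussNorm p r y := by
    rw [← hi, ← hj, NNReal.mul_rpow, pow_add]; ring
  -- all contributions other than that of the leading pair `(i, j)` are smaller
  have key : ∀ k l, k + l ≤ i + j → (k < i ∨ l < j) →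
      pfNorm p (teichCoord p x k) * pfNorm p (teichCoord p y l) < c := by
    intro k l hkl h
    have tx : (p : ℝ≥0)⁻¹ ^ k * pfNorm p (teichCoord p x k) ^ (r : ℝ) ≤ gaussTerm p r x k :=
      mul_le_mul_right (NNReal.rpow_le_rpow (le_partialNorm p x le_rfl) r.2) _
    have ty : (p : ℝ≥0)⁻¹ ^ l * pfNorm p (teichCoord p y l) ^ (r : ℝ) ≤ gaussTerm p r y l :=
      mul_le_mul_right (NNReal.rpow_le_rpow (le_partialNorm p y le_rfl) r.2) _
    have h1 : gaussTerm p r x k * gaussTerm p r y l < gaussNorm p r x * gaussNorm p r y := by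
      rcases h with h | h
      · exact (mul_le_mul_right (gaussTerm_le_gaussNorm p hy l) _).trans_lt
          (mul_lt_mul_of_pos_right (hi' k h) (pos_iff_ne_zero.mpr hy0))
      · exact (mul_le_mul_left (gaussTerm_le_gaussNorm p hx k) _).trans_lt
          (mul_lt_mul_of_pos_left (hj' l h) (pos_iff_ne_zero.mpr hx0))
    have h2 := (mul_le_mul' tx ty).trans_lt h1
    rw [← hc, mul_mul_mul_comm, ← NNReal.mul_rpow, ← pow_add] at h2
    have h3 : (p : ℝ≥0)⁻¹ ^ (i + j) ≤ (p : ℝ≥0)⁻¹ ^ (k + l) :=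
      pow_le_pow_of_le_one zero_le (inv_p_lt_one p).le hkl
    have h4 := lt_of_mul_lt_mul_left ((mul_le_mul_left h3 _).trans_lt h2) zero_le
    exact (NNReal.rpow_lt_rpow_iff hr').mp h4
  obtain ⟨X, hX⟩ : ∃ X, X = x.select fun k => k ≠ i := ⟨_, rfl⟩
  obtain ⟨Y, hY⟩ : ∃ Y, Y = y.select fun k => k ≠ j := ⟨_, rfl⟩
  have cpos : 0 < c := by
    refine pos_iff_ne_zero.mpr fun h => mul_ne_zero hx0 hy0 ?_
    rw [← hc, h, NNReal.zero_rpow hr'.ne', mul_zero]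
  have main : c ≤ partialNorm p (i + j) (WittVector.teichmuller p (a * b) *
      (p : WittVector p (PerfectClosure E p)) ^ (i + j)) := by
    have h := le_partialNorm p (WittVector.teichmuller p (a * b) *
      (p : WittVector p (PerfectClosure E p)) ^ (i + j)) (le_refl (i + j))
    rwa [teichCoord_of_coeff p (WittVector.teichmuller_mul_pow_coeff (i + j) (a * b)),
      pfNorm_mul] at h
  have e : WittVector.teichmuller p (a * b) * (p : WittVector p (PerfectClosure E p)) ^ (i + j) =
      x * y + (-(X * y) +
        -(WittVector.teichmuller p a * (p : WittVector p (PerfectClosure E p)) ^ i * Y)) := by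
    have ex : x = WittVector.teichmuller p a * (p : WittVector p (PerfectClosure E p)) ^ i + X :=
      hX ▸ eq_teichmuller_mul_pow_add p x i
    have ey : y = WittVector.teichmuller p b * (p : WittVector p (PerfectClosure E p)) ^ j + Y :=
      hY ▸ eq_teichmuller_mul_pow_add p y j
    rw [map_mul, pow_add]
    linear_combination (-y) * ex -
      (WittVector.teichmuller p a * (p : WittVector p (PerfectClosure E p)) ^ i) * ey
  have s1 : partialNorm p (i + j) (X * y) < c := by
    refine partialNorm_mul_lt_of p X y _ fun k l hkl => ?_
    rw [hX]
    refine (mul_le_mul_left (pfNorm_teichCoord_select_ne_le p x i k) _).trans_lt ?_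
    split_ifs with h
    · rwa [zero_mul]
    · exact key k l hkl (by omega)
  have s2 : partialNorm p (i + j) (WittVector.teichmuller p a *
      (p : WittVector p (PerfectClosure E p)) ^ i * Y) < c := by
    refine partialNorm_mul_lt_of p _ Y _ fun k l hkl => ?_
    by_cases hk : k = i
    · subst hk
      rw [teichCoord_of_coeff p (WittVector.teichmuller_mul_pow_coeff k a)]
      rw [hY]
      refine (mul_le_mul_right (pfNorm_teichCoord_select_ne_le p y j l) _).trans_lt ?_
      split_ifs with h
      · rwa [mul_zero]
      · exact key k l hkl (by omega)
    · rw [teichCoord, WittVector.teichmuller_mul_pow_coeff_of_ne a hk, map_zero, pfNorm_zero,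
        zero_mul]
      exact cpos
  rw [e] at main
  have h5 : c ≤ partialNorm p (i + j) (x * y) := by
    by_contra! h
    refine absurd main (not_le.mpr ?_)
    exact (partialNorm_add_le p _ _ _).trans_lt (max_lt h ((partialNorm_add_le p _ _ _).trans_lt
      (max_lt ((partialNorm_neg_le p _ _).trans_lt s1)
        ((partialNorm_neg_le p _ _).trans_lt s2))))
  rw [← hc]
  exact (mul_le_mul_right (NNReal.rpow_le_rpow h5 r.2) _).trans
    (gaussTerm_le_gaussNorm p (mul_mem hx hy) (i + j))

end WittNorm

end Overconvergent

/-! ### Near units -/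

namespace Overconvergent
namespace FrobeniusCohenRing

variable {p : ℕ} [hp : Fact p.Prime] {E : Type*} [NormedField E] [CharP E p]
  {Γ : Type*} [CommRing Γ] (D : FrobeniusCohenRing p E Γ)

theorem gaussTerm_embed_zero (t : ℝ≥0) (x : Γ) :
    gaussTerm p t (D.embed x) 0 = ‖D.residue x‖₊ ^ (t : ℝ) := by
  rw [gaussTerm_zero_right, embed_coeff_zero, pfNorm_of]

theorem isUnit_of_residue_ne_zero {p : ℕ} {E : Type*} [Field E] {Γ : Type*} [CommRing Γ]
    (D : FrobeniusCohenRing p E Γ) {x : Γ} (hx : D.residue x ≠ 0) : IsUnit x := by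
  have := D.isDomain
  have := D.isDiscreteValuationRing
  have hmax := RingHom.ker_isMaximal_of_surjective D.residue D.residue_surjective
  rw [← IsLocalRing.notMem_maximalIdeal, ← IsLocalRing.eq_maximalIdeal hmax]
  exact hx

/-- The set of those lifts `x` of nonzero elements of `E` all of whose terms
`p ^ (-(r₀ v^{≤ n}(x) + n))` are bounded by the term for `n = 0`. These are the semiunits that serve
as digits. -/
def nearUnits (r₀ : ℝ≥0) : Set Γ :=
  {x | D.residue x ≠ 0 ∧ ∀ n, gaussTerm p r₀ (D.embed x) n ≤ ‖D.residue x‖₊ ^ (r₀ : ℝ)}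

variable {D} {r₀ : ℝ≥0}

section
variable [IsUltrametricDist E]

theorem one_mem_nearUnits : (1 : Γ) ∈ D.nearUnits r₀ := by
  refine ⟨by simp, fun n => ?_⟩
  rw [map_one, map_one, nnnorm_one, NNReal.one_rpow]
  exact (gaussTerm_le_gaussNorm p (one_mem _) n).trans (gaussNorm_one p r₀).le

theorem neg_mem_nearUnits {x : Γ} (hx : x ∈ D.nearUnits r₀) : -x ∈ D.nearUnits r₀ := by
  refine ⟨by simpa using hx.1, fun n => ?_⟩
  rw [map_neg, map_neg, gaussTerm_neg, nnnorm_neg]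
  exact hx.2 n

theorem mul_mem_nearUnits {x y : Γ} (hx : x ∈ D.nearUnits r₀) (hy : y ∈ D.nearUnits r₀) :
    x * y ∈ D.nearUnits r₀ := by
  refine ⟨by simpa using ⟨hx.1, hy.1⟩, fun n => ?_⟩
  rw [map_mul, map_mul, nnnorm_mul, NNReal.mul_rpow]
  obtain ⟨i, j, k, -, h⟩ := exists_gaussTerm_mul_le p r₀ (D.embed x) (D.embed y) n
  exact (h.trans (mul_le_of_le_one_left zero_le (pow_le_one₀ zero_le (inv_p_lt_one p).le))).trans
    (mul_le_mul' (hx.2 i) (hy.2 j))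

theorem add_mem_nearUnits {x y : Γ} (hx : x ∈ D.nearUnits r₀) (hy : y ∈ D.nearUnits r₀)
    (h : ‖D.residue y‖₊ < ‖D.residue x‖₊) :
    x + y ∈ D.nearUnits r₀ ∧ ‖D.residue (x + y)‖₊ = ‖D.residue x‖₊ := by
  have h1 : ‖D.residue (x + y)‖₊ = ‖D.residue x‖₊ := by
    rw [map_add, ← NNReal.coe_inj, coe_nnnorm, coe_nnnorm]
    have h' : ‖D.residue y‖ < ‖D.residue x‖ := h
    rw [IsUltrametricDist.norm_add_eq_max_of_norm_ne_norm h'.ne', max_eq_left h'.le]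
  refine ⟨⟨fun h0 => ?_, fun n => ?_⟩, h1⟩
  · rw [h0, nnnorm_zero] at h1
    exact hx.1 (nnnorm_eq_zero.mp h1.symm)
  · rw [h1, map_add]
    exact (gaussTerm_add_le p _ _ _ _).trans (max_le (hx.2 n) ((hy.2 n).trans
      (NNReal.rpow_le_rpow h.le r₀.2)))

/-- The inverse of a near unit `x` is a near unit: with `x = [x₀] + Z`, the identity
`[x₀] y = 1 - Z y` bounds the terms of `y` by induction. -/
theorem exists_inv_mem_nearUnits (hr₀ : 0 < r₀) {x : Γ} (hx : x ∈ D.nearUnits r₀) :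
    ∃ y ∈ D.nearUnits r₀, x * y = 1 := by
  obtain ⟨y, hxy⟩ := (D.isUnit_of_residue_ne_zero hx.1).exists_right_inv
  have hres : D.residue x * D.residue y = 1 := by rw [← map_mul, hxy, map_one]
  refine ⟨y, ⟨right_ne_zero_of_mul_eq_one hres, ?_⟩, hxy⟩
  have hr : (0 : ℝ) < r₀ := by exact_mod_cast hr₀
  set X := D.embed x
  set Y := D.embed y
  set c := ‖D.residue x‖₊ ^ (r₀ : ℝ)
  have hcc : c * ‖D.residue y‖₊ ^ (r₀ : ℝ) = 1 := by
    rw [← NNReal.mul_rpow, ← nnnorm_mul, hres, nnnorm_one, NNReal.one_rpow]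
  have hc : c ≠ 0 := left_ne_zero_of_mul_eq_one hcc
  have hP : ∀ n, 0 < (p : ℝ≥0)⁻¹ ^ n := fun n => pow_pos (inv_p_pos p) n
  have hXY : X * Y = 1 := by rw [← map_mul, hxy, map_one]
  obtain ⟨Z, hZ⟩ : ∃ Z, Z = X.select fun k => k ≠ 0 := ⟨_, rfl⟩
  have eX : X = WittVector.teichmuller p (teichCoord p X 0) + Z := by
    have := eq_teichmuller_mul_pow_add p X 0
    rwa [pow_zero, mul_one, ← hZ] at this
  have hX0 : pfNorm p (teichCoord p X 0) ^ (r₀ : ℝ) = c := by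
    have h := D.gaussTerm_embed_zero r₀ x
    simpa [gaussTerm, partialNorm] using h
  intro n
  rw [← mul_le_mul_iff_right₀ (pos_iff_ne_zero.mpr hc), hcc]
  induction n using Nat.strong_induction_on with
  | _ n ih =>
  have e1 : WittVector.teichmuller p (teichCoord p X 0) * Y = 1 + -(Z * Y) := by
    linear_combination hXY - Y * eX
  have h1 : partialNorm p n (Z * Y) ^ (r₀ : ℝ) ≤ ((p : ℝ≥0)⁻¹ ^ n)⁻¹ := by
    rw [← NNReal.le_rpow_inv_iff hr]
    refine partialNorm_mul_le_of p Z Y n fun i j hij => ?_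
    rw [NNReal.le_rpow_inv_iff hr, NNReal.mul_rpow]
    refine (mul_le_mul_left (NNReal.rpow_le_rpow (z := r₀)
      (hZ ▸ pfNorm_teichCoord_select_ne_le p X 0 i) hr.le) _).trans ?_
    split_ifs with hi
    · rw [NNReal.zero_rpow hr.ne', zero_mul]; exact zero_le
    · have hx1 : (p : ℝ≥0)⁻¹ ^ i * pfNorm p (teichCoord p X i) ^ (r₀ : ℝ) ≤ c :=
        (mul_le_mul_right (NNReal.rpow_le_rpow (le_partialNorm p X le_rfl) hr.le) _).trans
          (hx.2 i)
      have hy1 : c * ((p : ℝ≥0)⁻¹ ^ j * pfNorm p (teichCoord p Y j) ^ (r₀ : ℝ)) ≤ 1 :=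
        (mul_le_mul_right (mul_le_mul_right (NNReal.rpow_le_rpow
          (le_partialNorm p Y le_rfl) hr.le) _) _).trans (ih j (by omega))
      rw [← one_div, le_div_iff₀ (hP n)]
      have h2 := mul_le_mul' hx1 hy1
      rw [mul_one, mul_left_comm] at h2
      have h3 := le_of_mul_le_mul_left (h2.trans (mul_one c).ge) (pos_iff_ne_zero.mpr hc)
      refine le_trans ?_ h3
      rw [mul_mul_mul_comm, ← pow_add, mul_comm]
      exact mul_le_mul_left (pow_le_pow_of_le_one zero_le (inv_p_lt_one p).le hij) _
  have h2 : partialNorm p n (1 : WittVector p (PerfectClosure E p)) ^ (r₀ : ℝ) ≤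
      ((p : ℝ≥0)⁻¹ ^ n)⁻¹ := by
    have h := (gaussTerm_le_gaussNorm p (one_mem (wittSubring p (E := E) r₀)) n).trans
      (gaussNorm_one p r₀).le
    rwa [gaussTerm, mul_comm, ← le_div_iff₀ (hP n), one_div] at h
  have h3 : (pfNorm p (teichCoord p X 0) * partialNorm p n Y) ^ (r₀ : ℝ) ≤
      ((p : ℝ≥0)⁻¹ ^ n)⁻¹ := by
    rw [← partialNorm_teichmuller_mul, e1, ← NNReal.le_rpow_inv_iff hr]
    refine (partialNorm_add_le p n _ _).trans (max_le ?_ ((partialNorm_neg_le p n _).trans ?_))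
    · rwa [NNReal.le_rpow_inv_iff hr]
    · rwa [NNReal.le_rpow_inv_iff hr]
  rw [NNReal.mul_rpow, hX0, ← one_div, le_div_iff₀ (hP n)] at h3
  rw [gaussTerm]
  exact (by ring : c * ((p : ℝ≥0)⁻¹ ^ n * partialNorm p n Y ^ (r₀ : ℝ)) = _).trans_le h3

/-- A unit of `Γ_{r₀}` is bounded by its residue, since the Gauss norm is multiplicative. -/
theorem unit_mem_nearUnits (hr₀ : 0 < r₀) (u : (D.overconvergent r₀)ˣ) :
    ((u : D.overconvergent r₀) : Γ) ∈ D.nearUnits r₀ := by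
  obtain ⟨x, hx⟩ : ∃ x : Γ, x = (u : D.overconvergent r₀) := ⟨_, rfl⟩
  obtain ⟨y, hy⟩ : ∃ y : Γ, y = (u⁻¹ : (D.overconvergent r₀)ˣ) := ⟨_, rfl⟩
  have hxm : D.embed x ∈ wittSubring p r₀ := hx ▸ (u : D.overconvergent r₀).2
  have hym : D.embed y ∈ wittSubring p r₀ := hy ▸ (u⁻¹ : (D.overconvergent r₀)ˣ).val.2
  have hxy : x * y = 1 := by
    rw [hx, hy]
    exact congrArg Subtype.val u.mul_inv
  rw [← hx]
  have hres : D.residue x * D.residue y = 1 := by rw [← map_mul, hxy, map_one]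
  refine ⟨left_ne_zero_of_mul_eq_one hres, fun n => ?_⟩
  have h1 := gaussNorm_mul p hr₀ hxm hym
  rw [← map_mul, hxy, map_one, gaussNorm_one] at h1
  have hx1 := gaussTerm_le_gaussNorm p hxm 0
  have hy1 := gaussTerm_le_gaussNorm p hym 0
  rw [gaussTerm_embed_zero] at hx1 hy1
  have h2 : ‖D.residue x‖₊ ^ (r₀ : ℝ) * ‖D.residue y‖₊ ^ (r₀ : ℝ) = 1 := by
    rw [← NNReal.mul_rpow, ← nnnorm_mul, hres, nnnorm_one, NNReal.one_rpow]
  refine (gaussTerm_le_gaussNorm p hxm n).trans ?_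
  have hpos : 0 < gaussNorm p r₀ (D.embed y) :=
    pos_iff_ne_zero.mpr (right_ne_zero_of_mul_eq_one h1.symm)
  refine le_of_mul_le_mul_right ?_ hpos
  rw [← h1, ← h2]
  exact mul_le_mul_right hy1 _

theorem exists_nearUnit (hr₀ : 0 < r₀) (h₀ : D.HasEnoughUnits r₀) {e : E} (he : e ≠ 0) :
    ∃ x ∈ D.nearUnits r₀, D.residue x = e := by
  obtain ⟨u, hu⟩ := h₀ e he
  exact ⟨_, unit_mem_nearUnits hr₀ u, hu⟩

end

/-- The rate at which the terms of a near unit decay at radii at most `r`. -/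
noncomputable def decay (p : ℕ) (r r₀ : ℝ≥0) : ℝ≥0 := (p : ℝ≥0)⁻¹ ^ (1 - (r : ℝ) / r₀)

theorem decay_pos (r r₀ : ℝ≥0) : 0 < decay p r r₀ := NNReal.rpow_pos (inv_p_pos p)

theorem decay_lt_one {r r₀ : ℝ≥0} (h : r < r₀) : decay p r r₀ < 1 := by
  refine NNReal.rpow_lt_one (inv_p_lt_one p) ?_
  have h0 : (0 : ℝ) < r₀ := by exact_mod_cast zero_le.trans_lt h
  rw [sub_pos, div_lt_one h0]
  exact_mod_cast h

/-- At radii smaller than `r₀` the terms of a near unit decay geometrically, by interpolation with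
radius zero. -/
theorem gaussTerm_le_of_mem_nearUnits {r t : ℝ≥0} (ht : t ≤ r) (h : r < r₀) {x : Γ}
    (hx : x ∈ D.nearUnits r₀) (n : ℕ) :
    gaussTerm p t (D.embed x) n ≤ decay p r r₀ ^ n * ‖D.residue x‖₊ ^ (t : ℝ) := by
  have h0 : (0 : ℝ) < r₀ := by exact_mod_cast zero_le.trans_lt h
  have hP : 0 < (p : ℝ≥0)⁻¹ := inv_p_pos p
  have e : ∀ y : ℝ≥0, (y ^ (r₀ : ℝ)) ^ ((t : ℝ) / r₀) = y ^ (t : ℝ) := fun y => by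
    rw [← NNReal.rpow_mul, mul_div_cancel₀ _ h0.ne']
  have h1 := NNReal.rpow_le_rpow (z := (t : ℝ) / r₀) (hx.2 n) (by positivity)
  rw [gaussTerm, NNReal.mul_rpow, e, e] at h1
  have h2 : (p : ℝ≥0)⁻¹ ^ n = ((p : ℝ≥0)⁻¹ ^ n) ^ (1 - (t : ℝ) / r₀) *
      ((p : ℝ≥0)⁻¹ ^ n) ^ ((t : ℝ) / r₀) := by
    rw [← NNReal.rpow_add (pow_pos hP n).ne', sub_add_cancel, NNReal.rpow_one]
  rw [gaussTerm, h2, mul_assoc]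
  refine mul_le_mul' ?_ h1
  rw [decay, ← NNReal.rpow_mul_natCast, mul_comm, NNReal.rpow_natCast_mul]
  refine NNReal.rpow_le_rpow_of_exponent_ge (pow_pos hP n)
    (pow_le_one₀ zero_le (inv_p_lt_one p).le) ?_
  gcongr

variable [IsUltrametricDist E]

theorem mem_overconvergent_of_mem_nearUnits {r : ℝ≥0} (h : r < r₀) {x : Γ}
    (hx : x ∈ D.nearUnits r₀) : x ∈ D.overconvergent r := by
  have h1 : Tendsto (fun n => decay p r r₀ ^ n * ‖D.residue x‖₊ ^ (r : ℝ)) atTop (𝓝 0) := by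
    simpa using (NNReal.tendsto_pow_atTop_nhds_zero_of_lt_one (decay_lt_one h)).mul_const
      (‖D.residue x‖₊ ^ (r : ℝ))
  exact tendsto_of_tendsto_of_tendsto_of_le_of_le tendsto_const_nhds h1 (fun _ => zero_le)
    fun n => gaussTerm_le_of_mem_nearUnits le_rfl h hx n

theorem embed_mem {r t : ℝ≥0} (ht : 0 < t) (htr : t ≤ r) {x : Γ} (hx : x ∈ D.overconvergent r) :
    D.embed x ∈ wittSubring p t := wittSubring_anti p ht htr hx

theorem norm_residue_le {r t : ℝ≥0} (ht : 0 < t) (htr : t ≤ r) {x : Γ}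
    (hx : x ∈ D.overconvergent r) :
    ‖D.residue x‖₊ ^ (t : ℝ) ≤ gaussNorm p t (D.embed x) := by
  rw [← gaussTerm_embed_zero]
  exact gaussTerm_le_gaussNorm p (embed_mem ht htr hx) 0

theorem gaussNorm_of_mem_nearUnits {r t : ℝ≥0} (ht : 0 < t) (htr : t ≤ r) (h : r < r₀) {x : Γ}
    (hx : x ∈ D.nearUnits r₀) : gaussNorm p t (D.embed x) = ‖D.residue x‖₊ ^ (t : ℝ) := by
  refine le_antisymm (ciSup_le fun n => ?_)
    (norm_residue_le ht htr (mem_overconvergent_of_mem_nearUnits h hx))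
  exact (gaussTerm_le_of_mem_nearUnits htr h hx n).trans
    (mul_le_of_le_one_left zero_le (pow_le_one₀ zero_le (decay_lt_one h).le))

/-- Up to an error smaller by a factor `decay p r r₀`, a sum of near units is a near unit
or zero. -/
theorem exists_add_nearUnits (h₀ : D.HasEnoughUnits r₀) {r : ℝ≥0} (h : r < r₀) {x y : Γ}
    (hx : x = 0 ∨ x ∈ D.nearUnits r₀) (hy : y = 0 ∨ y ∈ D.nearUnits r₀) :
    ∃ z, (z = 0 ∨ z ∈ D.nearUnits r₀) ∧ ∀ t, 0 < t → t ≤ r →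
      gaussNorm p t (D.embed z) ≤ max (gaussNorm p t (D.embed x)) (gaussNorm p t (D.embed y)) ∧
      gaussNorm p t (D.embed (x + y - z)) ≤ decay p r r₀ * gaussNorm p t (D.embed y) := by
  have triv : ∀ z, z = x + y → ∀ t, 0 < t → t ≤ r →
      gaussNorm p t (D.embed (x + y - z)) ≤ decay p r r₀ * gaussNorm p t (D.embed y) := by
    rintro _ rfl t ht -
    rw [sub_self, map_zero, gaussNorm_zero p ht]
    exact zero_le
  rcases hx with rfl | hx
  · exact ⟨y, hy, fun t ht htr => ⟨le_max_right _ _, triv y (zero_add y).symm t ht htr⟩⟩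
  rcases hy with rfl | hy
  · exact ⟨x, .inr hx, fun t ht htr => ⟨le_max_left _ _, triv x (add_zero x).symm t ht htr⟩⟩
  have N : ∀ {z}, z ∈ D.nearUnits r₀ → ∀ {t}, 0 < t → t ≤ r →
      gaussNorm p t (D.embed z) = ‖D.residue z‖₊ ^ (t : ℝ) := fun hz _ ht htr =>
    gaussNorm_of_mem_nearUnits ht htr h hz
  rcases lt_trichotomy ‖D.residue y‖₊ ‖D.residue x‖₊ with hlt | heq | hlt
  · obtain ⟨hz, hzn⟩ := add_mem_nearUnits hx hy hlt
    refine ⟨x + y, .inr hz, fun t ht htr => ⟨?_, triv _ rfl t ht htr⟩⟩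
    rw [N hz ht htr, hzn, N hx ht htr]
    exact le_max_left _ _
  · have hle : ‖D.residue (x + y)‖₊ ≤ ‖D.residue y‖₊ := by
      rw [map_add]
      exact (IsUltrametricDist.nnnorm_add_le_max _ _).trans (max_le heq.ge le_rfl)
    obtain ⟨z, hz, hzr⟩ : ∃ z, (z = 0 ∨ z ∈ D.nearUnits r₀) ∧ D.residue z = D.residue (x + y) := by
      by_cases h1 : D.residue (x + y) = 0
      · exact ⟨0, .inl rfl, by rw [h1, map_zero]⟩
      · obtain ⟨z, hz, hzr⟩ := exists_nearUnit (zero_le.trans_lt h) h₀ h1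
        exact ⟨z, .inr hz, hzr⟩
    have hzt : ∀ t, 0 < t → t ≤ r → ∀ n, gaussTerm p t (D.embed z) n ≤
        decay p r r₀ ^ n * ‖D.residue y‖₊ ^ (t : ℝ) := by
      intro t ht htr n
      rcases hz with rfl | hz
      · rw [map_zero]
        refine (gaussTerm_le_gaussNorm p (zero_mem _) n).trans ?_
        rw [gaussNorm_zero p ht]; exact zero_le
      · refine (gaussTerm_le_of_mem_nearUnits htr h hz n).trans ?_
        rw [hzr]
        exact mul_le_mul_right (NNReal.rpow_le_rpow hle t.2) _
    refine ⟨z, hz, fun t ht htr => ⟨le_max_of_le_right (ciSup_le fun n => ?_),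
      ciSup_le fun n => ?_⟩⟩
    · rw [N hy ht htr]
      exact (hzt t ht htr n).trans (mul_le_of_le_one_left zero_le
        (pow_le_one₀ zero_le (decay_lt_one h).le))
    · rw [N hy ht htr]
      cases n with
      | zero =>
        rw [gaussTerm_embed_zero, map_sub, hzr, sub_self, nnnorm_zero,
          NNReal.zero_rpow (by exact_mod_cast ht.ne')]
        exact zero_le
      | succ n =>
        refine le_trans (b := decay p r r₀ ^ (n + 1) * ‖D.residue y‖₊ ^ (t : ℝ)) ?_
          (mul_le_mul_left (pow_le_of_le_one zero_le (decay_lt_one h).le n.succ_ne_zero) _)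
        rw [sub_eq_add_neg, map_add, map_add, map_neg]
        refine (gaussTerm_add_le p _ _ _ _).trans (max_le
          ((gaussTerm_add_le p _ _ _ _).trans (max_le ?_ ?_)) ?_)
        · exact heq ▸ gaussTerm_le_of_mem_nearUnits htr h hx _
        · exact gaussTerm_le_of_mem_nearUnits htr h hy _
        · rw [gaussTerm_neg]; exact hzt t ht htr _
  · obtain ⟨hz, hzn⟩ := add_mem_nearUnits hy hx hlt
    refine ⟨x + y, .inr (add_comm x y ▸ hz), fun t ht htr => ⟨?_, triv _ rfl t ht htr⟩⟩
    rw [add_comm, N hz ht htr, hzn, N hy ht htr]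
    exact le_max_right _ _

theorem gaussNorm_le_add_p_mul {r t : ℝ≥0} (ht : 0 < t) (htr : t ≤ r) (h : r < r₀) {x y : Γ}
    (hx : x ∈ D.nearUnits r₀) (hy : y ∈ D.overconvergent r) :
    gaussNorm p t (D.embed x) ≤ gaussNorm p t (D.embed (x + p * y)) := by
  have h1 : D.residue (x + p * y) = D.residue x := by
    have : D.residue (p : Γ) = 0 := by
      rw [← RingHom.mem_ker, D.ker_residue]; exact Ideal.mem_span_singleton_self _
    rw [map_add, map_mul, this, zero_mul, add_zero]
  rw [gaussNorm_of_mem_nearUnits ht htr h hx, ← h1]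
  exact norm_residue_le ht htr (add_mem (mem_overconvergent_of_mem_nearUnits h hx)
    (mul_mem (natCast_mem _ p) hy))

end FrobeniusCohenRing
end Overconvergent

/-! ### Digit expansions -/

namespace Overconvergent
namespace FrobeniusCohenRing

variable {p : ℕ} [hp : Fact p.Prime] {E : Type*} [NormedField E] [CharP E p]
  {Γ : Type*} [CommRing Γ] {D : FrobeniusCohenRing p E Γ} {r₀ : ℝ≥0}

theorem mul_gaussNorm_le {r c B : ℝ≥0} {x : WittVector p (PerfectClosure E p)}
    (h : ∀ n, c * gaussTerm p r x n ≤ B) : c * gaussNorm p r x ≤ B := by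
  rw [gaussNorm, NNReal.mul_iSup]
  exact ciSup_le h

theorem gaussTerm_embed_p_mul_succ (t : ℝ≥0) (x : Γ) (n : ℕ) :
    gaussTerm p t (D.embed (p * x)) (n + 1) = (p : ℝ≥0)⁻¹ * gaussTerm p t (D.embed x) n := by
  rw [map_mul, map_natCast, gaussTerm_p_mul_succ]

variable [IsUltrametricDist E]

theorem gaussNorm_embed_p_mul {r t : ℝ≥0} (ht : 0 < t) (htr : t ≤ r) {x : Γ}
    (hx : x ∈ D.overconvergent r) :
    gaussNorm p t (D.embed (p * x)) = (p : ℝ≥0)⁻¹ * gaussNorm p t (D.embed x) := by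
  rw [map_mul, map_natCast, gaussNorm_p_mul p ht (embed_mem ht htr hx)]

theorem mem_overconvergent_of_p_mul {r : ℝ≥0} {x : Γ}
    (hx : (p : Γ) * x ∈ D.overconvergent r) : x ∈ D.overconvergent r := by
  have h1 : Tendsto (gaussTerm p r (D.embed (p * x))) atTop (𝓝 0) := hx
  have h2 := ((tendsto_add_atTop_iff_nat 1).mpr h1).const_mul (p : ℝ≥0)
  have hp0 : (p : ℝ≥0) ≠ 0 := by exact_mod_cast hp.out.ne_zero
  simp only [gaussTerm_embed_p_mul_succ, mul_inv_cancel_left₀ hp0, mul_zero] at h2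
  exact h2

/-- The first digit of an element of `Γ_r`. -/
theorem exists_digit (h₀ : D.HasEnoughUnits r₀) {r : ℝ≥0} (h : r < r₀) {y : Γ}
    (hy : y ∈ D.overconvergent r) : ∃ u z : Γ, (u = 0 ∨ u ∈ D.nearUnits r₀) ∧
      z ∈ D.overconvergent r ∧ y = u + p * z ∧ D.residue u = D.residue y := by
  obtain ⟨u, hu, hur⟩ : ∃ u, (u = 0 ∨ u ∈ D.nearUnits r₀) ∧ D.residue u = D.residue y := by
    by_cases h1 : D.residue y = 0
    · exact ⟨0, .inl rfl, by rw [h1, map_zero]⟩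
    · obtain ⟨u, hu, hur⟩ := exists_nearUnit (zero_le.trans_lt h) h₀ h1
      exact ⟨u, .inr hu, hur⟩
  have hker : y - u ∈ RingHom.ker D.residue := by rw [RingHom.mem_ker, map_sub, hur, sub_self]
  rw [D.ker_residue, Ideal.mem_span_singleton] at hker
  obtain ⟨z, hz⟩ := hker
  have hum : u ∈ D.overconvergent r := by
    rcases hu with rfl | hu
    · exact zero_mem _
    · exact mem_overconvergent_of_mem_nearUnits h hu
  exact ⟨u, z, hu, mem_overconvergent_of_p_mul (hz ▸ sub_mem hy hum), by rw [← hz]; ring, hur⟩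

theorem gaussTerm_digit_le {r t : ℝ≥0} (ht : 0 < t) (htr : t ≤ r) (h : r < r₀) {u y : Γ}
    (hu : u = 0 ∨ u ∈ D.nearUnits r₀) (hy : y ∈ D.overconvergent r)
    (hur : D.residue u = D.residue y) (n : ℕ) :
    gaussTerm p t (D.embed u) n ≤ decay p r r₀ ^ n * gaussNorm p t (D.embed y) := by
  rcases hu with rfl | hu
  · rw [map_zero]
    refine (gaussTerm_le_gaussNorm p (zero_mem _) n).trans ?_
    rw [gaussNorm_zero p ht]; exact zero_le
  · refine (gaussTerm_le_of_mem_nearUnits htr h hu n).trans ?_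
    rw [hur]
    exact mul_le_mul_right (norm_residue_le ht htr hy) _

theorem gaussNorm_digit_le {r t : ℝ≥0} (ht : 0 < t) (htr : t ≤ r) (h : r < r₀) {u y : Γ}
    (hu : u = 0 ∨ u ∈ D.nearUnits r₀) (hy : y ∈ D.overconvergent r)
    (hur : D.residue u = D.residue y) :
    gaussNorm p t (D.embed u) ≤ gaussNorm p t (D.embed y) :=
  ciSup_le fun n => (gaussTerm_digit_le ht htr h hu hy hur n).trans
    (mul_le_of_le_one_left zero_le (pow_le_one₀ zero_le (decay_lt_one h).le))

/-- Elements of `Γ_r` are approximated by finite sums of the form `∑ p ^ k u_k`, in which the `u_k`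
are near units or zero. Choosing digits that lift the successive residues, the sums converge
`p`-adically, and the point is that they also converge at radius `r`. -/
theorem exists_digit_expansion (h₀ : D.HasEnoughUnits r₀) {r : ℝ≥0} (hr : 0 < r) (h : r < r₀)
    {y : Γ} (hy : y ∈ D.overconvergent r) {ε : ℝ≥0} (hε : 0 < ε) :
    ∃ (K : ℕ) (u : ℕ → Γ), (∀ k, u k = 0 ∨ u k ∈ D.nearUnits r₀) ∧
      (∀ t, 0 < t → t ≤ r → ∀ k,
        (p : ℝ≥0)⁻¹ ^ k * gaussNorm p t (D.embed (u k)) ≤ gaussNorm p t (D.embed y)) ∧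
      gaussNorm p r (D.embed (y - ∑ k ∈ Finset.range K, (p : Γ) ^ k * u k)) ≤ ε := by
  choose digit shift hd hs hds hres using
    fun y : D.overconvergent r => exists_digit h₀ h y.2
  let next : D.overconvergent r → D.overconvergent r := fun y => ⟨shift y, hs y⟩
  let N : ℝ≥0 → D.overconvergent r → ℝ≥0 := fun t y => gaussNorm p t (D.embed y)
  have hsum : ∀ (y : D.overconvergent r) K, (y : Γ) =
      ∑ k ∈ Finset.range K, (p : Γ) ^ k * digit (next^[k] y) + (p : Γ) ^ K * next^[K] y := by
    intro y K
    induction K with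
    | zero => simp
    | succ K ih =>
      have e1 := hds (next^[K] y)
      have e2 : (next^[K + 1] y : Γ) = shift (next^[K] y) := by
        rw [Function.iterate_succ_apply']
      rw [Finset.sum_range_succ, e2, pow_succ]
      linear_combination ih + (p : Γ) ^ K * e1
  have hmax : ∀ t y n, 0 < t → t ≤ r → (p : ℝ≥0)⁻¹ * gaussTerm p t (D.embed (next y)) n ≤
      max (gaussTerm p t (D.embed y) (n + 1)) (decay p r r₀ ^ (n + 1) * N t y) := by
    intro t y n ht htr
    have e : (p : Γ) * next y = y + -digit y := by
      have := hds y
      change (p : Γ) * shift y = _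
      linear_combination -this
    rw [← gaussTerm_embed_p_mul_succ, e, map_add, map_neg]
    refine (gaussTerm_add_le p _ _ _ _).trans (max_le_max le_rfl ?_)
    rw [gaussTerm_neg]
    exact gaussTerm_digit_le ht htr h (hd y) y.2 (hres y) _
  have hstep : ∀ t y, 0 < t → t ≤ r → (p : ℝ≥0)⁻¹ * N t (next y) ≤ N t y := by
    intro t y ht htr
    refine mul_gaussNorm_le fun n => (hmax t y n ht htr).trans (max_le
      (gaussTerm_le_gaussNorm p (embed_mem ht htr y.2) _) (mul_le_of_le_one_left zero_le
        (pow_le_one₀ zero_le (decay_lt_one h).le)))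
  have hanti : ∀ t y k, 0 < t → t ≤ r → (p : ℝ≥0)⁻¹ ^ k * N t (next^[k] y) ≤ N t y := by
    intro t y k ht htr
    induction k with
    | zero => simp
    | succ k ih =>
      rw [Function.iterate_succ_apply', pow_succ, mul_assoc]
      exact (mul_le_mul_right (hstep t _ ht htr) _).trans ih
  -- all terms from the index `J` on are small, and the others disappear after `J` steps
  have hdrop : ∀ y, ∃ J, (p : ℝ≥0)⁻¹ ^ J * N r (next^[J] y) ≤ decay p r r₀ * N r y := by
    intro y
    obtain ⟨J, hJ⟩ : ∃ J, ∀ n, J ≤ n → gaussTerm p r (D.embed y) n ≤ decay p r r₀ * N r y := by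
      by_cases h0 : N r y = 0
      · refine ⟨0, fun n _ => ?_⟩
        rw [h0, mul_zero, ← h0]
        exact gaussTerm_le_gaussNorm p (embed_mem hr le_rfl y.2) n
      · have ht : Tendsto (gaussTerm p r (D.embed y)) atTop (𝓝 0) := y.2
        obtain ⟨J, hJ⟩ := eventually_atTop.mp (ht.eventually_le_const
          (mul_pos (decay_pos (p := p) r r₀) (pos_iff_ne_zero.mpr h0)))
        exact ⟨J, hJ⟩
    have hind : ∀ k n, J ≤ n + k →
        (p : ℝ≥0)⁻¹ ^ k * gaussTerm p r (D.embed (next^[k] y)) n ≤ decay p r r₀ * N r y := by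
      intro k
      induction k with
      | zero => intro n hn; simpa using hJ n hn
      | succ k ih =>
        intro n hn
        rw [Function.iterate_succ_apply', pow_succ, mul_assoc]
        refine (mul_le_mul_right (hmax r _ n hr le_rfl) _).trans ?_
        rw [mul_max_of_nonneg _ _ zero_le]
        refine max_le (ih (n + 1) (by omega)) ?_
        rw [mul_left_comm]
        exact mul_le_mul' (pow_le_of_le_one zero_le (decay_lt_one h).le n.succ_ne_zero)
          (hanti r y k hr le_rfl)
    exact ⟨J, mul_gaussNorm_le fun n => hind J n (by omega)⟩
  have hpow : ∀ M : ℕ, ∃ K, (p : ℝ≥0)⁻¹ ^ K * N r (next^[K] ⟨y, hy⟩) ≤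
      decay p r r₀ ^ M * N r ⟨y, hy⟩ := by
    intro M
    induction M with
    | zero => exact ⟨0, by simp⟩
    | succ M ih =>
      obtain ⟨K, hK⟩ := ih
      obtain ⟨J, hJ⟩ := hdrop (next^[K] ⟨y, hy⟩)
      refine ⟨J + K, ?_⟩
      rw [Function.iterate_add_apply, pow_add, mul_comm (_ ^ J), mul_assoc, pow_succ', mul_assoc]
      refine (mul_le_mul_right hJ _).trans ?_
      rw [mul_left_comm]
      exact mul_le_mul_right hK _
  have hlim : Tendsto (fun M => decay p r r₀ ^ M * N r ⟨y, hy⟩) atTop (𝓝 0) := by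
    simpa using (NNReal.tendsto_pow_atTop_nhds_zero_of_lt_one (decay_lt_one h)).mul_const
      (N r ⟨y, hy⟩)
  obtain ⟨M, hM⟩ := (hlim.eventually_le_const hε).exists
  obtain ⟨K, hK⟩ := hpow M
  refine ⟨K, fun k => digit (next^[k] ⟨y, hy⟩), fun k => hd _, fun t ht htr k => ?_, ?_⟩
  · refine le_trans (mul_le_mul_right ?_ _) (hanti t ⟨y, hy⟩ k ht htr)
    exact gaussNorm_digit_le ht htr h (hd _) (next^[k] ⟨y, hy⟩).2 (hres _)
  · have e : y - ∑ k ∈ Finset.range K, (p : Γ) ^ k * digit (next^[k] ⟨y, hy⟩) =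
        (p : Γ) ^ K * next^[K] ⟨y, hy⟩ := by
      have := hsum ⟨y, hy⟩ K
      exact sub_eq_of_eq_add' this
    have hpk : ∀ k (z : D.overconvergent r), gaussNorm p r (D.embed ((p : Γ) ^ k * z)) =
        (p : ℝ≥0)⁻¹ ^ k * N r z := by
      intro k z
      induction k with
      | zero => simp [N]
      | succ k ih =>
        rw [pow_succ', mul_assoc, gaussNorm_embed_p_mul hr le_rfl
          (mul_mem (pow_mem (natCast_mem _ p) k) z.2), ih, pow_succ', mul_assoc]
    rw [e, hpk]
    exact hK.trans hM

end FrobeniusCohenRing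
end Overconvergent

/-! ### Extending valuations to a completion -/

namespace Overconvergent

section CompletionValuation

open UniformSpace

variable {A : Type*} [CommRing A] [UniformSpace A]

theorem dist_valuation_le {A : Type*} [Ring A] (w : Valuation A ℝ≥0) (x y : A) :
    dist (w x) (w y) ≤ w (y - x) := by
  have h : ∀ a b : A, w a ≤ w b + w (a - b) := fun a b => by
    have := w.map_add b (a - b)
    rw [add_sub_cancel] at this
    exact this.trans (max_le_add_of_nonneg zero_le zero_le)
  have h1 : (w x : ℝ) ≤ w y + w (y - x) := by
    rw [Valuation.map_sub_swap]; exact_mod_cast h x y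
  have h2 : (w y : ℝ) ≤ w x + w (y - x) := by exact_mod_cast h y x
  rw [NNReal.dist_eq, abs_sub_le_iff]
  constructor <;> linarith

theorem uniformContinuous_valuation [IsUniformAddGroup A] {w : Valuation A ℝ≥0}
    (hw : Tendsto w (𝓝 0) (𝓝 0)) : UniformContinuous w := by
  rw [UniformContinuous, Metric.uniformity_eq_comap_nhds_zero, tendsto_comap_iff]
  have h1 : Tendsto (fun q : A × A => (w (q.2 - q.1) : ℝ)) (uniformity A) (𝓝 0) := by
    rw [uniformity_eq_comap_nhds_zero]
    exact (NNReal.tendsto_coe.mpr hw).comp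
      (tendsto_comap (f := fun q : A × A => q.2 - q.1) (x := 𝓝 0))
  exact squeeze_zero (fun _ => dist_nonneg) (fun q => dist_valuation_le w q.1 q.2) h1

variable [IsUniformAddGroup A] [IsTopologicalRing A]

/-- The extension by continuity of a continuous valuation to the completion. -/
noncomputable def completionValuation (w : Valuation A ℝ≥0) (hw : Tendsto w (𝓝 0) (𝓝 0)) :
    Valuation (Completion A) ℝ≥0 :=
  have hu := uniformContinuous_valuation hw
  have hc : Continuous (Completion.extension w) := Completion.continuous_extension
  { toFun := Completion.extension w
    map_zero' := by
      rw [← Completion.coe_zero, Completion.extension_coe hu, map_zero]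
    map_one' := by
      rw [← Completion.coe_one, Completion.extension_coe hu, map_one]
    map_mul' := fun x y => by
      induction x, y using Completion.induction_on₂ with
      | hp =>
        exact isClosed_eq (hc.comp continuous_mul)
          ((hc.comp continuous_fst).mul (hc.comp continuous_snd))
      | ih a b =>
        rw [← Completion.coe_mul, Completion.extension_coe hu, Completion.extension_coe hu,
          Completion.extension_coe hu, map_mul]
    map_add_le_max' := fun x y => by
      induction x, y using Completion.induction_on₂ with
      | hp =>
        exact isClosed_le (hc.comp continuous_add)
          ((hc.comp continuous_fst).max (hc.comp continuous_snd))
      | ih a b =>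
        rw [← Completion.coe_add, Completion.extension_coe hu, Completion.extension_coe hu,
          Completion.extension_coe hu]
        exact w.map_add a b }

theorem completionValuation_coe {w : Valuation A ℝ≥0} (hw : Tendsto w (𝓝 0) (𝓝 0)) (a : A) :
    completionValuation w hw a = w a :=
  Completion.extension_coe (uniformContinuous_valuation hw) a

theorem continuous_completionValuation {w : Valuation A ℝ≥0} (hw : Tendsto w (𝓝 0) (𝓝 0)) :
    Continuous (completionValuation w hw) :=
  Completion.continuous_extension

variable {ι : Type*} {w : ι → Valuation A ℝ≥0}

theorem tendsto_zero_of_nhds_eq {A : Type*} [CommRing A] [TopologicalSpace A] {ι : Type*}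
    {w : ι → Valuation A ℝ≥0} (hw : 𝓝 (0 : A) = ⨅ t, comap (w t) (𝓝 0)) (t : ι) :
    Tendsto (w t) (𝓝 0) (𝓝 0) := by
  rw [hw]
  exact tendsto_comap.mono_left (iInf_le _ t)

/-- The topology of the completion is defined by the extended valuations. -/
theorem le_nhds_zero_of_completionValuation (hw : 𝓝 (0 : A) = ⨅ t, comap (w t) (𝓝 0))
    {F : Filter (Completion A)}
    (hF : ∀ t, Tendsto (completionValuation (w t) (tendsto_zero_of_nhds_eq hw t)) F (𝓝 0)) :
    F ≤ 𝓝 0 := by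
  intro U hU
  obtain ⟨V, hV, hVc, hVU⟩ := exists_mem_nhds_isClosed_subset hU
  have h1 : ((↑) : A → Completion A) ⁻¹' V ∈ 𝓝 (0 : A) :=
    (Completion.continuous_coe A).continuousAt.preimage_mem_nhds (by rwa [Completion.coe_zero])
  rw [hw, mem_iInf] at h1
  obtain ⟨I, hI, W, hW, hVW⟩ := h1
  have h2 : ∀ i : I, ∃ ε > 0, ∀ a, w i a < ε → a ∈ W i := by
    intro i
    obtain ⟨T, hT, hTW⟩ := mem_comap.mp (hW i)
    obtain ⟨ε, hε, h⟩ := (nhds_bot_basis (α := ℝ≥0)).mem_iff.mp hT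
    exact ⟨ε, hε, fun a ha => hTW (h ha)⟩
  choose ε hε hεW using h2
  let O : Set (Completion A) :=
    ⋂ i : I, {x | completionValuation (w i) (tendsto_zero_of_nhds_eq hw i) x < ε i}
  have : Finite I := hI
  have hO : IsOpen O := isOpen_iInter_of_finite fun i =>
    isOpen_lt (continuous_completionValuation _) continuous_const
  have hOF : O ∈ F := iInter_mem.mpr fun i => (hF i).eventually_lt_const (hε i)
  refine mem_of_superset hOF (Set.Subset.trans ?_ hVU)
  refine (Completion.denseRange_coe.open_subset_closure_inter hO).trans
    (closure_minimal ?_ hVc)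
  rintro _ ⟨hx, a, rfl⟩
  have ha : a ∈ ⋂ i, W i := Set.mem_iInter.mpr fun i => hεW i a (by
    have := Set.mem_iInter.mp hx i
    rwa [Set.mem_ofPred_eq, completionValuation_coe] at this)
  rw [← hVW] at ha
  exact ha

theorem eq_zero_of_completionValuation (hw : 𝓝 (0 : A) = ⨅ t, comap (w t) (𝓝 0))
    {x : Completion A}
    (hx : ∀ t, completionValuation (w t) (tendsto_zero_of_nhds_eq hw t) x = 0) : x = 0 := by
  have h : pure x ≤ 𝓝 (0 : Completion A) := le_nhds_zero_of_completionValuation hw fun t => by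
    rw [tendsto_pure_left]
    intro s hs
    rw [hx]
    exact mem_of_mem_nhds hs
  exact pure_le_nhds_iff.mp h

theorem exists_limit_of_completionValuation (hw : 𝓝 (0 : A) = ⨅ t, comap (w t) (𝓝 0))
    {x : ℕ → Completion A}
    (hx : ∀ t, Tendsto (fun n => completionValuation (w t) (tendsto_zero_of_nhds_eq hw t)
      (x (n + 1) - x n)) atTop (𝓝 0)) :
    ∃ y, ∀ t, Tendsto (fun n => completionValuation (w t) (tendsto_zero_of_nhds_eq hw t)
      (x n - y)) atTop (𝓝 0) := by
  have hc : CauchySeq x := by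
    rw [cauchySeq_iff_tendsto, uniformity_eq_comap_nhds_zero, tendsto_comap_iff]
    refine le_nhds_zero_of_completionValuation hw fun t => ?_
    rw [tendsto_map'_iff, tendsto_order]
    refine ⟨fun a ha => absurd ha not_lt_zero, fun ε hε => ?_⟩
    obtain ⟨N, hN⟩ := eventually_atTop.mp ((hx t).eventually_lt_const hε)
    set v := completionValuation (w t) (tendsto_zero_of_nhds_eq hw t)
    have h1 : ∀ k, v (x (N + k) - x N) < ε := by
      intro k
      induction k with
      | zero => simpa using hε
      | succ k ih =>
        have := v.map_add_lt (hN (N + k) (by omega)) ih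
        rwa [sub_add_sub_cancel] at this
    refine eventually_atTop.mpr ⟨(N, N), fun q hq => ?_⟩
    obtain ⟨k, hk⟩ := Nat.exists_eq_add_of_le hq.1
    obtain ⟨l, hl⟩ := Nat.exists_eq_add_of_le hq.2
    have := v.map_sub_lt (h1 l) (h1 k)
    rwa [sub_sub_sub_cancel_right, ← hk, ← hl] at this
  obtain ⟨y, hy⟩ := cauchySeq_tendsto_of_complete hc
  refine ⟨y, fun t => ?_⟩
  have h := ((continuous_completionValuation (tendsto_zero_of_nhds_eq hw t)).tendsto _).comp
    (hy.sub_const y)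
  rwa [sub_self, map_zero] at h

/-- Simultaneous approximation at two valuations by elements of the dense subring. -/
theorem exists_coe_near {w₁ w₂ : Valuation A ℝ≥0} (h₁ : Tendsto w₁ (𝓝 0) (𝓝 0))
    (h₂ : Tendsto w₂ (𝓝 0) (𝓝 0)) (x : Completion A) {ε : ℝ≥0} (hε : 0 < ε) :
    ∃ a : A, completionValuation w₁ h₁ (x - a) < ε ∧ completionValuation w₂ h₂ (x - a) < ε := by
  have hs : Continuous fun z : Completion A => x - z := continuous_const.sub continuous_id
  have ho : IsOpen {z : Completion A | completionValuation w₁ h₁ (x - z) < ε ∧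
      completionValuation w₂ h₂ (x - z) < ε} := by
    have o₁ := isOpen_lt ((continuous_completionValuation h₁).comp hs) (continuous_const (y := ε))
    have o₂ := isOpen_lt ((continuous_completionValuation h₂).comp hs) (continuous_const (y := ε))
    exact o₁.inter o₂
  exact Completion.denseRange_coe.exists_mem_open ho ⟨x, by simpa using hε⟩

end CompletionValuation

end Overconvergent

/-! ### Valuations on the analytic ring -/

namespace Overconvergent

/-- The extension of a multiplicative nonarchimedean function `N` with `N (q x) = c N x` to a
valuation on the localization away from `q`. -/
noncomputable def awayValuation {A : Type*} [CommRing A] (q : A) (c : ℝ≥0) (hc : c ≠ 0)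
    (N : A → ℝ≥0) (hN0 : N 0 = 0) (hN1 : N 1 = 1)
    (hadd : ∀ x y, N (x + y) ≤ max (N x) (N y)) (hmul : ∀ x y, N (x * y) = N x * N y)
    (hq : ∀ x, N (q * x) = c * N x) : Valuation (Localization.Away q) ℝ≥0 where
  toFun := awayNorm q c hc N hN1 hq
  map_zero' := by
    rw [← Localization.mk_zero (1 : Submonoid.powers q)]
    show N 0 / N (1 : Submonoid.powers q) = 0
    simp [hN0]
  map_one' := by
    rw [← Localization.mk_one]
    show N 1 / N (1 : Submonoid.powers q) = 1
    simp [hN1]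
  map_mul' x y := by
    induction x using Localization.induction_on with
    | H x =>
    induction y using Localization.induction_on with
    | H y =>
      obtain ⟨a, s⟩ := x
      obtain ⟨b, t⟩ := y
      rw [Localization.mk_mul]
      show N (a * b) / N (s * t : Submonoid.powers q) = N a / N s * (N b / N t)
      rw [Submonoid.coe_mul, hmul, hmul, div_mul_div_comm]
  map_add_le_max' x y := by
    induction x using Localization.induction_on with
    | H x =>
    induction y using Localization.induction_on with
    | H y =>
      obtain ⟨a, s⟩ := x
      obtain ⟨b, t⟩ := y
      have nz := away_map_ne_zero q c hc N hN1 hq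
      rw [Localization.add_mk]
      show N (s * b + t * a) / N (s * t : Submonoid.powers q) ≤ max (N a / N s) (N b / N t)
      have hs := pos_iff_ne_zero.mpr (nz s)
      have ht := pos_iff_ne_zero.mpr (nz t)
      rw [Submonoid.coe_mul, hmul, div_le_iff₀ (mul_pos hs ht)]
      refine (hadd _ _).trans (max_le ?_ ?_)
      · rw [hmul, show N s * N b = N b / N t * (N s * N t) by
          rw [div_mul_eq_mul_div, eq_div_iff ht.ne']; ring]
        exact mul_le_mul_left (le_max_right _ _) _
      · rw [hmul, show N t * N a = N a / N s * (N s * N t) by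
          rw [div_mul_eq_mul_div, eq_div_iff hs.ne']; ring]
        exact mul_le_mul_left (le_max_left _ _) _

/-- The radii `0 < s ≤ r` at which elements of `Γ_r` have a Gauss norm. -/
abbrev Radii (r : ℝ≥0) : Type := {s : ℝ≥0 // 0 < s ∧ s ≤ r}

namespace FrobeniusCohenRing

open UniformSpace

variable {p : ℕ} [hp : Fact p.Prime] {E : Type*} [NormedField E] [CharP E p]
  {Γ : Type*} [CommRing Γ] (D : FrobeniusCohenRing p E Γ) [IsUltrametricDist E] {r : ℝ≥0}

/-- The valuation `p ^ (-w_s)` on `Γ_r[p⁻¹]`. -/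
noncomputable def locValuation (s : Radii r) :
    Valuation (D.OverconvergentLoc r) ℝ≥0 :=
  have mem : ∀ x : D.overconvergent r, D.embed x ∈ wittSubring p s :=
    fun x => embed_mem s.2.1 s.2.2 x.2
  awayValuation (p : D.overconvergent r) (p : ℝ≥0)⁻¹
    (inv_ne_zero (Nat.cast_ne_zero.mpr hp.out.ne_zero))
    (fun x => gaussNorm p s (D.embed x))
    (by simp [gaussNorm_zero p s.2.1])
    (by simp [gaussNorm_one p])
    (fun x y => by simpa using gaussNorm_add_le p (mem x) (mem y))
    (fun x y => by simpa using gaussNorm_mul p s.2.1 (mem x) (mem y))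
    (fun x => by simpa using gaussNorm_p_mul p s.2.1 (mem x))

theorem nhds_zero_loc :
    𝓝 (0 : D.OverconvergentLoc r) = ⨅ s, comap (D.locValuation s) (𝓝 0) := by
  have e : (UniformSpace.toTopologicalSpace : TopologicalSpace (D.OverconvergentLoc r)) =
      ⨅ s : Radii r, (D.frechetSeminorm s.2.1
        s.2.2).toSeminormedRing.toPseudoMetricSpace.toUniformSpace.toTopologicalSpace :=
    UniformSpace.toTopologicalSpace_iInf
  rw [e, nhds_iInf]
  refine iInf_congr fun s => ?_
  have h1 : comap (D.locValuation s) (𝓝 0) =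
      comap (fun x => (D.locValuation s x : ℝ)) (𝓝 0) := by
    rw [NNReal.isEmbedding_coe.nhds_eq_comap, Filter.comap_comap]
    rfl
  rw [h1]
  let := (D.frechetSeminorm s.2.1 s.2.2).toSeminormedRing
  exact (comap_norm_nhds_zero (E := D.OverconvergentLoc r)).symm

/-- The valuation `p ^ (-w_s)` on the completion of `Γ_r[p⁻¹]`. -/
noncomputable def anValuation (s : Radii r) :
    Valuation (Completion (D.OverconvergentLoc r)) ℝ≥0 :=
  completionValuation (D.locValuation s) (tendsto_zero_of_nhds_eq D.nhds_zero_loc s)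

theorem continuous_anValuation (s : Radii r) : Continuous (D.anValuation s) :=
  continuous_completionValuation _

variable (r) in
/-- The canonical map from `Γ_r` to the completion of `Γ_r[p⁻¹]`. -/
noncomputable def toAn : D.overconvergent r →+* Completion (D.OverconvergentLoc r) :=
  Completion.coeRingHom.comp
    (algebraMap (D.overconvergent r) (Localization.Away (p : D.overconvergent r)))

theorem anValuation_toAn (s : Radii r) (x : D.overconvergent r) :
    D.anValuation s (D.toAn r x) = gaussNorm p s (D.embed x) := by
  have h : D.anValuation s (D.toAn r x) = D.locValuation s (algebraMap (D.overconvergent r)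
      (Localization.Away (p : D.overconvergent r)) x) := completionValuation_coe _ _
  rw [h, ← Localization.mk_one_eq_algebraMap]
  show gaussNorm p s (D.embed x) / gaussNorm p s (D.embed (1 : D.overconvergent r)) = _
  rw [Subring.coe_one, map_one, gaussNorm_one, div_one]

theorem anValuation_p (s : Radii r) :
    D.anValuation s (p : Completion (D.OverconvergentLoc r)) = (p : ℝ≥0)⁻¹ := by
  have h := D.anValuation_toAn s (p : D.overconvergent r)
  have h1 := gaussNorm_embed_p_mul (D := D) s.2.1 s.2.2 (one_mem (D.overconvergent r))
  rw [mul_one, map_one, gaussNorm_one, mul_one] at h1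
  rwa [map_natCast, Subring.coe_natCast, h1] at h

theorem isUnit_p : IsUnit (p : Completion (D.OverconvergentLoc r)) := by
  have h := (IsLocalization.Away.algebraMap_isUnit (S := Localization.Away
    (p : D.overconvergent r)) (p : D.overconvergent r)).map
      (Completion.coeRingHom (α := D.OverconvergentLoc r))
  have e : D.toAn r p = p := map_natCast _ _
  rwa [← e]

theorem exists_p_pow_mul (y : D.OverconvergentLoc r) : ∃ (m : ℕ) (a : D.overconvergent r),
    (p : Completion (D.OverconvergentLoc r)) ^ m * y = D.toAn r a := by
  obtain ⟨m, a, h⟩ : ∃ (m : ℕ) (a : D.overconvergent r),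
      (p : D.OverconvergentLoc r) ^ m * y = algebraMap (D.overconvergent r)
        (Localization.Away (p : D.overconvergent r)) a := by
    obtain ⟨⟨a, _, m, rfl⟩, h⟩ := IsLocalization.surj
      (Submonoid.powers (p : D.overconvergent r)) (S := Localization.Away
        (p : D.overconvergent r)) y
    refine ⟨m, a, ?_⟩
    rw [← h, mul_comm]
    simp only [map_pow, map_natCast]
    rfl
  refine ⟨m, a, ?_⟩
  have h2 := congrArg (Completion.coeRingHom (α := D.OverconvergentLoc r)) h
  rw [map_mul, map_pow, map_natCast] at h2
  exact h2

theorem anValuation_interpolate {a b t : Radii r} {θ θ' : ℝ} (hθ : 0 < θ)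
    (hθ' : 0 < θ') (h1 : θ + θ' = 1) (ht : ((t : ℝ≥0) : ℝ) = (a : ℝ≥0) * θ + (b : ℝ≥0) * θ')
    (x : Completion (D.OverconvergentLoc r)) :
    D.anValuation t x ≤ D.anValuation a x ^ θ * D.anValuation b x ^ θ' := by
  induction x using Completion.induction_on with
  | hp =>
    exact isClosed_le (D.continuous_anValuation t)
      (((NNReal.continuous_rpow_const hθ.le).comp (D.continuous_anValuation a)).mul
        ((NNReal.continuous_rpow_const hθ'.le).comp (D.continuous_anValuation b)))
  | ih y =>
    obtain ⟨m, z, hz⟩ := D.exists_p_pow_mul y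
    have hP : 0 < (p : ℝ≥0)⁻¹ ^ m := pow_pos (inv_p_pos p) m
    have e : ∀ s : Radii r, gaussNorm p s (D.embed z) =
        (p : ℝ≥0)⁻¹ ^ m * D.anValuation s y := fun s => by
      rw [← anValuation_toAn, ← hz, map_mul, map_pow, anValuation_p]
    have h2 := gaussNorm_interpolate p hθ.le hθ'.le h1 ht
      (embed_mem a.2.1 a.2.2 z.2) (embed_mem b.2.1 b.2.2 z.2)
    rw [e, e, e, NNReal.mul_rpow, NNReal.mul_rpow, mul_mul_mul_comm,
      ← NNReal.rpow_add hP.ne', h1, NNReal.rpow_one] at h2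
    exact le_of_mul_le_mul_left h2 hP

theorem exists_weights {a b t : ℝ} (hat : a < t) (htb : t < b) :
    ∃ θ θ' : ℝ, 0 < θ ∧ 0 < θ' ∧ θ + θ' = 1 ∧ t = a * θ + b * θ' := by
  have h : 0 < b - a := by linarith
  exact ⟨(b - t) / (b - a), (t - a) / (b - a), div_pos (by linarith) h, div_pos (by linarith) h,
    by field_simp; ring, by field_simp; ring⟩

theorem anValuation_le_max {a b t : Radii r} (hat : a ≤ t) (htb : t ≤ b)
    (x : Completion (D.OverconvergentLoc r)) :
    D.anValuation t x ≤ max (D.anValuation a x) (D.anValuation b x) := by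
  rcases hat.eq_or_lt with rfl | hat
  · exact le_max_left _ _
  rcases htb.eq_or_lt with rfl | htb
  · exact le_max_right _ _
  obtain ⟨θ, θ', hθ, hθ', hs, e⟩ := exists_weights (NNReal.coe_lt_coe.mpr hat)
    (NNReal.coe_lt_coe.mpr htb)
  refine (D.anValuation_interpolate hθ hθ' hs e x).trans ?_
  refine (mul_le_mul' (NNReal.rpow_le_rpow (le_max_left _ (D.anValuation b x)) hθ.le)
    (NNReal.rpow_le_rpow (le_max_right (D.anValuation a x) _) hθ'.le)).trans ?_
  rw [← NNReal.rpow_add_of_nonneg _ hθ.le hθ'.le, hs, NNReal.rpow_one]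

/-- For elements of `Γ_r[p⁻¹]`, the function `s ↦ p ^ (-w_s)` is bounded below by an exponential
function with the same value at a given radius. -/
theorem exists_exponential_le (y : D.OverconvergentLoc r) (s : Radii r)
    (hy : D.anValuation s y ≠ 0) : ∃ c d : ℝ≥0, d ≠ 0 ∧
      (∀ t : Radii r, c * d ^ ((t : ℝ≥0) : ℝ) ≤ D.anValuation t y) ∧
      c * d ^ ((s : ℝ≥0) : ℝ) = D.anValuation s y := by
  obtain ⟨m, z, hz⟩ := D.exists_p_pow_mul y
  have hP : ∀ m, 0 < (p : ℝ≥0)⁻¹ ^ m := pow_pos (inv_p_pos p)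
  have e : ∀ s : Radii r, gaussNorm p s (D.embed z) =
      (p : ℝ≥0)⁻¹ ^ m * D.anValuation s y := fun s => by
    rw [← anValuation_toAn, ← hz, map_mul, map_pow, anValuation_p]
  have hs0 : ((s : ℝ≥0) : ℝ) ≠ 0 := by exact_mod_cast s.2.1.ne'
  obtain ⟨i, -, hi, -⟩ := exists_first_index p (embed_mem s.2.1 s.2.2 z.2)
    (by rw [e]; exact mul_ne_zero (hP m).ne' hy)
  have e2 : ∀ t : ℝ≥0, ((p : ℝ≥0)⁻¹ ^ m)⁻¹ * (p : ℝ≥0)⁻¹ ^ i *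
      partialNorm p i (D.embed z) ^ (t : ℝ) =
        ((p : ℝ≥0)⁻¹ ^ m)⁻¹ * gaussTerm p t (D.embed z) i := fun t => by
    rw [gaussTerm, mul_assoc]
  have e3 : ((p : ℝ≥0)⁻¹ ^ m)⁻¹ * (p : ℝ≥0)⁻¹ ^ i *
      partialNorm p i (D.embed z) ^ ((s : ℝ≥0) : ℝ) = D.anValuation s y := by
    rw [e2, hi, e, inv_mul_cancel_left₀ (hP m).ne']
  refine ⟨_, partialNorm p i (D.embed z), fun h => hy ?_, fun t => ?_, e3⟩
  · rw [← e3, h, NNReal.zero_rpow hs0, mul_zero]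
  · rw [e2, inv_mul_le_iff₀ (hP m), ← e]
    exact gaussTerm_le_gaussNorm p (embed_mem t.2.1 t.2.2 z.2) i

end FrobeniusCohenRing
end Overconvergent

/-! ### Expansions in the analytic ring -/

namespace Overconvergent
namespace FrobeniusCohenRing

open UniformSpace

variable {p : ℕ} [hp : Fact p.Prime] {E : Type*} [NormedField E] [CharP E p]
  {Γ : Type*} [CommRing Γ] (D : FrobeniusCohenRing p E Γ) [IsUltrametricDist E] {r : ℝ≥0}

theorem anValuation_eq_zero_of_between {a b t : Radii r} (hat : a < t) (htb : t < b)
    {x : Completion (D.OverconvergentLoc r)} (h : D.anValuation a x = 0 ∨ D.anValuation b x = 0) :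
    D.anValuation t x = 0 := by
  obtain ⟨θ, θ', hθ, hθ', hs, e⟩ := exists_weights (NNReal.coe_lt_coe.mpr hat)
    (NNReal.coe_lt_coe.mpr htb)
  have h1 := D.anValuation_interpolate hθ hθ' hs e x
  rcases h with h | h
  · rw [h, NNReal.zero_rpow hθ.ne', zero_mul] at h1
    exact le_antisymm h1 zero_le
  · rw [h, NNReal.zero_rpow hθ'.ne', mul_zero] at h1
    exact le_antisymm h1 zero_le

/-- Vanishing at all radii smaller than `r` implies vanishing at `r`: an element of `Γ_r[p⁻¹]` close
to `x` at `r` has about the same norm as `x` at `r`, and by log-convexity a smaller one at radii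
close to `r`, which contradicts the exponential lower bound. -/
theorem anValuation_top_eq_zero (hr : 0 < r) {x : Completion (D.OverconvergentLoc r)}
    (h : ∀ t : Radii r, (t : ℝ≥0) < r → D.anValuation t x = 0) :
    D.anValuation ⟨r, hr, le_rfl⟩ x = 0 := by
  set T : Radii r := ⟨r, hr, le_rfl⟩
  by_contra h0
  obtain ⟨y, hy, -⟩ := exists_coe_near (tendsto_zero_of_nhds_eq D.nhds_zero_loc T)
    (tendsto_zero_of_nhds_eq D.nhds_zero_loc T) x (pos_iff_ne_zero.mpr h0)
  change D.anValuation T (x - y) < D.anValuation T x at hy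
  have hyx : D.anValuation T y = D.anValuation T x := by
    have := (D.anValuation T).map_sub_eq_of_lt_left hy
    rwa [sub_sub_cancel] at this
  obtain ⟨c, d, hd, hcd, hcT⟩ := D.exists_exponential_le y T (hyx ▸ h0)
  obtain ⟨β, hβ, hβ'⟩ := exists_between hy
  have hr' : (0 : ℝ) < r := by exact_mod_cast hr
  let a : Radii r := ⟨r / 2, half_pos hr, half_le_self zero_le⟩
  set B := max (D.anValuation a (x - y)) 1
  let θ : ℕ → ℝ := fun n => ((n : ℝ) + 2)⁻¹
  have hθ0 : ∀ n, 0 < θ n := fun n => by positivity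
  have hθ1 : ∀ n, 0 < 1 - θ n := fun n => by
    rw [sub_pos]
    exact inv_lt_one_of_one_lt₀ (by have : (0 : ℝ) ≤ n := n.cast_nonneg; linarith)
  have hθ : Tendsto θ atTop (𝓝 0) :=
    tendsto_inv_atTop_zero.comp (tendsto_atTop_add_const_right _ _ tendsto_natCast_atTop_atTop)
  have hle : ∀ n, c * d ^ ((r : ℝ) / 2 * θ n + r * (1 - θ n)) ≤ B ^ θ n * β ^ (1 - θ n) := by
    intro n
    have ht0 : 0 < (r : ℝ) / 2 * θ n + r * (1 - θ n) :=
      add_pos (mul_pos (half_pos hr') (hθ0 n)) (mul_pos hr' (hθ1 n))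
    have ht1 : (r : ℝ) / 2 * θ n + r * (1 - θ n) < r := by
      nlinarith [mul_pos hr' (hθ0 n)]
    let t : Radii r := ⟨⟨_, ht0.le⟩, ht0, ht1.le⟩
    have h1 : D.anValuation t y ≤ D.anValuation t (x - y) := by
      have := (D.anValuation t).map_sub x (x - y)
      rwa [sub_sub_cancel, h t ht1, max_eq_right zero_le] at this
    have h2 := D.anValuation_interpolate (a := a) (b := T) (t := t) (hθ0 n) (hθ1 n) (by ring)
      (by simp [t, a, T]; rfl) (x - y)
    refine (hcd t).trans (h1.trans (h2.trans (mul_le_mul' ?_ ?_)))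
    · exact NNReal.rpow_le_rpow (le_max_left _ _) (hθ0 n).le
    · exact NNReal.rpow_le_rpow hβ.le (hθ1 n).le
  have hB : B ≠ 0 := (zero_lt_one.trans_le (le_max_right _ _)).ne'
  have hβ0 : β ≠ 0 := (zero_le.trans_lt hβ).ne'
  have lim1 : Tendsto (fun n => c * d ^ ((r : ℝ) / 2 * θ n + r * (1 - θ n))) atTop
      (𝓝 (c * d ^ (r : ℝ))) := by
    have := (hθ.const_mul ((r : ℝ) / 2)).add ((hθ.const_sub 1).const_mul (r : ℝ))
    simp only [mul_zero, sub_zero, mul_one, zero_add] at this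
    exact (tendsto_const_nhds.nnrpow this (.inl hd)).const_mul c
  have lim2 : Tendsto (fun n => B ^ θ n * β ^ (1 - θ n)) atTop (𝓝 β) := by
    have h1 := (tendsto_const_nhds (x := B)).nnrpow hθ (.inl hB)
    have h2 := (tendsto_const_nhds (x := β)).nnrpow (hθ.const_sub 1) (.inl hβ0)
    simpa using h1.mul h2
  have h1 := le_of_tendsto_of_tendsto' lim1 lim2 hle
  rw [show c * d ^ (r : ℝ) = _ from hcT, hyx] at h1
  exact absurd hβ' (not_lt.mpr h1)

/-- Each valuation on the analytic ring is an absolute value: by log-convexity, vanishing at one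
radius spreads to all radii smaller than `r`. -/
theorem eq_zero_of_anValuation_eq_zero {a : Radii r} {x : Completion (D.OverconvergentLoc r)}
    (h : D.anValuation a x = 0) : x = 0 := by
  have hr : 0 < r := a.2.1.trans_le a.2.2
  have h1 : ∀ t : Radii r, (t : ℝ≥0) < r → D.anValuation t x = 0 := by
    intro t ht
    rcases lt_trichotomy t a with hta | rfl | hat
    · let b : Radii r := ⟨t / 2, half_pos t.2.1, (half_le_self zero_le).trans t.2.2⟩
      exact D.anValuation_eq_zero_of_between (a := b)
        (show (b : ℝ≥0) < t from NNReal.half_lt_self t.2.1.ne') hta (.inr h)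
    · exact h
    · exact D.anValuation_eq_zero_of_between (b := ⟨r, hr, le_rfl⟩) hat ht (.inl h)
  refine eq_zero_of_completionValuation D.nhds_zero_loc fun t => ?_
  rcases t.2.2.lt_or_eq with ht | ht
  · exact h1 t ht
  · have : t = ⟨r, hr, le_rfl⟩ := Subtype.ext ht
    rw [this]
    exact D.anValuation_top_eq_zero hr h1

variable {D} {r₀ : ℝ≥0}

theorem exists_inv_nearUnit (h : r < r₀) {x : D.overconvergent r}
    (hx : (x : Γ) ∈ D.nearUnits r₀) :
    ∃ y : D.overconvergent r, (y : Γ) ∈ D.nearUnits r₀ ∧ x * y = 1 := by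
  obtain ⟨y, hy, hxy⟩ := exists_inv_mem_nearUnits (zero_le.trans_lt h) hx
  exact ⟨⟨y, mem_overconvergent_of_mem_nearUnits h hy⟩, hy, Subtype.ext hxy⟩

variable (D) in
/-- The group of units of the analytic ring given by near units. -/
noncomputable def nearUnitGroup (h : r < r₀) : Subgroup (Completion (D.OverconvergentLoc r))ˣ where
  carrier := {u | ∃ x : D.overconvergent r, (x : Γ) ∈ D.nearUnits r₀ ∧ (u : _) = D.toAn r x}
  one_mem' := ⟨1, one_mem_nearUnits, by simp⟩
  mul_mem' := by
    rintro u v ⟨x, hx, hu⟩ ⟨y, hy, hv⟩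
    exact ⟨x * y, mul_mem_nearUnits hx hy, by rw [Units.val_mul, hu, hv, map_mul]⟩
  inv_mem' := by
    rintro u ⟨x, hx, hu⟩
    obtain ⟨y, hy, hxy⟩ := exists_inv_nearUnit h hx
    refine ⟨y, hy, Units.inv_eq_of_mul_eq_one_right ?_⟩
    rw [hu, ← map_mul, hxy, map_one]

theorem eq_zero_or_mem_nearUnitGroup_iff (h : r < r₀) {x : Completion (D.OverconvergentLoc r)} :
    (x = 0 ∨ ∃ u ∈ D.nearUnitGroup h, x = u) ↔
      ∃ a : D.overconvergent r, ((a : Γ) = 0 ∨ (a : Γ) ∈ D.nearUnits r₀) ∧ x = D.toAn r a := by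
  constructor
  · rintro (rfl | ⟨u, ⟨a, ha, hu⟩, rfl⟩)
    · exact ⟨0, .inl rfl, (map_zero _).symm⟩
    · exact ⟨a, .inr ha, hu⟩
  · rintro ⟨a, ha | ha, rfl⟩
    · left
      rw [show a = 0 from Subtype.ext ha, map_zero]
    · obtain ⟨b, -, hab⟩ := exists_inv_nearUnit h ha
      refine .inr ⟨⟨D.toAn r a, D.toAn r b, ?_, ?_⟩, ⟨a, ha, rfl⟩, rfl⟩
      · rw [← map_mul, hab, map_one]
      · rw [mul_comm, ← map_mul, hab, map_one]

/-- Every element of the analytic ring is approximated, uniformly at radii bounded below, by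
a finite sum of elements `p ^ k u_k`. -/
theorem exists_anExpansion (h₀ : D.HasEnoughUnits r₀) (hr : 0 < r) (h : r < r₀)
    {π : (Completion (D.OverconvergentLoc r))ˣ} (hπ : (π : Completion (D.OverconvergentLoc r)) = p)
    (x : Completion (D.OverconvergentLoc r)) (s : Radii r) {ε : ℝ≥0} (hε : 0 < ε) :
    ∃ (F : Finset ℤ) (f : ℤ → Completion (D.OverconvergentLoc r)),
      (∀ k, f k = 0 ∨ ∃ u ∈ D.nearUnitGroup h, f k = u) ∧ (∀ k ∉ F, f k = 0) ∧
      ∀ t, s ≤ t →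
        (∀ k, D.anValuation t ((π ^ k : (Completion (D.OverconvergentLoc r))ˣ) * f k) ≤
          max (D.anValuation t x) ε) ∧
        D.anValuation t (x - ∑ k ∈ F, (π ^ k : (Completion (D.OverconvergentLoc r))ˣ) * f k) ≤
          ε := by
  classical
  set T : Radii r := ⟨r, hr, le_rfl⟩
  obtain ⟨y, hys, hyT⟩ := exists_coe_near (tendsto_zero_of_nhds_eq D.nhds_zero_loc s)
    (tendsto_zero_of_nhds_eq D.nhds_zero_loc T) x hε
  change D.anValuation s (x - y) < ε at hys
  change D.anValuation T (x - y) < ε at hyT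
  obtain ⟨m, a, ha⟩ := D.exists_p_pow_mul y
  have hP : 0 < (p : ℝ≥0)⁻¹ ^ m := pow_pos (inv_p_pos p) m
  have hs' : (0 : ℝ) < (s : ℝ≥0) := by exact_mod_cast s.2.1
  have hr' : (0 : ℝ) < r := by exact_mod_cast hr
  -- a bound `η` at radius `r` such that `η ^ (s / r) ≤ p ^ (-m) * ε`
  set η : ℝ≥0 := min 1 (((p : ℝ≥0)⁻¹ ^ m * ε) ^ ((r : ℝ) / (s : ℝ≥0)))
  have hη : 0 < η := lt_min zero_lt_one (NNReal.rpow_pos (mul_pos hP hε))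
  obtain ⟨K, u, hu, hub, hsum⟩ := exists_digit_expansion h₀ hr h a.2 hη
  have hum : ∀ k, u k ∈ D.overconvergent r := fun k => by
    rcases hu k with h1 | h1
    · rw [h1]; exact zero_mem _
    · exact mem_overconvergent_of_mem_nearUnits h h1
  let U : ℕ → D.overconvergent r := fun k => ⟨u k, hum k⟩
  let q : ℕ ↪ ℤ := ⟨fun k => (k : ℤ) - m, fun k l hkl => by simpa using hkl⟩
  let F : Finset ℤ := (Finset.range K).map q
  let f : ℤ → Completion (D.OverconvergentLoc r) := fun j =>
    if j ∈ F then D.toAn r (U (j + m).toNat) else 0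
  have hfq : ∀ k ∈ Finset.range K, f (q k) = D.toAn r (U k) := fun k hk => by
    have : q k ∈ F := Finset.mem_map_of_mem q hk
    simp only [f, if_pos this]
    rw [show q k = (k : ℤ) - m from rfl, sub_add_cancel, Int.toNat_natCast]
  set Q : (Completion (D.OverconvergentLoc r))ˣ := (π ^ m)⁻¹
  have hQm : (p : Completion (D.OverconvergentLoc r)) ^ m * Q = 1 := by
    rw [← hπ, ← Units.val_pow_eq_pow_val]; exact Units.mul_inv _
  have hyQ : (y : Completion (D.OverconvergentLoc r)) = Q * D.toAn r a := by
    rw [← ha]; linear_combination (-(y : Completion (D.OverconvergentLoc r))) * hQm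
  have hq : ∀ k, ((π ^ q k : (Completion (D.OverconvergentLoc r))ˣ) :
      Completion (D.OverconvergentLoc r)) = Q * p ^ k := fun k => by
    have : π ^ q k = Q * π ^ k := by
      rw [show q k = (k : ℤ) - m from rfl, zpow_sub, zpow_natCast, zpow_natCast, mul_comm]
    rw [this, Units.val_mul, Units.val_pow_eq_pow_val, hπ]
  have vQ : ∀ t, D.anValuation t (Q : Completion (D.OverconvergentLoc r)) =
      ((p : ℝ≥0)⁻¹ ^ m)⁻¹ := fun t => by
    have h1 := congrArg (D.anValuation t) hQm
    rw [map_mul, map_pow, anValuation_p, map_one] at h1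
    exact eq_inv_of_mul_eq_one_right h1
  refine ⟨F, f, fun k => ?_, fun k hk => if_neg hk, fun t hst => ?_⟩
  · rw [eq_zero_or_mem_nearUnitGroup_iff]
    by_cases hk : k ∈ F
    · exact ⟨U (k + m).toNat, hu _, if_pos hk⟩
    · exact ⟨0, .inl rfl, by rw [map_zero]; exact if_neg hk⟩
  have hxy : D.anValuation t (x - y) ≤ ε :=
    (D.anValuation_le_max hst (show t ≤ T from t.2.2) _).trans (max_le hys.le hyT.le)
  constructor
  · intro k
    by_cases hk : k ∈ F
    · obtain ⟨k, hkK, rfl⟩ := Finset.mem_map.mp hk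
      have h1 : D.anValuation t (Q * p ^ k * D.toAn r (U k)) ≤ D.anValuation t y := by
        rw [hyQ, mul_assoc, map_mul, map_mul, map_mul, map_pow, anValuation_p, anValuation_toAn,
          anValuation_toAn]
        exact mul_le_mul_right (hub t t.2.1 t.2.2 k) _
      rw [hq, hfq k hkK]
      refine h1.trans ?_
      have h2 := (D.anValuation t).map_sub x (x - y)
      rw [sub_sub_cancel] at h2
      exact h2.trans (max_le_max le_rfl hxy)
    · rw [show f k = 0 from if_neg hk, mul_zero, map_zero]
      exact zero_le
  · have e : x - ∑ k ∈ F, (π ^ k : (Completion (D.OverconvergentLoc r))ˣ) * f k =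
        (x - y) + Q * D.toAn r (a - ∑ k ∈ Finset.range K, (p : D.overconvergent r) ^ k * U k) := by
      rw [Finset.sum_map, map_sub, map_sum, mul_sub, ← hyQ, Finset.mul_sum, sub_add_sub_cancel]
      congr 1
      refine Finset.sum_congr rfl fun k hk => ?_
      rw [hfq k hk, hq, map_mul, map_pow, map_natCast, mul_assoc]
    rw [e]
    refine (D.anValuation t).map_add_le hxy ?_
    rw [map_mul, vQ, anValuation_toAn, inv_mul_le_iff₀ hP]
    have ec : ((a - ∑ k ∈ Finset.range K, (p : D.overconvergent r) ^ k * U k :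
        D.overconvergent r) : Γ) = a - ∑ k ∈ Finset.range K, (p : Γ) ^ k * u k := by
      simp [U]
    have hm : D.embed (a - ∑ k ∈ Finset.range K, (p : D.overconvergent r) ^ k * U k :
        D.overconvergent r) ∈ wittSubring p r := Subtype.prop (p := (· ∈ D.overconvergent r)) _
    rw [← ec] at hsum
    calc _ ≤ _ := gaussNorm_le_rpow p t.2.1 t.2.2 hm
      _ ≤ η ^ (((t : ℝ≥0) : ℝ) / r) := NNReal.rpow_le_rpow hsum (by positivity)
      _ ≤ η ^ (((s : ℝ≥0) : ℝ) / r) := by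
        refine NNReal.rpow_le_rpow_of_exponent_ge hη (min_le_left _ _) ?_
        have : ((s : ℝ≥0) : ℝ) ≤ (t : ℝ≥0) := NNReal.coe_le_coe.mpr hst
        gcongr
      _ ≤ ((((p : ℝ≥0)⁻¹ ^ m * ε) ^ ((r : ℝ) / (s : ℝ≥0)))) ^ (((s : ℝ≥0) : ℝ) / r) :=
        NNReal.rpow_le_rpow (min_le_right _ _) (by positivity)
      _ = (p : ℝ≥0)⁻¹ ^ m * ε := by
        rw [← NNReal.rpow_mul, div_mul_div_cancel₀ hs'.ne', div_self hr'.ne', NNReal.rpow_one]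

end FrobeniusCohenRing
end Overconvergent

/-! ### The analytic ring is a ring with semiunits -/

namespace Overconvergent
namespace FrobeniusCohenRing

open UniformSpace

variable {p : ℕ} [hp : Fact p.Prime] {E : Type*} [NormedField E] [CharP E p]
  {Γ : Type*} [CommRing Γ] (D : FrobeniusCohenRing p E Γ) [IsUltrametricDist E] {r r₀ : ℝ≥0}

/-- The analytic ring `Γ_{an,r}` is a ring with semiunits. -/
noncomputable def semiunitRing (h₀ : D.HasEnoughUnits r₀) (hr : 0 < r) (h : r < r₀) :
    SemiunitRing (Completion (D.OverconvergentLoc r)) where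
  r := r
  r_pos := hr
  v t := D.anValuation ⟨⟨t, t.2.1.le⟩, t.2.1, t.2.2⟩
  eq_zero_of_v hx := D.eq_zero_of_anValuation_eq_zero hx
  v_le_max x hst htu := D.anValuation_le_max hst htu x
  exists_limit x hx := by
    obtain ⟨y, hy⟩ := exists_limit_of_completionValuation D.nhds_zero_loc (x := x)
      fun t => hx ⟨t, t.2.1, t.2.2⟩
    exact ⟨y, fun t => hy _⟩
  P := p
  one_lt_P := by exact_mod_cast hp.out.one_lt
  π := D.isUnit_p.unit
  v_π t := D.anValuation_p _
  G := D.nearUnitGroup h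
  neg_one_mem := ⟨-1, neg_mem_nearUnits one_mem_nearUnits, by simp⟩
  exists_abs := by
    rintro u ⟨x, hx, hu⟩
    refine ⟨‖D.residue x‖₊, fun t => ?_⟩
    rw [hu, anValuation_toAn]
    exact gaussNorm_of_mem_nearUnits t.2.1 t.2.2 h hx
  δ := decay p r r₀
  δ_pos := decay_pos r r₀
  δ_lt_one := decay_lt_one h
  exists_add x y hx hy := by
    obtain ⟨a, ha, rfl⟩ := (eq_zero_or_mem_nearUnitGroup_iff h).mp hx
    obtain ⟨b, hb, rfl⟩ := (eq_zero_or_mem_nearUnitGroup_iff h).mp hy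
    obtain ⟨c, hc, habc⟩ := exists_add_nearUnits h₀ h ha hb
    have hcm : c ∈ D.overconvergent r := by
      rcases hc with rfl | hc
      · exact zero_mem _
      · exact mem_overconvergent_of_mem_nearUnits h hc
    refine ⟨D.toAn r ⟨c, hcm⟩, (eq_zero_or_mem_nearUnitGroup_iff h).mpr ⟨⟨c, hcm⟩, hc, rfl⟩,
      fun t => ?_⟩
    rw [← map_add, ← map_sub, anValuation_toAn, anValuation_toAn, anValuation_toAn,
      anValuation_toAn]
    exact habc _ t.2.1 t.2.2
  O := (D.toAn r).range
  π_mem := ⟨p, map_natCast _ _⟩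
  mem_O := by
    rintro u ⟨x, -, hu⟩
    exact ⟨x, hu.symm⟩
  v_le_rpow := by
    rintro _ ⟨x, rfl⟩ s t hst
    rw [anValuation_toAn, anValuation_toAn]
    exact gaussNorm_le_rpow p s.2.1 hst (embed_mem t.2.1 t.2.2 x.2)
  v_le_add := by
    rintro u ⟨x, hx, hu⟩ _ ⟨y, rfl⟩ t
    have e : (u : Completion (D.OverconvergentLoc r)) +
        (D.isUnit_p (r := r)).unit.val * D.toAn r y =
        D.toAn r (x + p * y) := by
      rw [hu, map_add, map_mul, map_natCast]
      rfl
    rw [e, hu, anValuation_toAn, anValuation_toAn]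
    exact gaussNorm_le_add_p_mul t.2.1 t.2.2 h hx y.2
  exists_expansion x s ε hε := by
    obtain ⟨F, f, h1, h2, h3⟩ := exists_anExpansion h₀ hr h D.isUnit_p.unit_spec x
      ⟨⟨s, s.2.1.le⟩, s.2.1, s.2.2⟩ hε
    exact ⟨F, f, h1, h2, fun t ht => h3 _ ht⟩

end FrobeniusCohenRing
end Overconvergent

theorem lemma2p0p6 (p : ℕ) [Fact p.Prime]
    (E : Type u) [NormedField E] [IsUltrametricDist E] [CompleteSpace E] [CharP E p]
    (hE : PerfectField E ∨ Overconvergent.IsDiscretelyNormed E)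
    (Γ : Type v) [CommRing Γ] (D : Overconvergent.FrobeniusCohenRing p E Γ)
    (r₀ r : ℝ≥0) (h₀ : D.HasEnoughUnits r₀) (hr : 0 < r) (hrr₀ : r < r₀) :
    Overconvergent.IsAdequate (D.Analytic r) ∧
      Overconvergent.ElementaryDivisorTheorem.{w} (D.Analytic r) := by
  have h : Overconvergent.IsAdequate (D.Analytic r) := (D.semiunitRing h₀ hr hrr₀).isAdequate
  exact ⟨h, h.elementaryDivisorTheorem⟩
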